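/- **Setting.** Let $n\ge 0$ and let $J=J^1(\mathbb R^n)\cong\mathbb R^{2n+1}$ have coordinates $z=(x,u,p)$ and contact form $\alpha=du-p_i\,dx^i$. The contact vector field of $H:J\to\mathbb R$ is $$X_H=\frac{\partial H}{\partial p_i}\,\partial_{x^i}-\Big(\frac{\partial H}{\partial x^i}+p_i\frac{\partial H}{\partial u}\Big)\partial_{p_i}+\Big(p_i\frac{\partial H}{\partial p_i}-H\Big)\partial_u,$$ and $\Phi_H^t$ is its flow. The contact–Jacobi bracket is $$[H,K]=\sum_i\big(H_{p_i}K_{x^i}-H_{x^i}K_{p_i}\big)+H_u\,(K-p\cdot K_p)-K_u\,(H-p\cdot H_p).$$ A smooth $H$ is *strict* if $\partial H/\partial u=0$, and *prolonged* if $H=f(x,u)+g^i(x,u)p_i$ with smooth $f,g^i$. Let $P^{(N)}$ be the set of $\sum_{|a|\le N}f_a(x,u)p^a$ with smooth $f_a$. Put $\|f\|_{C^r(U)}=\max_{k\le r}\sup_{z\in U}\|D^kf(z)\|$. **Theorem (Local Universal Approximation).** (1) Every $G\in P^{(N)}$ has a representation $G=s_0+d_0+\sum_{i=1}^m[s_i,d_i]$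 with finite $m$, strict $s_i$ and prolonged $d_i$. (2) To each such representation and each order $p\in\mathbb N$ one can assign a finite list of factors $(g_j,c_j,q_j)$ with $g_j\in\{s_0,d_0,s_i,d_i\}$, $c_j\in\mathbb R$, $q_j>0$, such that the compositions $\Psi_h=\Psi^{(p)}_{N,h}$ of the exact flows $\Phi_{g_j}^{c_jh^{q_j}}$ have the following properties. Let $r\ge 0$ be an integer, $U\subset J$ compact and $T>0$, and let $G=H^{(N)}\in P^{(N)}$ be given with a representation, and $p\in\mathbb N$. There are $C_{\rm split}>0$, $h_0>0$ and an open $W\supset U$ such that for $0<h<h_0$ the map $\Psi_h$ is defined on $W$ and is a contactomorphism of $W$ onto its image ($\Psi_h^*\alpha=e^{\lambda}\alpha$). Moreover, let $K\subset U$ be compact (for instance $K=U$) such that the flow of $H^{(N)}$ exists on $[0,T]$ for initial values near $K$ and the trajectories from $K$ remain in $U$. Then $\Phi^t_{H^{(N)}}$ is $C^r$ at the points of $K$ for $0\le t\le T$, and for all $0<h<h_0$ and all integers $k\ge0$ with $kh\le T$ one has $\Psi_h^k(K)\subset W$ and $$\big\|\Phi_{H^{(N)}}^{kh}-\Psi_h^k\big\|_{C^r(K)}\le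 C_{\rm split}\,h^p .$$ (3) In the situation of (2) let $H$ be $C^{r+1}$ on a neighbourhood of $U$, with $X_H$ locally Lipschitz there (automatic if $r\ge1$), such that the flow of $H$ exists on $[0,T]$ for initial values near $K$ and the trajectories from $K$ remain in $U$. Put $\varepsilon_N=\|H-H^{(N)}\|_{C^{r+1}(U)}$. Then $\Phi_H^t$ is $C^r$ at the points of $K$ for $0\le t\le T$. If $B\ge 0$ is such that $\varepsilon_N\le B$ and at least one of $D^{r+1}H$, $D^{r+1}H^{(N)}$ is $B$-Lipschitz on $U$, then $$\big\|\Phi_{H}^{kh}-\Psi_h^k\big\|_{C^r(K)}\le C_{\rm approx}\,\varepsilon_N+C_{\rm split}\,h^p\qquad(0<h<h_0,\ kh\le T),$$ where $C_{\rm approx}>0$ depends only on $H,U,T,r,B$, and $C_{\rm split}$, $h_0$ are those of (2), which depend on neither $H$ nor $K$. Furthermore, for each $\varepsilon>0$ there is $\delta>0$, depending only on $H,U,T,r,\varepsilon$, such that $\varepsilon_N<\delta$ implies $\|\Phi_H^{kh}-\Psi_h^k\|_{C^r(K)}<\varepsilon$ for all sufficiently small $h>0$ and all $kh\le T$. (4)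 If, for $r,U,T$ and compact $K\subset U$ as above, $H$ is as in (3) and its trajectories from $K$ remain in the interior of $U$ on $[0,T]$, then for every $\varepsilon>0$ and every $p$ there are $N<\infty$, $H^{(N)}\in P^{(N)}$ with $\varepsilon_N<\varepsilon$ whose flow exists on $[0,T]$ near $K$ with trajectories from $K$ remaining in $U$, a representation of $H^{(N)}$, and $h_0>0$, such that $\Psi_h$ is, for $0<h<h_0$, a contact map on an open set $W\supset U$ with $\Psi_h^k(K)\subset W$ and $\|\Phi_H^{kh}-\Psi_h^k\|_{C^r(K)}<\varepsilon$ for all $kh\le T$. -/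

import Mathlib

open Set Filter Topology
open scoped ENNReal NNReal ContDiff

noncomputable section

/-- The jet space `J¹(ℝⁿ) ≅ ℝ^{2n+1}` in its global Darboux coordinates `z = (x, u, p)`. -/
abbrev J1 (n : ℕ) : Type := (Fin n → ℝ) × ℝ × (Fin n → ℝ)

namespace J1

variable {n : ℕ}

/-- `∂H/∂xⁱ` at `z`. -/
def dx (H : J1 n → ℝ) (i : Fin n) (z : J1 n) : ℝ := fderiv ℝ H z (Pi.single i 1, 0, 0)

/-- `∂H/∂u` at `z`. -/
def du (H : J1 n → ℝ) (z : J1 n) : ℝ := fderiv ℝ H z (0, 1, 0)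

/-- `∂H/∂pᵢ` at `z`. -/
def dp (H : J1 n → ℝ) (i : Fin n) (z : J1 n) : ℝ := fderiv ℝ H z (0, 0, Pi.single i 1)

/-- The standard contact form `α = du - pᵢ dxⁱ`, at the point `z` on the tangent vector `v`. -/
def contactForm (z v : J1 n) : ℝ := v.2.1 - ∑ i, z.2.2 i * v.1 i

/-- The contact Hamiltonian vector field
`X_H = H_p ∂_x - (H_x + p H_u) ∂_p + (p H_p - H) ∂_u`. -/
def contactField (H : J1 n → ℝ) (z : J1 n) : J1 n :=
  (fun i => dp H i z,
   (∑ i, z.2.2 i * dp H i z) - H z,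
   fun i => -(dx H i z + z.2.2 i * du H z))

/-- The Poisson bracket `{f, g} = f_p g_x - f_x g_p`. -/
def poisson (f g : J1 n → ℝ) (z : J1 n) : ℝ :=
  ∑ i, (dp f i z * dx g i z - dx f i z * dp g i z)

/-- The Euler operator `f ↦ f - p f_p`. -/
def euler (f : J1 n → ℝ) (z : J1 n) : ℝ := f z - ∑ i, z.2.2 i * dp f i z

/-- The contact-Jacobi bracket `[H, K] = {H, K} + H_u (K - p K_p) - K_u (H - p H_p)`. -/
def jacobi (H K : J1 n → ℝ) (z : J1 n) : ℝ :=
  poisson H K z + du H z * euler K z - du K z * euler H z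

/-- Strict contact Hamiltonians: smooth, with `∂H/∂u = 0`. -/
def strictHam (n : ℕ) : Set (J1 n → ℝ) :=
  {H | ContDiff ℝ ∞ H ∧ ∀ z, du H z = 0}

/-- Prolonged Hamiltonians: affine in `p`, `H = f(x,u) + gⁱ(x,u) pᵢ` with `f`, `gⁱ` smooth. -/
def prolongedHam (n : ℕ) : Set (J1 n → ℝ) :=
  {H | ∃ (f : (Fin n → ℝ) × ℝ → ℝ) (g : Fin n → (Fin n → ℝ) × ℝ → ℝ),
    ContDiff ℝ ∞ f ∧ (∀ i, ContDiff ℝ ∞ (g i)) ∧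
    ∀ x u p, H (x, u, p) = f (x, u) + ∑ i, g i (x, u) * p i}

/-- `P^(k)`: Hamiltonians `∑_{|a| ≤ k} f_a(x,u) p^a` with smooth coefficients. A multi-index with
`|a| ≤ k` has all its entries in `{0, …, k}`. -/
def polyHam (n k : ℕ) : Set (J1 n → ℝ) :=
  {H | ∃ f : (Fin n → Fin (k + 1)) → (Fin n → ℝ) × ℝ → ℝ,
    (∀ a, ContDiff ℝ ∞ (f a)) ∧
    ∀ x u p, H (x, u, p) =
      ∑ a : Fin n → Fin (k + 1) with ∑ i, (a i : ℕ) ≤ k,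
        f a (x, u) * ∏ i, p i ^ (a i : ℕ)}

/-- The data of an expression `s₀ + d₀ + ∑ᵢ [sᵢ, dᵢ]` with strict `sᵢ` and prolonged `dᵢ`. -/
structure DepthOne (n : ℕ) where
  m : ℕ
  s₀ : J1 n → ℝ
  d₀ : J1 n → ℝ
  s : Fin m → J1 n → ℝ
  d : Fin m → J1 n → ℝ
  s₀_mem : s₀ ∈ strictHam n
  d₀_mem : d₀ ∈ prolongedHam n
  s_mem : ∀ i, s i ∈ strictHam n
  d_mem : ∀ i, d i ∈ prolongedHam n

/-- The Hamiltonian `s₀ + d₀ + ∑ᵢ [sᵢ, dᵢ]`. -/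
def DepthOne.ham (R : DepthOne n) (z : J1 n) : ℝ :=
  R.s₀ z + R.d₀ z + ∑ i, jacobi (R.s i) (R.d i) z

/-- The set of the generators `s₀, d₀, sᵢ, dᵢ`. -/
def DepthOne.generators (R : DepthOne n) : Set (J1 n → ℝ) :=
  {R.s₀, R.d₀} ∪ range R.s ∪ range R.d

/-- `‖f‖_{C^r(U)} = max_{k ≤ r} sup_{z ∈ U} ‖D^k f(z)‖`, with values in `[0, ∞]`. -/
def cNorm {F : Type*} [NormedAddCommGroup F] [NormedSpace ℝ F]
    (r : ℕ) (U : Set (J1 n)) (f : J1 n → F) : ℝ≥0∞ :=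
  ⨆ (k : ℕ) (_ : k ≤ r) (z : J1 n) (_ : z ∈ U), ‖iteratedFDeriv ℝ k f z‖ₑ

/-- `H` is `C^{r+1}` on a neighbourhood of `U`, and its contact vector field is locally Lipschitz
there. The second condition follows from the first one if `r ≥ 1`; for `r = 0` it is what makes
the flow of `H` well defined. -/
def RegularNear (r : ℕ) (U : Set (J1 n)) (H : J1 n → ℝ) : Prop :=
  ∃ V : Set (J1 n), IsOpen V ∧ U ⊆ V ∧ ContDiffOn ℝ (r + 1) H V ∧
    LocallyLipschitzOn V (contactField H)

/-- `Φ` is the flow of the vector field `X` on `[0, T]` for the initial values near `K`, and the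
trajectories that start in `K` remain in `U`. -/
structure IsConfinedFlow (X : J1 n → J1 n) (K U : Set (J1 n)) (T : ℝ) (Φ : ℝ → J1 n → J1 n) :
    Prop where
  flow : ∀ᶠ z in 𝓝ˢ K, Φ 0 z = z ∧ IsIntegralCurveOn (fun t => Φ t z) (fun _ => X) (Icc 0 T)
  mem : ∀ z ∈ K, ∀ t ∈ Icc 0 T, Φ t z ∈ U

/-- The exact flow of `X` for the (positive or negative) time `τ` is defined at `z`, and takes
`z` to `w`. -/
def FlowsTo (X : J1 n → J1 n) (τ : ℝ) (z w : J1 n) : Prop :=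
  ∃ γ : ℝ → J1 n, γ 0 = z ∧ γ τ = w ∧ IsIntegralCurveOn γ (fun _ => X) (uIcc 0 τ)

/-- A factor of a composition scheme: the exact contact flow of the Hamiltonian `gen` for the
time `coeff * h ^ expo`, where `h` is the step size. -/
structure Factor (n : ℕ) where
  gen : J1 n → ℝ
  coeff : ℝ
  expo : ℝ

/-- The composition of the factors of the list, the first one applied first, is defined at `z`
for the step size `h`, and takes `z` to `w`. -/
def Realizes : List (Factor n) → ℝ → J1 n → J1 n → Prop
  | [], _, z, w => w = z
  | f :: l, h, z, w =>
      ∃ y, FlowsTo (contactField f.gen) (f.coeff * h ^ f.expo) z y ∧ Realizes l h y w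

/-- `ψ` is a contactomorphism from the open set `W` onto its image: a smooth embedding with
`ψ^*α = e^λ α`. -/
structure IsContactMapOn (ψ : J1 n → J1 n) (W : Set (J1 n)) : Prop where
  smooth : ContDiffOn ℝ ∞ ψ W
  injOn : InjOn ψ W
  bijective : ∀ z ∈ W, Function.Bijective (fderiv ℝ ψ z)
  conformal : ∃ lam : J1 n → ℝ, ∀ z ∈ W, ∀ v,
    contactForm (ψ z) (fderiv ℝ ψ z v) = Real.exp (lam z) * contactForm z v

/-- For the step sizes `0 < h < h₀`, the composition `w` of exact flows is defined on the open set
`W`, where it is the contact map `Ψ h`. -/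
structure IsOneStepMap (w : List (Factor n)) (h₀ : ℝ) (W : Set (J1 n)) (Ψ : ℝ → J1 n → J1 n) :
    Prop where
  pos : 0 < h₀
  isOpen : IsOpen W
  realizes : ∀ h, 0 < h → h < h₀ → ∀ z ∈ W, Realizes w h z (Ψ h z)
  contact : ∀ h, 0 < h → h < h₀ → IsContactMapOn (Ψ h) W

end J1

end

open J1

open Set Filter Topology
open scoped ENNReal NNReal ContDiff

/-! ### Linear differential equations depending on a parameter -/

section LinearODE

/-! Algebra. For a monomial `p^a` of degree `k` and a function `F(x,u)`, the bracket `[p^a, F]`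
equals `(k - 1) F_u p^a` plus terms of degree `k - 1` in `p`. For `k ≥ 2` one solves `F_u = f / (k -
1)`; the bracket is then `f p^a` up to lower degree, and induction on the degree ends at degree at
most one, where every Hamiltonian is prolonged (`isDepthOne_mul_mono`).

Splitting. The contact field of a Jacobi bracket is the Lie bracket of the contact fields
(`contactField_jacobi`), and the group commutator of two flows for time `τ = √h` is `id + τ² [A, B]
+ O(τ³)` (`isQuadratic_commutator`). Composing such commutators with the flows of `s₀`, `d₀` for
time `τ²` agrees with the flow of `H^(N)` for time `h` up to `O(τ³)`. If the leading error of `Ψ_τ`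
has order `τ^m`, it cancels in `Ψ_{cτ} Ψ_{cτ} Ψ_{bτ}⁻¹` for suitable `b`, `c`
(`isApprox_raiseWord`), so every order is reached. All Hamiltonians are multiplied by one cut-off
that is `1` near `U`; the flows become complete, remain contact and keep their values near `U`. A
telescoping argument converts the local error into the global one in `C^r` (`exists_global_error`).

Approximation. Gronwall's inequality, applied to all spatial derivatives up to order `r` at once,
compares the flows of `H` and `H^(N)` (`exists_flow_comparison`). The two fields are evaluated along
different trajectories, so a modulus of continuity of the top derivative is needed: a Lipschitz
bound gives the linear estimate, uniform continuity the qualitative one. Good surrogates come from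
convolution with `(1 - M |z - w|²)^k`, which is polynomial in `p` and concentrates at `w = z`
(`exists_polyHam_approx`); their trajectories stay in `U` because they remain in a tube around those
of `H`.

All this rests on smooth dependence of solutions on parameters (`contDiff_of_integralCurves`), which
follows from the continuity in the parameters of solutions of linear Volterra equations. -/

lemma isUnit_one_sub_of_norm_pow_lt_one {B : Type*} [NormedRing B] [CompleteSpace B] {v : B} {k : ℕ}
    (hk : ‖v ^ k‖ < 1) : IsUnit (1 - v) := by
  have hu : IsUnit (1 - v ^ k) := isUnit_one_sub_of_norm_lt_one hk
  -- `1 - v^k = (1 - v)(1 + v + ⋯ + v^(k-1))` with commuting factors, and commuting factors of a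
  -- unit are units.
  rw [← mul_neg_geom_sum] at hu
  have hc : Commute (1 - v) (∑ i ∈ Finset.range k, v ^ i) := by
    refine Commute.sub_left (Commute.one_left _) (Commute.sum_right _ _ _ fun i _ => ?_)
    exact (Commute.refl _).pow_right i
  exact (hc.isUnit_mul_iff.1 hu).1

/-- Solutions of `s = b + V s` for quasi-nilpotent operators `V` depend continuously on `V`. -/
lemma exists_continuous_solution {B Q : Type*} [NormedAddCommGroup B] [NormedSpace ℝ B]
    [CompleteSpace B] [TopologicalSpace Q] {V : Q → B →L[ℝ] B} (hV : Continuous V)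
    (hk : ∀ q, ∃ k, ‖V q ^ k‖ < 1) (b : B) :
    ∃ S : Q → B, Continuous S ∧ ∀ q, S q = b + V q (S q) := by
  have hu : ∀ q, IsUnit (1 - V q) := fun q => isUnit_one_sub_of_norm_pow_lt_one (hk q).choose_spec
  refine ⟨fun q => Ring.inverse (1 - V q) b, ?_, fun q => ?_⟩
  -- Continuity comes from that of inversion at units, so the exponents `k` need not be uniform in
  -- `q`.
  · have h1 : Continuous fun q => Ring.inverse (1 - V q) := by
      rw [continuous_iff_continuousAt]
      intro q
      obtain ⟨v, hv⟩ := hu q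
      have h2 : ContinuousAt (fun q => 1 - V q) q := by fun_prop
      exact ContinuousAt.comp (g := Ring.inverse)
        (by rw [← hv]; exact NormedRing.inverse_continuousAt v) h2
    fun_prop
  · have : (1 - V q) (Ring.inverse (1 - V q) b) = b := by
      rw [← mul_apply_eq_comp, Ring.mul_inverse_cancel _ (hu q)]
      rfl
    rw [sub_apply, sub_eq_iff_eq_add] at this
    exact this

variable {A : Type*} [NormedRing A] [NormedAlgebra ℝ A] [CompleteSpace A] {T : ℝ}

/-- The operator `w ↦ ∫₀ᵗ w` on the continuous functions on `[0, T]`. -/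
noncomputable def primitiveCLM (A : Type*) [NormedRing A] [NormedAlgebra ℝ A] [CompleteSpace A]
    (hT : 0 ≤ T) : C(Icc 0 T, A) →L[ℝ] C(Icc 0 T, A) :=
  LinearMap.mkContinuous
    { toFun := fun w => ⟨fun t => ∫ s in (0 : ℝ)..t, IccExtend hT w s, by
        have h : Continuous (IccExtend hT w) := w.continuous.Icc_extend'
        exact (intervalIntegral.continuous_primitive
          (fun a b => h.intervalIntegrable a b) 0).comp continuous_subtype_val⟩
      map_add' := fun w v => by
        ext t
        exact intervalIntegral.integral_add
          ((w.continuous.Icc_extend' (h := hT)).intervalIntegrable _ _)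
          ((v.continuous.Icc_extend' (h := hT)).intervalIntegrable _ _)
      map_smul' := fun c w => by
        ext t
        exact intervalIntegral.integral_smul c (fun s => IccExtend hT w s) }
    T (fun w => by
      rw [ContinuousMap.norm_le _ (by positivity)]
      intro t
      have := intervalIntegral.norm_integral_le_of_norm_le_const (a := 0) (b := (t : ℝ))
        (f := IccExtend hT w) (C := ‖w‖) (fun s _ => w.norm_coe_le_norm _)
      refine this.trans ?_
      rw [sub_zero, abs_of_nonneg t.2.1, mul_comm]
      exact mul_le_mul_of_nonneg_right t.2.2 (norm_nonneg _))

/-- The Volterra operator `u ↦ ∫₀ᵗ M u`. -/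
noncomputable def volterra (hT : 0 ≤ T) (M : C(Icc 0 T, A)) : C(Icc 0 T, A) →L[ℝ] C(Icc 0 T, A) :=
  (primitiveCLM A hT).comp (ContinuousLinearMap.mul ℝ _ M)

lemma volterra_apply (hT : 0 ≤ T) (M u : C(Icc 0 T, A)) (t : Icc 0 T) :
    volterra hT M u t = ∫ s in (0 : ℝ)..t, IccExtend hT M s * IccExtend hT u s := rfl

lemma continuous_volterra (hT : 0 ≤ T) : Continuous (volterra (A := A) hT) := by
  unfold volterra
  fun_prop

/-- Each application integrates the previous bound once more, which produces the factorial. Hence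
the operator is quasi-nilpotent for every `M`, and linear equations are solved on all of `[0, T]` at
once. -/
lemma norm_volterra_pow_apply_le (hT : 0 ≤ T) (M u : C(Icc 0 T, A)) (k : ℕ) (t : Icc 0 T) :
    ‖(volterra hT M ^ k) u t‖ ≤ (‖M‖ * t) ^ k / k.factorial * ‖u‖ := by
  induction k generalizing t with
  | zero => simpa using u.norm_coe_le_norm t
  | succ k ih =>
    rw [pow_succ', mul_apply_eq_comp, volterra_apply]
    have hb : ∀ s ∈ Ioc (0 : ℝ) t, ‖IccExtend hT M s * IccExtend hT ((volterra hT M ^ k) u) s‖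
        ≤ ‖M‖ ^ (k + 1) / k.factorial * ‖u‖ * s ^ k := by
      intro s hs
      have hs' : s ∈ Icc 0 T := ⟨hs.1.le, hs.2.trans t.2.2⟩
      rw [IccExtend_of_mem hT _ hs', IccExtend_of_mem hT _ hs']
      refine (norm_mul_le _ _).trans ?_
      refine (mul_le_mul (M.norm_coe_le_norm _) (ih ⟨s, hs'⟩) (norm_nonneg _)
        (norm_nonneg _)).trans (le_of_eq ?_)
      rw [mul_pow]
      ring
    refine (intervalIntegral.norm_integral_le_of_norm_le t.2.1 (MeasureTheory.ae_of_all _ hb)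
      (by apply Continuous.intervalIntegrable; fun_prop)).trans (le_of_eq ?_)
    rw [intervalIntegral.integral_const_mul, integral_pow, Nat.factorial_succ, mul_pow]
    have : (k.factorial : ℝ) ≠ 0 := by positivity
    push_cast
    field_simp
    simp

lemma exists_norm_volterra_pow_lt_one (hT : 0 ≤ T) (M : C(Icc 0 T, A)) :
    ∃ k, ‖volterra hT M ^ k‖ < 1 := by
  have hlim := FloorSemiring.tendsto_pow_div_factorial_atTop (‖M‖ * T)
  obtain ⟨k, hk⟩ := (hlim.eventually (gt_mem_nhds one_pos)).exists
  refine ⟨k, lt_of_le_of_lt (ContinuousLinearMap.opNorm_le_bound _ (by positivity) fun u => ?_) hk⟩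
  rw [ContinuousMap.norm_le _ (by positivity)]
  intro t
  refine (norm_volterra_pow_apply_le hT M u k t).trans ?_
  have ht := t.2.1
  have ht' := t.2.2
  gcongr

/-- The fundamental solution of `S' = M S` on `[0, T]`, depending continuously on parameters. -/
lemma exists_fundamental_solution {Q : Type*} [TopologicalSpace Q] (hT : 0 ≤ T)
    (M : Q → C(Icc 0 T, A)) (hM : Continuous M) :
    ∃ S : Q → C(Icc 0 T, A), Continuous S ∧ (∀ q, S q ⟨0, left_mem_Icc.2 hT⟩ = 1) ∧
      ∀ q, ∀ t ∈ Icc 0 T, HasDerivWithinAt (IccExtend hT (S q))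
        (IccExtend hT (M q) t * IccExtend hT (S q) t) (Icc 0 T) t := by
  -- The integral equation `S = 1 + ∫ M S` is solved in the space of continuous functions, so the
  -- continuity in `q` is uniform in `t`.
  obtain ⟨S, hSc, hS⟩ := exists_continuous_solution ((continuous_volterra hT).comp hM)
    (fun q => exists_norm_volterra_pow_lt_one hT (M q)) 1
  have key : ∀ q t, S q t = 1 + ∫ s in (0 : ℝ)..t,
      IccExtend hT (M q) s * IccExtend hT (S q) s := fun q t =>
    congrArg (fun f : C(Icc 0 T, A) => f t) (hS q)
  refine ⟨S, hSc, fun q => ?_, fun q t ht => ?_⟩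
  · rw [key]
    simp
  · have hc : Continuous fun s => IccExtend hT (M q) s * IccExtend hT (S q) s :=
      ((M q).continuous.Icc_extend' (h := hT)).mul ((S q).continuous.Icc_extend' (h := hT))
    have hd := (intervalIntegral.integral_hasDerivAt_right (hc.intervalIntegrable 0 t)
      (hc.stronglyMeasurableAtFilter _ _) hc.continuousAt).const_add 1
    refine (hd.hasDerivWithinAt (s := Icc 0 T)).congr (fun s hs => ?_) ?_
    · rw [IccExtend_of_mem hT _ hs, key q ⟨s, hs⟩]
    · rw [IccExtend_of_mem hT _ ht, key q ⟨t, ht⟩]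

end LinearODE

/-! ### The mean value formula -/

section MeanValue

variable {E F : Type*} [NormedAddCommGroup E] [NormedSpace ℝ E]
  [NormedAddCommGroup F] [NormedSpace ℝ F]

/-- The averaged derivative `∫₀¹ Df(y + s w) ds`. -/
noncomputable def averagedFDeriv (f : E → F) (q : E × E) : E →L[ℝ] F :=
  ∫ s in (0 : ℝ)..1, fderiv ℝ f (q.1 + s • q.2)

lemma continuous_averagedFDeriv {f : E → F} (hf : ContDiff ℝ 1 f) :
    Continuous (averagedFDeriv f) := by
  have h := hf.continuous_fderiv one_ne_zero
  unfold averagedFDeriv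
  apply intervalIntegral.continuous_parametric_intervalIntegral_of_continuous'
  fun_prop

/-- Hadamard's exact form of the mean value theorem: increments become linear in `w` with regular
coefficients. It serves both for differences of solutions and for Taylor remainders. -/
lemma averagedFDeriv_apply [CompleteSpace F] {f : E → F} (hf : ContDiff ℝ 1 f) (y w : E) :
    averagedFDeriv f (y, w) w = f (y + w) - f y := by
  have h := hf.continuous_fderiv one_ne_zero
  have hc : Continuous fun s : ℝ => fderiv ℝ f (y + s • w) := by fun_prop
  rw [averagedFDeriv, ContinuousLinearMap.intervalIntegral_apply (hc.intervalIntegrable 0 1)]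
  have hd : ∀ s ∈ uIcc (0 : ℝ) 1,
      HasDerivAt (fun s : ℝ => f (y + s • w)) (fderiv ℝ f (y + s • w) w) s := by
    intro s _
    have h1 : HasDerivAt (fun s : ℝ => y + s • w) w s := by
      simpa using ((hasDerivAt_id s).smul_const w).const_add y
    exact (hf.differentiable one_ne_zero _).hasFDerivAt.comp_hasDerivAt s h1
  rw [intervalIntegral.integral_eq_sub_of_hasDerivAt hd
    (by apply Continuous.intervalIntegrable; fun_prop)]
  simp

lemma averagedFDeriv_zero [CompleteSpace F] (f : E → F) (y : E) : averagedFDeriv f (y, 0) = fderiv ℝ f y := by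
  simp [averagedFDeriv]

end MeanValue

/-! ### Smooth dependence of solutions on parameters -/

section Dependence

lemma HasDerivWithinAt.Ici_of_Icc {E : Type*} [NormedAddCommGroup E] [NormedSpace ℝ E]
    {f : ℝ → E} {f' : E} {a b t : ℝ} (h : HasDerivWithinAt f f' (Icc a b) t) (ht : t ∈ Ico a b) :
    HasDerivWithinAt f f' (Ici t) t :=
  h.mono_of_mem_nhdsWithin (Icc_mem_nhdsGE_of_mem ht)

lemma HasDerivWithinAt.compContinuousMultilinearMap {ι P F G : Type*} [Fintype ι]
    [NormedAddCommGroup P] [NormedSpace ℝ P] [NormedAddCommGroup F] [NormedSpace ℝ F]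
    [NormedAddCommGroup G] [NormedSpace ℝ G] (L : F →L[ℝ] G)
    {f : ℝ → ContinuousMultilinearMap ℝ (fun _ : ι => P) F}
    {f' : ContinuousMultilinearMap ℝ (fun _ : ι => P) F} {s : Set ℝ} {t : ℝ}
    (h : HasDerivWithinAt f f' s t) :
    HasDerivWithinAt (fun s => L.compContinuousMultilinearMap (f s))
      (L.compContinuousMultilinearMap f') s t :=
  (ContinuousLinearMap.compContinuousMultilinearMapL ℝ (fun _ : ι => P) F G
    L).hasFDerivAt.comp_hasDerivWithinAt t h

variable {P E : Type} [NormedAddCommGroup P] [NormedSpace ℝ P]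
  [NormedAddCommGroup E] [NormedSpace ℝ E] [CompleteSpace E] {T : ℝ}

/-- A continuous family of solutions of `γ' = X(γ)` with differentiable initial values is
differentiable in the parameter, and the derivative solves the variational equation. -/
lemma exists_hasFDerivAt_of_integralCurves (hT : 0 ≤ T) {X : E → E} (hX : ContDiff ℝ 1 X)
    {γ : ℝ → P → E}
    (hγ : ∀ z, ∀ t ∈ Icc 0 T, HasDerivWithinAt (fun s => γ s z) (X (γ t z)) (Icc 0 T) t)
    (hc : ContinuousOn (fun q : ℝ × P => γ q.1 q.2) (Icc 0 T ×ˢ univ))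
    (h0 : ContDiff ℝ 1 (γ 0)) :
    (∀ t ∈ Icc 0 T, ∀ z, DifferentiableAt ℝ (γ t) z) ∧
    (∀ z, ∀ t ∈ Icc 0 T, HasDerivWithinAt (fun s => fderiv ℝ (γ s) z)
      ((fderiv ℝ X (γ t z)).comp (fderiv ℝ (γ t) z)) (Icc 0 T) t) ∧
    ContinuousOn (fun q : ℝ × P => fderiv ℝ (γ q.1) q.2) (Icc 0 T ×ˢ univ) := by
  have hcs : Continuous fun q : Icc 0 T × P => γ q.1 q.2 := by
    rw [continuousOn_iff_continuous_domRestrict] at hc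
    exact hc.comp (f := fun q : Icc 0 T × P => (⟨((q.1 : ℝ), q.2), ⟨q.1.2, mem_univ _⟩⟩ :
      (Icc 0 T ×ˢ univ : Set (ℝ × P)))) (by fun_prop)
  -- The difference of the two solutions labelled by `q` solves the linear equation with this
  -- coefficient, which is continuous in `q` and on the diagonal is the coefficient of the
  -- variational equation.
  let M : P × P → C(Icc 0 T, E →L[ℝ] E) := fun q =>
    ⟨fun t => averagedFDeriv X (γ t q.1, γ t q.2 - γ t q.1), by
      have := continuous_averagedFDeriv hX
      have h1 : Continuous fun t : Icc 0 T => γ t q.1 :=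
        hcs.comp (f := fun t : Icc 0 T => (t, q.1)) (by fun_prop)
      have h2 : Continuous fun t : Icc 0 T => γ t q.2 :=
        hcs.comp (f := fun t : Icc 0 T => (t, q.2)) (by fun_prop)
      exact this.comp (h1.prodMk (h2.sub h1))⟩
  have hM : Continuous M := by
    refine ContinuousMap.continuous_of_continuous_uncurry _ ?_
    have := continuous_averagedFDeriv hX
    have h1 : Continuous fun x : (P × P) × Icc 0 T => γ x.2 x.1.1 :=
      hcs.comp (f := fun x : (P × P) × Icc 0 T => (x.2, x.1.1)) (by fun_prop)
    have h2 : Continuous fun x : (P × P) × Icc 0 T => γ x.2 x.1.2 :=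
      hcs.comp (f := fun x : (P × P) × Icc 0 T => (x.2, x.1.2)) (by fun_prop)
    exact this.comp (h1.prodMk (h2.sub h1))
  obtain ⟨S, hSc, hS0, hSd⟩ := exists_fundamental_solution hT M hM
  have hMd : ∀ z, ∀ t ∈ Icc 0 T, IccExtend hT (M (z, z)) t = fderiv ℝ X (γ t z) := by
    intro z t ht
    rw [IccExtend_of_mem hT _ ht]
    simp [M, averagedFDeriv_zero]
  -- differences of solutions
  have hdiff : ∀ z z', ∀ t ∈ Icc 0 T,
      γ t z' - γ t z = IccExtend hT (S (z, z')) t (γ 0 z' - γ 0 z) := by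
    intro z z'
    have hL : ∀ t, LipschitzWith ‖M (z, z')‖₊ (fun x => IccExtend hT (M (z, z')) t x) := by
      intro t
      exact (IccExtend hT (M (z, z')) t).lipschitz.weaken ((M (z, z')).norm_coe_le_norm _)
    have hd1 : ∀ t ∈ Icc 0 T, HasDerivWithinAt (fun s => γ s z' - γ s z)
        (IccExtend hT (M (z, z')) t (γ t z' - γ t z)) (Icc 0 T) t := by
      intro t ht
      refine ((hγ z' t ht).sub (hγ z t ht)).congr_deriv ?_
      rw [IccExtend_of_mem hT _ ht]
      simp only [M, ContinuousMap.coe_mk]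
      rw [averagedFDeriv_apply hX]
      simp
    have hd2 : ∀ t ∈ Icc 0 T,
        HasDerivWithinAt (fun s => IccExtend hT (S (z, z')) s (γ 0 z' - γ 0 z))
        (IccExtend hT (M (z, z')) t (IccExtend hT (S (z, z')) t (γ 0 z' - γ 0 z))) (Icc 0 T) t := by
      intro t ht
      have := (hSd (z, z') t ht).clm_apply (hasDerivWithinAt_const t (Icc 0 T) (γ 0 z' - γ 0 z))
      simpa using this
    refine ODE_solution_unique (v := fun t x => IccExtend hT (M (z, z')) t x) hL
      (fun t ht => (hd1 t ht).continuousWithinAt)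
      (fun t ht => (hd1 t (Ico_subset_Icc_self ht)).Ici_of_Icc ht)
      (fun t ht => (hd2 t ht).continuousWithinAt)
      (fun t ht => (hd2 t (Ico_subset_Icc_self ht)).Ici_of_Icc ht) ?_
    rw [IccExtend_of_mem hT _ (left_mem_Icc.2 hT), hS0]
    simp
  -- Since `hdiff` is an exact identity, differentiability only requires the continuity of `S` at
  -- the diagonal.
  have hfd : ∀ t ∈ Icc 0 T, ∀ z, HasFDerivAt (γ t)
      ((IccExtend hT (S (z, z)) t).comp (fderiv ℝ (γ 0) z)) z := by
    intro t ht z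
    have hg := (h0.differentiable one_ne_zero z).hasFDerivAt
    have hcont : ContinuousAt (fun z' => IccExtend hT (S (z, z')) t) z := by
      have : Continuous fun z' => IccExtend hT (S (z, z')) t := by
        simp only [IccExtend_of_mem hT _ ht]
        fun_prop
      exact this.continuousAt
    have hO := hg.isBigO_sub
    rw [hasFDerivAt_iff_isLittleO] at hg ⊢
    have hso : (fun z' => IccExtend hT (S (z, z')) t - IccExtend hT (S (z, z)) t)
        =o[𝓝 z] fun _ => (1 : ℝ) := by
      rw [Asymptotics.isLittleO_one_iff]
      simpa using hcont.tendsto.sub_const (IccExtend hT (S (z, z)) t)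
    have h1 : (fun z' => (IccExtend hT (S (z, z')) t - IccExtend hT (S (z, z)) t)
        (γ 0 z' - γ 0 z)) =o[𝓝 z] fun z' => z' - z := by
      have hmul := hso.norm_left.mul_isBigO hO.norm_norm
      simp only [one_mul] at hmul
      refine Asymptotics.IsLittleO.of_norm_right ?_
      refine Asymptotics.IsBigO.trans_isLittleO ?_ hmul
      refine Asymptotics.IsBigO.of_bound 1 (Eventually.of_forall fun z' => ?_)
      rw [one_mul, Real.norm_of_nonneg (by positivity)]
      exact ContinuousLinearMap.le_opNorm _ _
    have h2 : (fun z' => IccExtend hT (S (z, z)) t (γ 0 z' - γ 0 z - fderiv ℝ (γ 0) z (z' - z)))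
        =o[𝓝 z] fun z' => z' - z :=
      ((IccExtend hT (S (z, z)) t).isBigO_comp _ _).trans_isLittleO hg
    refine (h1.add h2).congr_left fun z' => ?_
    rw [hdiff z z' t ht]
    simp
  have hfd' : ∀ t ∈ Icc 0 T, ∀ z,
      fderiv ℝ (γ t) z = (IccExtend hT (S (z, z)) t).comp (fderiv ℝ (γ 0) z) :=
    fun t ht z => (hfd t ht z).fderiv
  refine ⟨fun t ht z => (hfd t ht z).differentiableAt, fun z t ht => ?_, ?_⟩
  · have h1 := (hSd (z, z) t ht).clm_comp (hasDerivWithinAt_const t (Icc 0 T) (fderiv ℝ (γ 0) z))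
    have h2 : HasDerivWithinAt (fun s => (IccExtend hT (S (z, z)) s).comp (fderiv ℝ (γ 0) z))
        ((fderiv ℝ X (γ t z)).comp (fderiv ℝ (γ t) z)) (Icc 0 T) t := by
      refine h1.congr_deriv ?_
      rw [hMd z t ht, hfd' t ht z]
      ext v
      simp
    exact h2.congr (fun s hs => hfd' s hs z) (hfd' t ht z)
  · have hcf := h0.continuous_fderiv one_ne_zero
    have h1 : Continuous fun q : ℝ × P =>
        (IccExtend hT (S (q.2, q.2)) q.1).comp (fderiv ℝ (γ 0) q.2) := by
      have h2 : Continuous fun q : ℝ × P => IccExtend hT (S (q.2, q.2)) q.1 := by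
        change Continuous fun q : ℝ × P => S (q.2, q.2) (projIcc 0 T hT q.1)
        have := continuous_projIcc (h := hT)
        fun_prop
      fun_prop
    exact h1.continuousOn.congr fun q hq => hfd' q.1 hq.1 q.2

/-- A continuous family of solutions of `γ' = X(γ)`, with `X` and the initial values of class
`C^r`, is of class `C^r` in the parameter, and the derivatives in the parameter solve the
differentiated equations. -/
theorem contDiff_of_integralCurves (hT : 0 ≤ T) (r : ℕ) {P E : Type} [NormedAddCommGroup P]
    [NormedSpace ℝ P] [NormedAddCommGroup E] [NormedSpace ℝ E] [CompleteSpace E]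
    {X : E → E} (hX : ContDiff ℝ (r + 1) X) {γ : ℝ → P → E}
    (hγ : ∀ z, ∀ t ∈ Icc 0 T, HasDerivWithinAt (fun s => γ s z) (X (γ t z)) (Icc 0 T) t)
    (hc : ContinuousOn (fun q : ℝ × P => γ q.1 q.2) (Icc 0 T ×ˢ univ))
    (h0 : ContDiff ℝ (r + 1) (γ 0)) :
    (∀ t ∈ Icc 0 T, ContDiff ℝ (r + 1) (γ t)) ∧
    ∀ j ≤ r + 1, ∀ z, ∀ t ∈ Icc 0 T, HasDerivWithinAt (fun s => iteratedFDeriv ℝ j (γ s) z)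
      (iteratedFDeriv ℝ j (X ∘ γ t) z) (Icc 0 T) t := by
  induction r generalizing E with
  | zero =>
    simp only [Nat.cast_zero, zero_add] at hX h0 ⊢
    obtain ⟨h1, h2, h3⟩ := exists_hasFDerivAt_of_integralCurves hT hX hγ hc h0
    refine ⟨fun t ht => contDiff_one_iff_fderiv.2 ⟨fun z => h1 t ht z, ?_⟩, ?_⟩
    · have : ContinuousOn (fun z : P => fderiv ℝ (γ t) z) univ :=
        h3.comp (f := fun z => (t, z)) (by fun_prop) (fun z _ => ⟨ht, mem_univ _⟩)
      exact continuousOn_univ.1 this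
    · intro j hj z t ht
      interval_cases j
      · have := (continuousMultilinearCurryFin0
          ℝ P E).symm.toContinuousLinearEquiv.toContinuousLinearMap.hasFDerivAt.comp_hasDerivWithinAt t (hγ z t ht)
        exact this
      · have hcomp : fderiv ℝ (X ∘ γ t) z = (fderiv ℝ X (γ t z)).comp (fderiv ℝ (γ t) z) :=
          fderiv_comp z (hX.differentiable one_ne_zero _) (h1 t ht z)
        have := (continuousMultilinearCurryFin1
          ℝ P E).symm.toContinuousLinearEquiv.toContinuousLinearMap.hasFDerivAt.comp_hasDerivWithinAt t (h2 z t ht)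
        rw [← hcomp] at this
        refine (this.congr_deriv ?_).congr (fun s _ => ?_) ?_
        all_goals
          ext v
          simp [iteratedFDeriv_one_apply]
  | succ r ih =>
    have hX1 : ContDiff ℝ 1 X := hX.of_le (by norm_cast; omega)
    have h01 : ContDiff ℝ 1 (γ 0) := h0.of_le (by norm_cast; omega)
    obtain ⟨h1, h2, h3⟩ := exists_hasFDerivAt_of_integralCurves hT hX1 hγ hc h01
    have hXd : ContDiff ℝ (r + 1) (fderiv ℝ X) :=
      hX.fderiv_right (by norm_cast)
    have hX' : ContDiff ℝ (r + 1)
        (fun y : E × (P →L[ℝ] E) => (X y.1, (fderiv ℝ X y.1).comp y.2)) := by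
      refine ContDiff.prodMk ?_ ?_
      · exact (hX.of_le (by norm_cast; omega)).comp contDiff_fst
      · exact (hXd.comp contDiff_fst).clm_comp contDiff_snd
    have hγ0 : ContDiff ℝ (r + 1) (fun z => (γ 0 z, fderiv ℝ (γ 0) z)) :=
      (h0.of_le (by norm_cast; omega)).prodMk (h0.fderiv_right (by norm_cast))
    -- The pair of `γ` and its derivative runs along integral curves of the tangent lift of `X`,
    -- which has one derivative less and lives on a larger space; hence the induction over all `E`.
    obtain ⟨k1, k2⟩ := ih (X := fun y : E × (P →L[ℝ] E) => (X y.1, (fderiv ℝ X y.1).comp y.2))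
      hX' (γ := fun t z => (γ t z, fderiv ℝ (γ t) z))
      (fun z t ht => (hγ z t ht).prodMk (h2 z t ht)) (hc.prodMk h3) hγ0
    have k3 : ∀ t ∈ Icc 0 T, ContDiff ℝ (r + 1) (fderiv ℝ (γ t)) := fun t ht => (k1 t ht).snd
    have k4 : ∀ t ∈ Icc 0 T, ContDiff ℝ (r + 1 + 1) (γ t) := fun t ht =>
      contDiff_succ_iff_fderiv.2 ⟨fun z => h1 t ht z, by simp, k3 t ht⟩
    refine ⟨fun t ht => by exact_mod_cast k4 t ht, ?_⟩
    intro j hj z t ht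
    rcases j with _ | j
    · have := (continuousMultilinearCurryFin0
        ℝ P E).symm.toContinuousLinearEquiv.toContinuousLinearMap.hasFDerivAt.comp_hasDerivWithinAt t (hγ z t ht)
      exact this
    · have hcomp : fderiv ℝ (X ∘ γ t) = fun z => (fderiv ℝ X (γ t z)).comp (fderiv ℝ (γ t) z) :=
        funext fun z => fderiv_comp z (hX1.differentiable one_ne_zero _) (h1 t ht z)
      have hj' : j ≤ r + 1 := by omega
      have k5 := k2 j hj' z t ht
      have hsnd : ∀ (f : P → E × (P →L[ℝ] E)), ContDiff ℝ (r + 1) f →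
          iteratedFDeriv ℝ j (fun z => (f z).2) z =
          (ContinuousLinearMap.snd ℝ E (P →L[ℝ] E)).compContinuousMultilinearMap
            (iteratedFDeriv ℝ j f z) := by
        intro f hf
        have hj2 : ((j : ℕ) : WithTop ℕ∞) ≤ (r : WithTop ℕ∞) + 1 := by exact_mod_cast hj'
        exact ContinuousLinearMap.iteratedFDeriv_comp_left
          (ContinuousLinearMap.snd ℝ E (P →L[ℝ] E)) hf.contDiffAt hj2
      have k6 := k5.compContinuousMultilinearMap (ContinuousLinearMap.snd ℝ E (P →L[ℝ] E))
      have k7 : HasDerivWithinAt (fun s => iteratedFDeriv ℝ j (fderiv ℝ (γ s)) z)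
          (iteratedFDeriv ℝ j (fderiv ℝ (X ∘ γ t)) z) (Icc 0 T) t := by
        refine (k6.congr_deriv ?_).congr (fun s hs => ?_) ?_
        · rw [hcomp]
          exact (hsnd _ (hX'.comp (k1 t ht))).symm
        · exact hsnd _ (k1 s hs)
        · exact hsnd _ (k1 t ht)
      have k8 := (continuousMultilinearCurryRightEquiv'
        ℝ j P E).symm.toContinuousLinearEquiv.toContinuousLinearMap.hasFDerivAt.comp_hasDerivWithinAt t k7
      refine (k8.congr_deriv ?_).congr (fun s hs => ?_) ?_
      · exact (iteratedFDeriv_succ_eq_comp_right).symm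
      · exact iteratedFDeriv_succ_eq_comp_right
      · exact iteratedFDeriv_succ_eq_comp_right

end Dependence

/-! ### Global flows -/

section GlobalFlow

variable {E : Type} [NormedAddCommGroup E] [NormedSpace ℝ E]

/-- `Φ` is the complete flow of the vector field `X`. -/
structure IsGlobalFlow (X : E → E) (Φ : ℝ → E → E) : Prop where
  zero : ∀ z, Φ 0 z = z
  deriv : ∀ z t, HasDerivAt (fun s => Φ s z) (X (Φ t z)) t

/-- A curve of speed at most `L` cannot leave the ball of radius `L T` within time `T`, so
Picard–Lindelöf applies on intervals of any length. -/
lemma exists_integralCurve_of_lipschitz [CompleteSpace E] {X : E → E} {K : ℝ≥0}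
    (hL : LipschitzWith K X) {L : ℝ≥0} (hb : ∀ x, ‖X x‖ ≤ L) (z : E) (T : ℝ≥0) :
    ∃ α : ℝ → E, α 0 = z ∧ ∀ t ∈ Ioo (-(T : ℝ)) T, HasDerivAt α (X (α t)) t := by
  have h0 : (0 : ℝ) ∈ Icc (-(T : ℝ)) T := by simp
  have hPL : IsPicardLindelof (fun _ => X) (⟨0, h0⟩ : Icc (-(T : ℝ)) T) z (L * T) 0 L K :=
    IsPicardLindelof.of_time_independent (fun x _ => hb x) hL.lipschitzOnWith (by simp)
  obtain ⟨α, hα0, hα⟩ := hPL.exists_eq_forall_mem_Icc_hasDerivWithinAt₀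
  exact ⟨α, hα0, fun t ht => (hα t (Ioo_subset_Icc_self ht)).hasDerivAt (Icc_mem_nhds ht.1 ht.2)⟩

/-- A bounded Lipschitz vector field is complete. -/
theorem exists_isGlobalFlow [CompleteSpace E] {X : E → E} {K : ℝ≥0}
    (hL : LipschitzWith K X) {L : ℝ} (hb : ∀ x, ‖X x‖ ≤ L) : ∃ Φ, IsGlobalFlow X Φ := by
  have hb' : ∀ x, ‖X x‖ ≤ (L.toNNReal : ℝ) := fun x => (hb x).trans (Real.le_coe_toNNReal L)
  choose α h0 hα using exists_integralCurve_of_lipschitz hL hb'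
  have huniq : ∀ z (S T : ℝ≥0), 0 < S → S ≤ T → EqOn (α z S) (α z T) (Ioo (-(S : ℝ)) S) := by
    intro z S T hS hST
    have hST' : (S : ℝ) ≤ T := hST
    have hS' : (0 : ℝ) < S := hS
    refine ODE_solution_unique_of_mem_Ioo (v := fun _ => X) (s := fun _ => univ) (K := K) (t₀ := 0)
      (fun t _ => hL.lipschitzOnWith) (by constructor <;> linarith)
      (fun t ht => ⟨hα z S t ht, mem_univ _⟩)
      (fun t ht => ⟨hα z T t ⟨by linarith [ht.1], by linarith [ht.2]⟩, mem_univ _⟩) ?_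
    rw [h0, h0]
  -- The value at `t` is read off the solution on the interval of radius `|t| + 1`; by uniqueness
  -- these solutions agree on common intervals.
  refine ⟨fun t z => α z (‖t‖₊ + 1) t, fun z => h0 z _, fun z t => ?_⟩
  have ht : t ∈ Ioo (-((‖t‖₊ + 1 : ℝ≥0) : ℝ)) (‖t‖₊ + 1 : ℝ≥0) := by
    have := abs_lt.1 (show |t| < |t| + 1 by linarith)
    simpa using this
  refine (hα z _ t ht).congr_of_eventuallyEq ?_
  filter_upwards [Ioo_mem_nhds ht.1 ht.2] with s hs
  have hs' : s ∈ Ioo (-((‖s‖₊ + 1 : ℝ≥0) : ℝ)) (‖s‖₊ + 1 : ℝ≥0) := by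
    have := abs_lt.1 (show |s| < |s| + 1 by linarith)
    simpa using this
  rcases le_total (‖s‖₊ + 1) (‖t‖₊ + 1) with h | h
  · exact huniq z _ _ (by positivity) h hs'
  · exact (huniq z _ _ (by positivity) h hs).symm

variable {X : E → E} {Φ : ℝ → E → E} {K : ℝ≥0}

namespace IsGlobalFlow

lemma neg (h : IsGlobalFlow X Φ) : IsGlobalFlow (-X) (fun t => Φ (-t)) where
  zero z := by simpa using h.zero z
  deriv z t := by
    have := (h.deriv z (-t)).scomp t (hasDerivAt_neg t)
    simpa [Function.comp_def] using this

lemma curve_unique (h : IsGlobalFlow X Φ) (hL : LipschitzWith K X) {z : E} {γ : ℝ → E}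
    (h0 : γ 0 = z) (hγ : ∀ t, HasDerivAt γ (X (γ t)) t) (t : ℝ) : γ t = Φ t z := by
  have := ODE_solution_unique_univ (v := fun _ => X) (s := fun _ => univ) (K := K) (t₀ := 0)
    (fun t => hL.lipschitzOnWith) (fun t => ⟨hγ t, mem_univ _⟩)
    (fun t => ⟨h.deriv z t, mem_univ _⟩) (by rw [h0, h.zero])
  exact congrFun this t

lemma add (h : IsGlobalFlow X Φ) (hL : LipschitzWith K X) (s t : ℝ) (z : E) :
    Φ (s + t) z = Φ s (Φ t z) := by
  refine h.curve_unique hL (γ := fun s => Φ (s + t) z) (by simp) (fun s => ?_) s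
  exact (h.deriv z (s + t)).comp_add_const s t

lemma neg_apply (h : IsGlobalFlow X Φ) (hL : LipschitzWith K X) (t : ℝ) (z : E) :
    Φ (-t) (Φ t z) = z := by
  rw [← h.add hL]
  simp [h.zero]

lemma apply_neg (h : IsGlobalFlow X Φ) (hL : LipschitzWith K X) (t : ℝ) (z : E) :
    Φ t (Φ (-t) z) = z := by
  rw [← h.add hL]
  simp [h.zero]

lemma fixed (h : IsGlobalFlow X Φ) (hL : LipschitzWith K X) {z : E} (hz : X z = 0) (t : ℝ) :
    Φ t z = z :=
  (h.curve_unique hL (γ := fun _ => z) rfl (fun t => by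
    simpa [hz] using hasDerivAt_const t z) t).symm

lemma continuous_curve (h : IsGlobalFlow X Φ) (z : E) : Continuous fun t => Φ t z :=
  continuous_iff_continuousAt.2 fun t => (h.deriv z t).continuousAt

lemma dist_le_of_nonneg (h : IsGlobalFlow X Φ) (hL : LipschitzWith K X) (z z' : E) {t : ℝ}
    (ht : 0 ≤ t) : dist (Φ t z) (Φ t z') ≤ dist z z' * Real.exp (K * t) := by
  have := dist_le_of_trajectories_ODE (v := fun _ => X) (a := 0) (b := t) (δ := dist z z')
    (fun _ => hL) (h.continuous_curve z).continuousOn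
    (fun s _ => (h.deriv z s).hasDerivWithinAt) (h.continuous_curve z').continuousOn
    (fun s _ => (h.deriv z' s).hasDerivWithinAt) (by rw [h.zero, h.zero]) t ⟨ht, le_rfl⟩
  simpa using this

lemma dist_le (h : IsGlobalFlow X Φ) (hL : LipschitzWith K X) (z z' : E) (t : ℝ) :
    dist (Φ t z) (Φ t z') ≤ dist z z' * Real.exp (K * |t|) := by
  rcases le_total 0 t with ht | ht
  · rw [abs_of_nonneg ht]
    exact h.dist_le_of_nonneg hL z z' ht
  · have := h.neg.dist_le_of_nonneg hL.neg z z' (neg_nonneg.2 ht)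
    rw [abs_of_nonpos ht]
    simpa using this

lemma continuous (h : IsGlobalFlow X Φ) (hL : LipschitzWith K X) :
    Continuous fun q : ℝ × E => Φ q.1 q.2 := by
  rw [continuous_iff_continuousAt]
  rintro ⟨t₀, z₀⟩
  rw [ContinuousAt, tendsto_iff_dist_tendsto_zero]
  have hlim : Tendsto (fun q : ℝ × E => dist q.2 z₀ * Real.exp (K * |q.1|)
      + dist (Φ q.1 z₀) (Φ t₀ z₀)) (𝓝 (t₀, z₀)) (𝓝 0) := by
    have hc : Continuous fun q : ℝ × E => dist q.2 z₀ * Real.exp (K * |q.1|)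
        + dist (Φ q.1 z₀) (Φ t₀ z₀) := by
      have := h.continuous_curve z₀
      fun_prop
    simpa using hc.tendsto (t₀, z₀)
  refine squeeze_zero (fun _ => dist_nonneg) (fun q => ?_) hlim
  exact (dist_triangle _ (Φ q.1 z₀) _).trans (by gcongr; exact h.dist_le hL _ _ _)

/-- The flow of a `C^r` vector field is `C^r`, and its derivatives solve the differentiated
equations. -/
lemma contDiff_of_nat [CompleteSpace E] (h : IsGlobalFlow X Φ) (hL : LipschitzWith K X) {r : ℕ}
    (hX : ContDiff ℝ r X) {T : ℝ} :
    ∀ t ∈ Icc 0 T, ContDiff ℝ r (Φ t) ∧ ∀ j ≤ r, ∀ z,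
      HasDerivWithinAt (fun s => iteratedFDeriv ℝ j (Φ s) z) (iteratedFDeriv ℝ j (X ∘ Φ t) z)
        (Icc 0 T) t := by
  intro t ht
  have hc := h.continuous hL
  have hd : ∀ z, ∀ t ∈ Icc 0 T, HasDerivWithinAt (fun s => Φ s z) (X (Φ t z)) (Icc 0 T) t :=
    fun z t _ => (h.deriv z t).hasDerivWithinAt
  rcases r with _ | r
  · refine ⟨contDiff_zero.2 (hc.comp (by fun_prop : Continuous fun z => (t, z))), fun j hj z => ?_⟩
    obtain rfl : j = 0 := by omega
    exact (continuousMultilinearCurryFin0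
      ℝ E E).symm.toContinuousLinearEquiv.toContinuousLinearMap.hasFDerivAt.comp_hasDerivWithinAt t
      (hd z t ht)
  · have h0 : Φ 0 = id := funext h.zero
    obtain ⟨h1, h2⟩ := contDiff_of_integralCurves (ht.1.trans ht.2) r (by exact_mod_cast hX)
      (γ := Φ) hd hc.continuousOn (by rw [h0]; exact contDiff_id)
    exact ⟨by exact_mod_cast h1 t ht, fun j hj z => h2 j hj z t ht⟩

/-- The flow of a smooth vector field is smooth in time and space. -/
lemma contDiff [CompleteSpace E] (h : IsGlobalFlow X Φ) (hL : LipschitzWith K X)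
    (hX : ContDiff ℝ ∞ X) : ContDiff ℝ ∞ fun q : ℝ × E => Φ q.1 q.2 := by
  rw [contDiff_infty]
  intro r
  -- Time becomes a parameter: `s ↦ Φ (s t) z` solves the equation with the field `t X` on `[0, 1]`,
  -- and `t` is carried along as a constant component of the state.
  have hX' : ContDiff ℝ (r + 1) fun y : ℝ × E => ((0 : ℝ), y.1 • X y.2) :=
    contDiff_const.prodMk (contDiff_fst.smul ((hX.of_le (by exact_mod_cast le_top)).comp
      contDiff_snd))
  have hc := h.continuous hL
  obtain ⟨h1, -⟩ := contDiff_of_integralCurves zero_le_one r hX'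
    (γ := fun s (q : ℝ × E) => (q.1, Φ (s * q.1) q.2)) (T := 1)
    (fun q t _ => by
      refine ((hasDerivAt_const t q.1).prodMk ?_).hasDerivWithinAt
      have := (h.deriv q.2 (t * q.1)).scomp t ((hasDerivAt_id t).mul_const q.1)
      simpa [Function.comp_def] using this)
    (by
      apply Continuous.continuousOn
      have : Continuous fun q : ℝ × ℝ × E => Φ (q.1 * q.2.1) q.2.2 :=
        hc.comp (f := fun q : ℝ × ℝ × E => (q.1 * q.2.1, q.2.2)) (by fun_prop)
      fun_prop)
    (by simpa [h.zero] using contDiff_fun_id)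
  have h2 := (h1 1 (by simp)).snd
  simp only [one_mul] at h2
  exact h2.of_le (by exact_mod_cast Nat.le_succ r)

end IsGlobalFlow

/-- Two integral curves with the same initial value agree if one of them remains in an open set on
which the vector field is Lipschitz. -/
lemma eqOn_of_integralCurve_of_mem {V : Set E} (hV : IsOpen V) (hL : LipschitzOnWith K X V)
    {f g : ℝ → E} {T : ℝ} (hf : IsIntegralCurveOn f (fun _ => X) (Icc 0 T))
    (hg : IsIntegralCurveOn g (fun _ => X) (Icc 0 T)) (hfV : ∀ t ∈ Icc 0 T, f t ∈ V)
    (h0 : f 0 = g 0) : ∀ t ∈ Icc 0 T, f t = g t := by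
  have hcl : IsClosed ({t | f t = g t} ∩ Icc 0 T) := by
    have := (hf.continuousOn.prodMk hg.continuousOn).preimage_isClosed_of_isClosed isClosed_Icc
      isClosed_diagonal
    rwa [inter_comm] at this
  -- Only `f` is known to stay in `V`. Where the curves agree, `g` lies in `V` too and remains there
  -- for a short time, so local uniqueness pushes the closed set of coincidence to the right.
  refine IsClosed.Icc_subset_of_forall_exists_gt hcl h0 ?_
  rintro x ⟨hx : f x = g x, hxI⟩ y (hy : x < y)
  have hxI' := Ico_subset_Icc_self hxI
  have hgx : ∀ᶠ t in 𝓝[Icc 0 T] x, g t ∈ V :=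
    (hg.continuousOn x hxI').eventually (hV.mem_nhds (hx ▸ hfV x hxI'))
  obtain ⟨δ, hδ, hball⟩ := Metric.mem_nhdsWithin_iff.1 hgx
  set b := min (x + δ / 2) (min y T) with hb
  have hxb : x < b := lt_min (by linarith) (lt_min hy hxI.2)
  have hbT : b ≤ T := (min_le_right _ _).trans (min_le_right _ _)
  have hsub : Icc x b ⊆ Icc 0 T := Icc_subset_Icc hxI.1 hbT
  refine ⟨b, ?_, hxb, (min_le_right _ _).trans (min_le_left _ _)⟩
  refine ODE_solution_unique_of_mem_Icc_right (v := fun _ => X) (s := fun _ => V) (a := x) (b := b)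
    (fun _ _ => hL) (hf.continuousOn.mono hsub)
    (fun t ht => (hf t (hsub (Ico_subset_Icc_self ht))).Ici_of_Icc
      ⟨hxI.1.trans ht.1, ht.2.trans_le hbT⟩)
    (fun t ht => hfV t (hsub (Ico_subset_Icc_self ht))) (hg.continuousOn.mono hsub)
    (fun t ht => (hg t (hsub (Ico_subset_Icc_self ht))).Ici_of_Icc
      ⟨hxI.1.trans ht.1, ht.2.trans_le hbT⟩)
    (fun t ht => hball ⟨?_, hsub (Ico_subset_Icc_self ht)⟩) hx ⟨hxb.le, le_rfl⟩
  rw [Metric.mem_ball, Real.dist_eq, abs_of_nonneg (by linarith [ht.1])]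
  linarith [ht.2, min_le_left (x + δ / 2) (min y T)]

namespace IsGlobalFlow

lemma eventually_forall_mem (h : IsGlobalFlow X Φ) (hL : LipschitzWith K X) {V : Set E}
    (hV : IsOpen V) {T : ℝ} {z₀ : E} (hz : ∀ t ∈ Icc 0 T, Φ t z₀ ∈ V) :
    ∀ᶠ z in 𝓝 z₀, ∀ t ∈ Icc 0 T, Φ t z ∈ V := by
  refine isCompact_Icc.eventually_forall_of_forall_eventually fun t ht => ?_
  have hc := (h.continuous hL).comp (f := fun q : E × ℝ => (q.2, q.1)) (by fun_prop)
  exact hc.continuousAt.eventually (hV.mem_nhds (hz t ht))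

lemma eq_of_integralCurveOn (h : IsGlobalFlow X Φ) (hL : LipschitzWith K X) {Y : E → E}
    {V : Set E} (hXY : EqOn X Y V) {T : ℝ} {z : E} {γ : ℝ → E}
    (h0 : γ 0 = z) (hγ : IsIntegralCurveOn γ (fun _ => Y) (Icc 0 T))
    (hmem : ∀ t ∈ Icc 0 T, γ t ∈ V) : ∀ t ∈ Icc 0 T, γ t = Φ t z := by
  refine ODE_solution_unique (v := fun _ => X) (K := K) (fun _ => hL) hγ.continuousOn
    (fun t ht => ?_) (h.continuous_curve z).continuousOn
    (fun t _ => (h.deriv z t).hasDerivWithinAt) (by rw [h0, h.zero])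
  rw [hXY (hmem t (Ico_subset_Icc_self ht))]
  exact (hγ t (Ico_subset_Icc_self ht)).Ici_of_Icc ht

/-- A flow of `Y` whose trajectory from `z₀` remains in an open set where `Y` coincides with the
complete vector field `X` is, near `z₀`, the flow of `X`. -/
lemma eventually_eq_of_confined (h : IsGlobalFlow X Φ) (hL : LipschitzWith K X) {Y : E → E}
    {V : Set E} (hV : IsOpen V) (hXY : EqOn X Y V) {T : ℝ} {z₀ : E} {Ψ : ℝ → E → E}
    (hΨ : ∀ᶠ z in 𝓝 z₀, Ψ 0 z = z ∧ IsIntegralCurveOn (fun t => Ψ t z) (fun _ => Y) (Icc 0 T))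
    (hmem : ∀ t ∈ Icc 0 T, Ψ t z₀ ∈ V) :
    ∀ᶠ z in 𝓝 z₀, ∀ t ∈ Icc 0 T, Ψ t z = Φ t z := by
  have h1 := h.eq_of_integralCurveOn hL hXY hΨ.self_of_nhds.1 hΨ.self_of_nhds.2 hmem
  have h2 := h.eventually_forall_mem hL hV (T := T) (z₀ := z₀)
    (fun t ht => h1 t ht ▸ hmem t ht)
  filter_upwards [hΨ, h2] with z hz hzV t ht
  have hLY : LipschitzOnWith K Y V := fun x hx y hy => by
    rw [← hXY hx, ← hXY hy]
    exact hL x y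
  -- The curve known to stay in `V` is that of `X`, by continuity of its flow; nothing is known in
  -- advance about the neighbouring curves of `Y`.
  refine (eqOn_of_integralCurve_of_mem hV hLY (f := fun t => Φ t z) ?_ hz.2 hzV
    (by rw [h.zero, hz.1]) t ht).symm
  intro s hs
  exact (h.deriv z s).hasDerivWithinAt.congr_deriv (hXY (hzV s hs))

end IsGlobalFlow

end GlobalFlow

/-! ### Smooth parametric integrals -/

section ParametricIntegral

variable {Q F : Type} [NormedAddCommGroup Q] [NormedSpace ℝ Q] [CompleteSpace Q]
  [NormedAddCommGroup F] [NormedSpace ℝ F] [CompleteSpace F]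

/-- Integrals over `[0, 1]` of smooth functions depend smoothly on parameters. -/
theorem contDiff_parametric_intervalIntegral {g : ℝ × Q → F} (hg : ContDiff ℝ ∞ g) :
    ContDiff ℝ ∞ fun q => ∫ s in (0 : ℝ)..1, g (s, q) := by
  rw [contDiff_infty]
  intro r
  -- The primitive `∫₀ᵗ g(s, q) ds` is a component of the solution of `(t, q, w)' = (1, 0, g(t,
  -- q))`, so smoothness in `q` is a case of dependence on initial values.
  have hX : ContDiff ℝ (r + 1) fun y : ℝ × Q × F => ((1 : ℝ), (0 : Q), g (y.1, y.2.1)) :=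
    contDiff_const.prodMk (contDiff_const.prodMk
      ((hg.of_le (by exact_mod_cast le_top)).comp (by fun_prop)))
  have hgc := hg.continuous
  have hc : Continuous fun q : Q × ℝ => ∫ s in (0 : ℝ)..q.2, g (s, q.1) := by
    exact intervalIntegral.continuous_parametric_primitive_of_continuous
      (f := fun q s => g (s, q)) (hgc.comp (by fun_prop : Continuous fun q : Q × ℝ => (q.2, q.1)))
  obtain ⟨h1, -⟩ := contDiff_of_integralCurves zero_le_one r hX
    (γ := fun t q => (t, q, ∫ s in (0 : ℝ)..t, g (s, q))) (T := 1)
    (fun q t _ => by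
      refine ((hasDerivAt_id t).prodMk ((hasDerivAt_const t q).prodMk ?_)).hasDerivWithinAt
      have hcq : Continuous fun s => g (s, q) := by fun_prop
      exact intervalIntegral.integral_hasDerivAt_right (hcq.intervalIntegrable 0 t)
        (hcq.stronglyMeasurableAtFilter _ _) hcq.continuousAt)
    (by
      apply Continuous.continuousOn
      have := hc.comp (f := fun q : ℝ × Q => (q.2, q.1)) (by fun_prop)
      exact continuous_fst.prodMk (continuous_snd.prodMk this))
    (by
      simp only [intervalIntegral.integral_same]
      fun_prop)
  exact (h1 1 (by simp)).snd.snd.of_le (by exact_mod_cast Nat.le_succ r)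

lemma contDiff_averagedFDeriv {f : Q → F} (hf : ContDiff ℝ ∞ f) :
    ContDiff ℝ ∞ (averagedFDeriv f) := by
  have hd : ContDiff ℝ ∞ (fderiv ℝ f) := hf.fderiv_right (by simp)
  exact contDiff_parametric_intervalIntegral (Q := Q × Q)
    (g := fun q : ℝ × Q × Q => fderiv ℝ f (q.2.1 + q.1 • q.2.2)) (by fun_prop)

/-- First order Taylor expansion in a real variable, with smooth remainder. -/
lemma exists_smooth_remainder {g : ℝ × Q → F} (hg : ContDiff ℝ ∞ g) :
    ∃ g₁ : ℝ × Q → F, ContDiff ℝ ∞ g₁ ∧ (∀ τ z, g (τ, z) = g (0, z) + τ • g₁ (τ, z)) ∧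
      ∀ z, g₁ (0, z) = fderiv ℝ g (0, z) (1, 0) := by
  refine ⟨fun q => averagedFDeriv g ((0, q.2), (q.1, 0)) (1, 0), ?_, fun τ z => ?_, fun z => ?_⟩
  · have := contDiff_averagedFDeriv hg
    fun_prop
  · have h := averagedFDeriv_apply (hg.of_le (by exact_mod_cast le_top)) ((0, z) : ℝ × Q) (τ, 0)
    have h2 : ((τ, 0) : ℝ × Q) = τ • (1, 0) := by simp
    dsimp only
    rw [← map_smul, ← h2, h]
    simp
  · exact congrArg (fun L => L ((1 : ℝ), (0 : Q))) (averagedFDeriv_zero g (0, z))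

end ParametricIntegral

/-! ### Composition schemes -/

section Scheme

variable {E : Type} [NormedAddCommGroup E] [NormedSpace ℝ E]

/-- Perturbing the argument of a smooth family of maps `F τ`, `F 0 = id`, by a term of order
`τ ^ k` perturbs the value, to leading order, by the same term. -/
lemma exists_smooth_perturbation [CompleteSpace E] {F y v : ℝ × E → E} (hF : ContDiff ℝ ∞ F) (hy : ContDiff ℝ ∞ y)
    (hv : ContDiff ℝ ∞ v) (hF0 : ∀ z, F (0, z) = z) {k : ℕ} (hk : k ≠ 0) :
    ∃ N : ℝ × E → E, ContDiff ℝ ∞ N ∧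
      (∀ τ z, F (τ, y (τ, z) + τ ^ k • v (τ, z)) = F (τ, y (τ, z)) + τ ^ k • N (τ, z)) ∧
      ∀ z, N (0, z) = v (0, z) := by
  refine ⟨fun q => averagedFDeriv F ((q.1, y q), (0, q.1 ^ k • v q)) (0, v q), ?_, ?_, ?_⟩
  · have := contDiff_averagedFDeriv hF
    fun_prop
  · intro τ z
    have h := averagedFDeriv_apply (hF.of_le (by exact_mod_cast le_top)) ((τ, y (τ, z)) : ℝ × E)
      (0, τ ^ k • v (τ, z))
    have h2 : ((0, τ ^ k • v (τ, z)) : ℝ × E) = τ ^ k • (0, v (τ, z)) := by simp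
    dsimp only
    rw [← map_smul, ← h2, h]
    simp
  · intro z
    -- As `k ≠ 0`, the increment vanishes at `τ = 0`, and the averaged derivative reduces there to
    -- the derivative of `F (0, ·) = id`.
    simp only [ne_eq, hk, not_false_eq_true, zero_pow, zero_smul]
    have h0 : ((0, 0) : ℝ × E) = 0 := rfl
    rw [h0, averagedFDeriv_zero]
    have h1 : HasFDerivAt (fun w : E => F (0, w))
        ((fderiv ℝ F (0, y (0, z))).comp (ContinuousLinearMap.inr ℝ ℝ E)) (y (0, z)) :=
      HasFDerivAt.comp (y (0, z)) (hF.differentiable (by simp) _).hasFDerivAt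
        (hasFDerivAt_prodMk_right 0 (y (0, z)))
    have h2 : (fun w : E => F (0, w)) = id := funext hF0
    rw [h2] at h1
    have h3 := h1.unique (hasFDerivAt_id _)
    simpa using congrArg (fun L => L (v (0, z))) h3

/-- `Ψ τ = Φ (a τ²) + τ ^ m e + O(τ ^ (m + 1))`, with smooth remainder. -/
def IsApprox (Φ : ℝ → E → E) (m : ℕ) (a : ℝ) (Ψ : ℝ → E → E) (e : E → E) : Prop :=
  ∃ R : ℝ × E → E, ContDiff ℝ ∞ R ∧ (∀ τ z, Ψ τ z = Φ (a * τ ^ 2) z + τ ^ m • R (τ, z)) ∧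
    ∀ z, R (0, z) = e z

namespace IsApprox

variable {X : E → E} {Φ Ψ Ψ₁ Ψ₂ : ℝ → E → E} {K : ℝ≥0} {m : ℕ} {a b : ℝ} {e e₁ e₂ : E → E}

lemma apply_zero (hΦ : IsGlobalFlow X Φ) (hm : m ≠ 0) (h : IsApprox Φ m a Ψ e) (z : E) :
    Ψ 0 z = z := by
  obtain ⟨R, -, hR, -⟩ := h
  rw [hR]
  simp [hm, hΦ.zero]

lemma scale (h : IsApprox Φ m a Ψ e) (c : ℝ) :
    IsApprox Φ m (a * c ^ 2) (fun τ => Ψ (c * τ)) (fun z => c ^ m • e z) := by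
  obtain ⟨R, hR, hΨ, he⟩ := h
  refine ⟨fun q => c ^ m • R (c * q.1, q.2), by fun_prop, fun τ z => ?_, fun z => ?_⟩
  · dsimp only
    rw [hΨ, smul_smul, mul_pow, mul_pow, mul_comm (c ^ m), mul_assoc]
  · simp [he]

variable [CompleteSpace E]

/-- Leading errors add: the inner error passes through `Φ (a τ²)`, which is the identity at `τ = 0`,
unchanged to leading order. -/
lemma comp (hΦ : IsGlobalFlow X Φ) (hL : LipschitzWith K X) (hX : ContDiff ℝ ∞ X) (hm : m ≠ 0)
    (h₁ : IsApprox Φ m a Ψ₁ e₁) (h₂ : IsApprox Φ m b Ψ₂ e₂) :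
    IsApprox Φ m (a + b) (fun τ z => Ψ₁ τ (Ψ₂ τ z)) (fun z => e₁ z + e₂ z) := by
  have h20 := h₂.apply_zero hΦ hm
  obtain ⟨R₁, hR₁, hΨ₁, he₁⟩ := h₁
  obtain ⟨R₂, hR₂, hΨ₂, he₂⟩ := h₂
  have hs := hΦ.contDiff hL hX
  have hsc : ∀ c : ℝ, ContDiff ℝ ∞ fun q : ℝ × E => Φ (c * q.1 ^ 2) q.2 := fun c =>
    hs.comp (f := fun q : ℝ × E => (c * q.1 ^ 2, q.2)) (by fun_prop)
  obtain ⟨N, hN, hN1, hN0⟩ := exists_smooth_perturbation (hsc a) (hsc b) hR₂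
    (fun z => by simp [hΦ.zero]) hm
  have hΨs : ContDiff ℝ ∞ fun q : ℝ × E => Ψ₂ q.1 q.2 := by
    simp only [hΨ₂]
    exact (hsc b).add (by fun_prop)
  refine ⟨fun q => R₁ (q.1, Ψ₂ q.1 q.2) + N q, ?_, fun τ z => ?_, fun z => ?_⟩
  · fun_prop
  · have := hN1 τ z
    dsimp only at this ⊢
    rw [hΨ₁ τ, smul_add, add_mul, hΦ.add hL]
    nth_rw 1 [hΨ₂ τ z]
    rw [this]
    abel
  · simp [h20, he₁, he₂, hN0]

/-- From `z = Φ (a τ²) (Ψ' z) + τ^m R` one gets `Ψ' z = Φ (-a τ²) (z - τ^m R)`, so the leading error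
changes sign. -/
lemma inverse (hΦ : IsGlobalFlow X Φ) (hL : LipschitzWith K X) (hX : ContDiff ℝ ∞ X) (hm : m ≠ 0)
    (h : IsApprox Φ m a Ψ e) {Ψ' : ℝ → E → E} (hΨ' : ContDiff ℝ ∞ fun q : ℝ × E => Ψ' q.1 q.2)
    (hinv : ∀ τ z, Ψ τ (Ψ' τ z) = z) : IsApprox Φ m (-a) Ψ' (fun z => -e z) := by
  have h0 := h.apply_zero hΦ hm
  obtain ⟨R, hR, hΨ, he⟩ := h
  have hs := hΦ.contDiff hL hX
  have hsc : ContDiff ℝ ∞ fun q : ℝ × E => Φ (-a * q.1 ^ 2) q.2 :=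
    hs.comp (f := fun q : ℝ × E => (-a * q.1 ^ 2, q.2)) (by fun_prop)
  obtain ⟨N, hN, hN1, hN0⟩ := exists_smooth_perturbation hsc contDiff_snd
    (v := fun q => -R (q.1, Ψ' q.1 q.2)) (by fun_prop) (fun z => by simp [hΦ.zero]) hm
  refine ⟨N, hN, fun τ z => ?_, fun z => ?_⟩
  · have h1 := hN1 τ z
    dsimp only at h1
    rw [← h1]
    have h2 : z + τ ^ m • -R (τ, Ψ' τ z) = Φ (a * τ ^ 2) (Ψ' τ z) := by
      have h3 := hinv τ z
      rw [hΨ τ] at h3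
      nth_rw 1 [← h3]
      simp
    rw [h2, neg_mul, hΦ.neg_apply hL]
  · have h3 := hinv 0 z
    rw [h0] at h3
    rw [hN0]
    simp [h3, he]

lemma succ (h : IsApprox Φ m a Ψ e) (he0 : ∀ z, e z = 0) :
    ∃ e', IsApprox Φ (m + 1) a Ψ e' := by
  obtain ⟨R, hR, hΨ, he⟩ := h
  obtain ⟨R', hR', h1, -⟩ := exists_smooth_remainder hR
  refine ⟨fun z => R' (0, z), R', hR', fun τ z => ?_, fun _ => rfl⟩
  rw [hΨ, h1, he, he0, zero_add, smul_smul, pow_succ τ m]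

end IsApprox

section Quadratic

variable [CompleteSpace E]

lemma IsGlobalFlow.exists_second_order {A : E → E} {Φ : ℝ → E → E} {K : ℝ≥0}
    (hΦ : IsGlobalFlow A Φ) (hL : LipschitzWith K A) (hA : ContDiff ℝ ∞ A) :
    ∃ a₂ : ℝ × E → E, ContDiff ℝ ∞ a₂ ∧ ∀ τ z, Φ τ z = z + τ • A z + τ ^ 2 • a₂ (τ, z) := by
  obtain ⟨R, hR, h1, h2⟩ := exists_smooth_remainder (hΦ.contDiff hL hA)
  obtain ⟨R', hR', h3, -⟩ := exists_smooth_remainder hR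
  have h4 : ∀ z, R (0, z) = A z := by
    intro z
    rw [h2]
    have hd := ((hΦ.contDiff hL hA).differentiable (by simp) (0, z)).hasFDerivAt.comp_hasDerivAt
      (0 : ℝ) ((hasDerivAt_id (0 : ℝ)).prodMk (hasDerivAt_const 0 z))
    have := hd.unique (hΦ.deriv z 0)
    rwa [hΦ.zero] at this
  refine ⟨R', hR', fun τ z => ?_⟩
  have h5 := h1 τ z
  dsimp only at h5
  rw [h5, hΦ.zero, h3, h4]
  module

/-- `Ψ τ = id + τ² Y + O(τ³)`, with smooth remainder. -/
def IsQuadratic (Ψ : ℝ → E → E) (Y : E → E) : Prop :=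
  ∃ R : ℝ × E → E, ContDiff ℝ ∞ R ∧ ∀ τ z, Ψ τ z = z + τ ^ 2 • Y z + τ ^ 3 • R (τ, z)

namespace IsQuadratic

variable {X Y Y₁ Y₂ : E → E} {Φ Ψ Ψ₁ Ψ₂ : ℝ → E → E} {K : ℝ≥0}

lemma comp (h₁ : IsQuadratic Ψ₁ Y₁) (h₂ : IsQuadratic Ψ₂ Y₂) (hY₁ : ContDiff ℝ ∞ Y₁)
    (hY₂ : ContDiff ℝ ∞ Y₂) : IsQuadratic (fun τ z => Ψ₁ τ (Ψ₂ τ z)) (fun z => Y₂ z + Y₁ z) := by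
  obtain ⟨R₁, hR₁, hΨ₁⟩ := h₁
  obtain ⟨R₂, hR₂, hΨ₂⟩ := h₂
  have hΨs : ContDiff ℝ ∞ fun q : ℝ × E => Ψ₂ q.1 q.2 := by
    simp only [hΨ₂]
    fun_prop
  obtain ⟨N, hN, hN1, -⟩ := exists_smooth_remainder (g := fun q : ℝ × E => Y₁ (Ψ₂ q.1 q.2))
    (by fun_prop)
  have h0 : ∀ z, Ψ₂ 0 z = z := fun z => by simp [hΨ₂]
  refine ⟨fun q => R₂ q + N q + R₁ (q.1, Ψ₂ q.1 q.2), by fun_prop, fun τ z => ?_⟩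
  have h1 := hN1 τ z
  dsimp only at h1 ⊢
  rw [h0] at h1
  rw [hΨ₁, h1]
  nth_rw 1 [hΨ₂]
  module

lemma of_flow (hΦ : IsGlobalFlow X Φ) (hL : LipschitzWith K X) (hX : ContDiff ℝ ∞ X) :
    IsQuadratic (fun τ => Φ (τ ^ 2)) X := by
  obtain ⟨R, hR, h⟩ := hΦ.exists_second_order hL hX
  refine ⟨fun q => q.1 • R (q.1 ^ 2, q.2), by fun_prop, fun τ z => ?_⟩
  dsimp only
  rw [h]
  module

lemma isApprox (h : IsQuadratic Ψ X) (hΦ : IsGlobalFlow X Φ) (hL : LipschitzWith K X)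
    (hX : ContDiff ℝ ∞ X) : ∃ e, IsApprox Φ 3 1 Ψ e := by
  obtain ⟨R, hR, h1⟩ := h
  obtain ⟨R', hR', h2⟩ := of_flow hΦ hL hX
  refine ⟨fun z => R (0, z) - R' (0, z), fun q => R q - R' q, by fun_prop, fun τ z => ?_,
    fun _ => rfl⟩
  dsimp only at h2 ⊢
  rw [h1, one_mul, h2]
  module

end IsQuadratic

/-- The commutator of two flows, to second order. -/
lemma isQuadratic_commutator {A B : E → E} {ΦA ΦB : ℝ → E → E} {K L : ℝ≥0}
    (hA : IsGlobalFlow A ΦA) (hLA : LipschitzWith K A) (hAs : ContDiff ℝ ∞ A)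
    (hB : IsGlobalFlow B ΦB) (hLB : LipschitzWith L B) (hBs : ContDiff ℝ ∞ B) :
    IsQuadratic (fun τ z => ΦB (-τ) (ΦA (-τ) (ΦB τ (ΦA τ z)))) (VectorField.lieBracket ℝ A B) := by
  -- Exchanging `A` and `B` in this expansion alters only the mixed term, from `DB·A` to `DA·B`;
  -- hence the two orders of composition differ by `τ² [A, B] + O(τ³)`.
  have composed : ∀ {A B : E → E} {ΦA ΦB : ℝ → E → E} {K L : ℝ≥0} {a₂ b₂ : ℝ × E → E},
      IsGlobalFlow A ΦA → LipschitzWith K A → ContDiff ℝ ∞ A →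
      IsGlobalFlow B ΦB → LipschitzWith L B → ContDiff ℝ ∞ B →
      ContDiff ℝ ∞ a₂ → (∀ τ z, ΦA τ z = z + τ • A z + τ ^ 2 • a₂ (τ, z)) →
      ContDiff ℝ ∞ b₂ → (∀ τ z, ΦB τ z = z + τ • B z + τ ^ 2 • b₂ (τ, z)) →
      ∃ R : ℝ × E → E, ContDiff ℝ ∞ R ∧ ∀ τ z, ΦB τ (ΦA τ z) = z + τ • (A z + B z) +
        τ ^ 2 • (a₂ (0, z) + b₂ (0, z) + fderiv ℝ B z (A z)) + τ ^ 3 • R (τ, z) := by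
    intro A B ΦA ΦB K L a₂ b₂ hA hLA hAs hB hLB hBs ha₂ hA2 hb₂ hB2
    have hsA := hA.contDiff hLA hAs
    obtain ⟨g₁, hg₁, h1, h2⟩ := exists_smooth_remainder
      (g := fun q : ℝ × E => B (ΦA q.1 q.2)) (by fun_prop)
    obtain ⟨g₂, hg₂, h3, -⟩ := exists_smooth_remainder hg₁
    obtain ⟨b₃, hb₃, h4, -⟩ := exists_smooth_remainder
      (g := fun q : ℝ × E => b₂ (q.1, ΦA q.1 q.2)) (by fun_prop)
    obtain ⟨a₃, ha₃, h5, -⟩ := exists_smooth_remainder ha₂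
    have h6 : ∀ z, g₁ (0, z) = fderiv ℝ B z (A z) := by
      intro z
      rw [h2]
      have hds : ContDiff ℝ ∞ fun q : ℝ × E => B (ΦA q.1 q.2) := by fun_prop
      have hd := (hds.differentiable (by simp) (0, z)).hasFDerivAt.comp_hasDerivAt
        (0 : ℝ) ((hasDerivAt_id (0 : ℝ)).prodMk (hasDerivAt_const 0 z))
      have hd2 := (hBs.differentiable (by simp) (ΦA 0 z)).hasFDerivAt.comp_hasDerivAt
        (0 : ℝ) (hA.deriv z 0)
      have := hd.unique hd2
      rwa [hA.zero] at this
    refine ⟨fun q => a₃ q + g₂ q + b₃ q, by fun_prop, fun τ z => ?_⟩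
    have k1 := h1 τ z
    have k4 := h4 τ z
    dsimp only at k1 k4
    rw [hA.zero] at k1 k4
    rw [hB2, k1, k4, h3, h6]
    nth_rw 1 [hA2]
    rw [h5]
    module
  obtain ⟨a₂, ha₂, hA2⟩ := hA.exists_second_order hLA hAs
  obtain ⟨b₂, hb₂, hB2⟩ := hB.exists_second_order hLB hBs
  obtain ⟨R, hR, hP⟩ := composed hA hLA hAs hB hLB hBs ha₂ hA2 hb₂ hB2
  obtain ⟨R', hR', hQ⟩ := composed hB hLB hBs hA hLA hAs hb₂ hB2 ha₂ hA2
  have hsA := hA.contDiff hLA hAs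
  have hsB := hB.contDiff hLB hBs
  have hlie : ContDiff ℝ ∞ (VectorField.lieBracket ℝ A B) := by
    have h1 : ContDiff ℝ ∞ (fderiv ℝ A) := hAs.fderiv_right (by simp)
    have h2 : ContDiff ℝ ∞ (fderiv ℝ B) := hBs.fderiv_right (by simp)
    simp only [VectorField.lieBracket_eq]
    fun_prop
  have hnA : ContDiff ℝ ∞ fun q : ℝ × E => ΦA (-q.1) q.2 :=
    hsA.comp (f := fun q : ℝ × E => (-q.1, q.2)) (by fun_prop)
  have hnB : ContDiff ℝ ∞ fun q : ℝ × E => ΦB (-q.1) q.2 :=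
    hsB.comp (f := fun q : ℝ × E => (-q.1, q.2)) (by fun_prop)
  -- `F` inverts `y = ΦA ΦB`, and the commutator is `F` applied to `ΦB ΦA = y + τ² v`. So it equals
  -- `z + τ² N`, where `N` starts with the Lie bracket.
  obtain ⟨N, hN, hN1, hN0⟩ := exists_smooth_perturbation
    (F := fun q => ΦB (-q.1) (ΦA (-q.1) q.2)) (y := fun q => ΦA q.1 (ΦB q.1 q.2))
    (v := fun q => VectorField.lieBracket ℝ A B q.2 + q.1 • (R q - R' q))
    (hnB.comp (f := fun q : ℝ × E => (q.1, ΦA (-q.1) q.2)) (by fun_prop))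
    (hsA.comp (f := fun q : ℝ × E => (q.1, ΦB q.1 q.2)) (by fun_prop))
    (by fun_prop) (fun z => by simp [hA.zero, hB.zero]) two_ne_zero
  obtain ⟨N₁, hN₁, h1, -⟩ := exists_smooth_remainder hN
  refine ⟨N₁, hN₁, fun τ z => ?_⟩
  have h2 := hN1 τ z
  dsimp only at h2
  rw [hA.neg_apply hLA, hB.neg_apply hLB] at h2
  have h3 : ΦA τ (ΦB τ z) + τ ^ 2 • (VectorField.lieBracket ℝ A B z +
      τ • (R (τ, z) - R' (τ, z))) = ΦB τ (ΦA τ z) := by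
    rw [hP, hQ, VectorField.lieBracket]
    module
  rw [h3] at h2
  dsimp only
  rw [h2, h1, hN0]
  simp only [zero_smul, add_zero]
  module

/-! ### Words in the flows -/

end Quadratic

variable {Γ : Type*}

/-- The composition of the flows `fl g (c τ ^ k)` over the entries `(g, c, k)` of a list, the first
one applied first. -/
def evalWord (fl : Γ → ℝ → E → E) : List (Γ × ℝ × ℕ) → ℝ → E → E
  | [], _, z => z
  | f :: w, τ, z => evalWord fl w τ (fl f.1 (f.2.1 * τ ^ f.2.2) z)

/-- The word that represents the composition at the step size `b τ`. -/
def scaleWord (b : ℝ) (w : List (Γ × ℝ × ℕ)) : List (Γ × ℝ × ℕ) :=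
  w.map fun f => (f.1, f.2.1 * b ^ f.2.2, f.2.2)

/-- The word that represents the inverse. -/
def invWord (w : List (Γ × ℝ × ℕ)) : List (Γ × ℝ × ℕ) :=
  (w.map fun f => (f.1, -f.2.1, f.2.2)).reverse

/-- The composition `Ψ_{cτ} Ψ_{cτ} Ψ_{bτ}⁻¹`, with `b` and `c` such that `2 c² - b² = 1` and
`2 c ^ m = b ^ m`. -/
noncomputable def raiseWord (m : ℕ) (w : List (Γ × ℝ × ℕ)) : List (Γ × ℝ × ℕ) :=
  -- With `b = β c` the second equation says `β^m = 2`, and the first becomes `c² (2 - β²) = 1`,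
  -- which is solvable because `β² < 2` for `m ≥ 3`.
  let β : ℝ := 2 ^ ((m : ℝ)⁻¹)
  let c : ℝ := (√(2 - β ^ 2))⁻¹
  scaleWord c w ++ (scaleWord c w ++ invWord (scaleWord (β * c) w))

/-- The word of order `k + 3` in `τ` obtained from a word of order `3`. -/
noncomputable def orderWord (w : List (Γ × ℝ × ℕ)) : ℕ → List (Γ × ℝ × ℕ)
  | 0 => w
  | k + 1 => raiseWord (k + 3) (orderWord w k)

lemma evalWord_append {E : Type} (fl : Γ → ℝ → E → E) (w w' : List (Γ × ℝ × ℕ)) (τ : ℝ) (z : E) :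
    evalWord fl (w ++ w') τ z = evalWord fl w' τ (evalWord fl w τ z) := by
  induction w generalizing z with
  | nil => rfl
  | cons f w ih => exact ih _

lemma evalWord_scaleWord {E : Type} (fl : Γ → ℝ → E → E) (b : ℝ) (w : List (Γ × ℝ × ℕ)) (τ : ℝ) (z : E) :
    evalWord fl (scaleWord b w) τ z = evalWord fl w (b * τ) z := by
  induction w generalizing z with
  | nil => rfl
  | cons f w ih =>
    refine (ih _).trans ?_
    simp only [evalWord, mul_pow, mul_assoc]

lemma invWord_invWord (w : List (Γ × ℝ × ℕ)) : invWord (invWord w) = w := by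
  simp [invWord, Function.comp_def]

/-- Every entry `(g, c, k)` of an `orderWord` has a generator and an exponent that occur in the
word. -/
lemma exists_mem_of_mem_orderWord (w : List (Γ × ℝ × ℕ)) (k : ℕ) :
    ∀ f ∈ orderWord w k, ∃ f' ∈ w, f.1 = f'.1 ∧ f.2.2 = f'.2.2 := by
  induction k with
  | zero => exact fun f hf => ⟨f, hf, rfl, rfl⟩
  | succ k ih =>
    intro f hf
    simp only [orderWord, raiseWord, scaleWord, invWord, List.mem_append, List.mem_reverse,
      List.mem_map, or_self_left] at hf
    obtain ⟨f', hf', rfl⟩ | ⟨-, ⟨f', hf', rfl⟩, rfl⟩ := hf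
    · exact ih f' hf'
    · exact ih f' hf'

section Flows

variable {A : Γ → E → E} {fl : Γ → ℝ → E → E} {L : Γ → ℝ≥0}

lemma evalWord_invWord_apply (hfl : ∀ g, IsGlobalFlow (A g) (fl g))
    (hL : ∀ g, LipschitzWith (L g) (A g)) (w : List (Γ × ℝ × ℕ)) (τ : ℝ) (z : E) :
    evalWord fl (invWord w) τ (evalWord fl w τ z) = z := by
  induction w generalizing z with
  | nil => rfl
  | cons f w ih =>
    have : invWord (f :: w) = invWord w ++ [(f.1, -f.2.1, f.2.2)] := by simp [invWord]
    rw [this, evalWord_append]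
    simp only [evalWord]
    rw [ih, neg_mul, (hfl f.1).neg_apply (hL f.1)]

lemma evalWord_apply_invWord (hfl : ∀ g, IsGlobalFlow (A g) (fl g))
    (hL : ∀ g, LipschitzWith (L g) (A g)) (w : List (Γ × ℝ × ℕ)) (τ : ℝ) (z : E) :
    evalWord fl w τ (evalWord fl (invWord w) τ z) = z := by
  have := evalWord_invWord_apply hfl hL (invWord w) τ z
  rwa [invWord_invWord] at this

variable [CompleteSpace E]

lemma contDiff_evalWord (hfl : ∀ g, IsGlobalFlow (A g) (fl g)) (hL : ∀ g, LipschitzWith (L g) (A g))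
    (hA : ∀ g, ContDiff ℝ ∞ (A g)) (w : List (Γ × ℝ × ℕ)) :
    ContDiff ℝ ∞ fun q : ℝ × E => evalWord fl w q.1 q.2 := by
  induction w with
  | nil => exact contDiff_snd
  | cons f w ih =>
    have h1 := (hfl f.1).contDiff (hL f.1) (hA f.1)
    have h2 : ContDiff ℝ ∞ fun q : ℝ × E => fl f.1 (f.2.1 * q.1 ^ f.2.2) q.2 :=
      h1.comp (f := fun q : ℝ × E => (f.2.1 * q.1 ^ f.2.2, q.2)) (by fun_prop)
    exact ih.comp (f := fun q : ℝ × E => (q.1, fl f.1 (f.2.1 * q.1 ^ f.2.2) q.2)) (by fun_prop)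

lemma isApprox_raiseWord (hfl : ∀ g, IsGlobalFlow (A g) (fl g))
    (hL : ∀ g, LipschitzWith (L g) (A g)) (hA : ∀ g, ContDiff ℝ ∞ (A g))
    {X : E → E} {Φ : ℝ → E → E} {K : ℝ≥0} (hΦ : IsGlobalFlow X Φ) (hLX : LipschitzWith K X)
    (hX : ContDiff ℝ ∞ X) {m : ℕ} (hm : 3 ≤ m) {w : List (Γ × ℝ × ℕ)} {e : E → E}
    (h : IsApprox Φ m 1 (evalWord fl w) e) :
    ∃ e', IsApprox Φ (m + 1) 1 (evalWord fl (raiseWord m w)) e' := by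
  have hm0 : m ≠ 0 := by omega
  set β : ℝ := 2 ^ ((m : ℝ)⁻¹) with hβ
  set c : ℝ := (√(2 - β ^ 2))⁻¹ with hc
  have hβm : β ^ m = 2 := Real.rpow_inv_natCast_pow zero_le_two hm0
  have hβ1 : 1 < β := Real.one_lt_rpow one_lt_two (by positivity)
  have hβ2 : β ^ 2 < 2 := by
    rw [← hβm]
    exact pow_lt_pow_right₀ hβ1 (by omega)
  have hc2 : c ^ 2 * (2 - β ^ 2) = 1 := by
    rw [hc, inv_pow, Real.sq_sqrt (by linarith)]
    exact inv_mul_cancel₀ (by linarith)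
  have hsc : ∀ b : ℝ, IsApprox Φ m (1 * b ^ 2) (evalWord fl (scaleWord b w))
      (fun z => b ^ m • e z) := by
    intro b
    have := h.scale b
    have h2 : evalWord fl (scaleWord b w) = fun τ => evalWord fl w (b * τ) := by
      funext τ z
      exact evalWord_scaleWord fl b w τ z
    rwa [h2]
  -- Flow times are proportional to `τ²`, so a backward step cannot be obtained from `-τ`; the
  -- inverse word provides it.
  have hinv := (hsc (β * c)).inverse hΦ hLX hX hm0
    (contDiff_evalWord hfl hL hA (invWord (scaleWord (β * c) w)))
    (evalWord_apply_invWord hfl hL _)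
  have hcomp := IsApprox.comp hΦ hLX hX hm0 hinv (IsApprox.comp hΦ hLX hX hm0 (hsc c) (hsc c))
  have h1 : -(1 * (β * c) ^ 2) + (1 * c ^ 2 + 1 * c ^ 2) = 1 := by
    rw [mul_pow]
    linarith
  rw [h1] at hcomp
  have h2 : evalWord fl (raiseWord m w) = fun τ z => evalWord fl (invWord (scaleWord (β * c) w)) τ
      (evalWord fl (scaleWord c w) τ (evalWord fl (scaleWord c w) τ z)) := by
    funext τ z
    simp only [raiseWord, evalWord_append]
    rfl
  rw [h2]
  -- The leading error has the coefficient `2 c^m - (β c)^m = 0`.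
  refine hcomp.succ fun z => ?_
  rw [mul_pow, hβm]
  module

lemma isApprox_orderWord (hfl : ∀ g, IsGlobalFlow (A g) (fl g))
    (hL : ∀ g, LipschitzWith (L g) (A g)) (hA : ∀ g, ContDiff ℝ ∞ (A g))
    {X : E → E} {Φ : ℝ → E → E} {K : ℝ≥0} (hΦ : IsGlobalFlow X Φ) (hLX : LipschitzWith K X)
    (hX : ContDiff ℝ ∞ X) {w : List (Γ × ℝ × ℕ)} (h : IsQuadratic (evalWord fl w) X) (k : ℕ) :
    ∃ e, IsApprox Φ (k + 3) 1 (evalWord fl (orderWord w k)) e := by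
  induction k with
  | zero => exact h.isApprox hΦ hLX hX
  | succ k ih =>
    obtain ⟨e, he⟩ := ih
    obtain ⟨e', he'⟩ := isApprox_raiseWord hfl hL hA hΦ hLX hX (by omega) he
    exact ⟨e', he'⟩

end Flows

end Scheme

/-! ### Estimates for derivatives of compositions -/

section Estimates

variable {D E F G : Type} [NormedAddCommGroup D] [NormedSpace ℝ D] [NormedAddCommGroup E]
  [NormedSpace ℝ E] [NormedAddCommGroup F] [NormedSpace ℝ F] [NormedAddCommGroup G]
  [NormedSpace ℝ G]

lemma norm_iteratedFDeriv_bilinear_le (B : E →L[ℝ] F →L[ℝ] G) {f : D → E} {g : D → F}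
    {N : WithTop ℕ∞} (hf : ContDiff ℝ N f) (hg : ContDiff ℝ N g) (x : D) {k : ℕ} (hk : k ≤ N)
    {a b : ℝ} (ha : ∀ i ≤ k, ‖iteratedFDeriv ℝ i f x‖ ≤ a)
    (hb : ∀ i ≤ k, ‖iteratedFDeriv ℝ i g x‖ ≤ b) :
    ‖iteratedFDeriv ℝ k (fun y => B (f y) (g y)) x‖ ≤ ‖B‖ * (2 ^ k * (a * b)) := by
  refine (B.norm_iteratedFDeriv_le_of_bilinear hf hg x hk).trans ?_
  gcongr
  have ha0 : 0 ≤ a := (norm_nonneg _).trans (ha 0 (Nat.zero_le _))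
  have hsum : ∑ i ∈ Finset.range (k + 1), (k.choose i : ℝ) * (a * b) = 2 ^ k * (a * b) := by
    rw [← Finset.sum_mul]
    congr 1
    exact_mod_cast Nat.sum_range_choose k
  rw [← hsum]
  refine Finset.sum_le_sum fun i hi => ?_
  have hi' : i ≤ k := by simpa [Nat.lt_succ_iff] using hi
  rw [mul_assoc]
  gcongr
  · exact ha i hi'
  · exact hb _ (Nat.sub_le _ _)

lemma norm_iteratedFDeriv_succ_sub (f g : E → F) (x y : E) (i : ℕ) :
    ‖iteratedFDeriv ℝ (i + 1) f x - iteratedFDeriv ℝ (i + 1) g y‖ =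
      ‖iteratedFDeriv ℝ i (fderiv ℝ f) x - iteratedFDeriv ℝ i (fderiv ℝ g) y‖ := by
  rw [iteratedFDeriv_succ_eq_comp_right, iteratedFDeriv_succ_eq_comp_right, ← dist_eq_norm,
    ← dist_eq_norm]
  exact LinearIsometryEquiv.dist_map _ _ _

/-- The constant in `norm_iteratedFDeriv_comp_sub_comp_le`. -/
noncomputable def compConst (M : ℝ) : ℕ → ℝ
  | 0 => 1
  | r + 1 => 1 + 2 ^ r * (compConst M r * M) + 2 ^ r * (r.factorial * M * M ^ r)

lemma one_le_compConst {M : ℝ} (hM : 1 ≤ M) (r : ℕ) : 1 ≤ compConst M r := by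
  induction r with
  | zero => exact le_rfl
  | succ r ih =>
    have : 0 ≤ compConst M r := by linarith
    rw [compConst, add_assoc]
    have h1 : 0 ≤ 2 ^ r * (compConst M r * M) := by positivity
    have h2 : 0 ≤ 2 ^ r * (r.factorial * M * M ^ r) := by positivity
    linarith

/-- The derivatives of `f ∘ a` and `g ∘ b` at a point are close if those of `f` and `g`, and those
of `a` and `b`, are close along the point. -/
lemma norm_iteratedFDeriv_comp_sub_comp_le {M : ℝ} (hM : 1 ≤ M) (r : ℕ)
    {F : Type} [NormedAddCommGroup F] [NormedSpace ℝ F] {f g : E → F}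
    {a b : D → E} (hf : ContDiff ℝ r f) (hg : ContDiff ℝ r g) (ha : ContDiff ℝ r a)
    (hb : ContDiff ℝ r b) {z : D} {ε : ℝ}
    (hgM : ∀ i, 1 ≤ i → i ≤ r → ‖iteratedFDeriv ℝ i g (b z)‖ ≤ M)
    (haM : ∀ i, 1 ≤ i → i ≤ r → ‖iteratedFDeriv ℝ i a z‖ ≤ M)
    (hbM : ∀ i, 1 ≤ i → i ≤ r → ‖iteratedFDeriv ℝ i b z‖ ≤ M)
    (hfg : ∀ i ≤ r, ‖iteratedFDeriv ℝ i f (a z) - iteratedFDeriv ℝ i g (b z)‖ ≤ ε)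
    (hab : ∀ i, 1 ≤ i → i ≤ r → ‖iteratedFDeriv ℝ i a z - iteratedFDeriv ℝ i b z‖ ≤ ε) :
    ∀ j ≤ r, ‖iteratedFDeriv ℝ j (fun y => f (a y) - g (b y)) z‖ ≤ compConst M r * ε := by
  have hε : 0 ≤ ε := (norm_nonneg _).trans (hfg 0 (Nat.zero_le _))
  have hzero : ‖f (a z) - g (b z)‖ ≤ ε := by
    have := hfg 0 (Nat.zero_le _)
    rwa [iteratedFDeriv_zero_eq_comp, iteratedFDeriv_zero_eq_comp, Function.comp_apply,
      Function.comp_apply, ← map_sub, LinearIsometryEquiv.norm_map] at this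
  induction r generalizing F with
  | zero =>
    intro j hj
    obtain rfl : j = 0 := by omega
    simpa [compConst] using hzero
  | succ r ih =>
    have hM0 : 0 ≤ M := by linarith
    have hC1 := one_le_compConst hM r
    have hC0 : 0 ≤ compConst M r := by linarith
    intro j hj
    rcases j with _ | j
    · rw [norm_iteratedFDeriv_zero]
      refine hzero.trans (le_mul_of_one_le_left hε (one_le_compConst hM _))
    · have hj' : j ≤ r := by omega
      have hle : ((r : ℕ) : WithTop ℕ∞) ≤ ((r + 1 : ℕ) : WithTop ℕ∞) := by
        exact_mod_cast Nat.le_succ r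
      have hf1 : ContDiff ℝ r (fderiv ℝ f) := hf.fderiv_right (by exact_mod_cast le_rfl)
      have hg1 : ContDiff ℝ r (fderiv ℝ g) := hg.fderiv_right (by exact_mod_cast le_rfl)
      have ha1 : ContDiff ℝ r (fderiv ℝ a) := ha.fderiv_right (by exact_mod_cast le_rfl)
      have hb1 : ContDiff ℝ r (fderiv ℝ b) := hb.fderiv_right (by exact_mod_cast le_rfl)
      have ha0 := ha.of_le hle
      have hb0 := hb.of_le hle
      have hne : ((r + 1 : ℕ) : WithTop ℕ∞) ≠ 0 := by exact_mod_cast Nat.succ_ne_zero r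
      -- The derivative is `(Df∘a - Dg∘b) Da + (Dg∘b)(Da - Db)`. The first bracket is again a
      -- difference of compositions, of one order less and with values in another space; hence the
      -- induction over all `F`.
      have hfd : fderiv ℝ (fun y => f (a y) - g (b y)) = fun y =>
          ContinuousLinearMap.compL ℝ D E F (fderiv ℝ f (a y) - fderiv ℝ g (b y)) (fderiv ℝ a y) +
          ContinuousLinearMap.compL ℝ D E F (fderiv ℝ g (b y)) (fderiv ℝ a y - fderiv ℝ b y) := by
        funext y
        have h1 := ((hf.differentiable hne (a y)).hasFDerivAt.comp y
          (ha.differentiable hne y).hasFDerivAt).sub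
          ((hg.differentiable hne (b y)).hasFDerivAt.comp y (hb.differentiable hne y).hasFDerivAt)
        refine h1.fderiv.trans ?_
        ext v
        simp
      have hfg1 : ContDiff ℝ r fun y => fderiv ℝ f (a y) - fderiv ℝ g (b y) :=
        (hf1.comp ha0).sub (hg1.comp hb0)
      have hgb1 : ContDiff ℝ r fun y => fderiv ℝ g (b y) := hg1.comp hb0
      have hab1 : ContDiff ℝ r fun y => fderiv ℝ a y - fderiv ℝ b y := ha1.sub hb1
      have hjr : (j : WithTop ℕ∞) ≤ (r : WithTop ℕ∞) := by exact_mod_cast hj'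
      have hIH := ih hf1 hg1 ha0 hb0
        (fun i h1 h2 => by
          rw [norm_iteratedFDeriv_fderiv]
          exact hgM _ (by omega) (by omega))
        (fun i h1 h2 => haM i h1 (by omega)) (fun i h1 h2 => hbM i h1 (by omega))
        (fun i hi => by
          rw [← norm_iteratedFDeriv_succ_sub]
          exact hfg _ (by omega))
        (fun i h1 h2 => hab i h1 (by omega))
        (by
          have := hfg 1 (by omega)
          rw [norm_iteratedFDeriv_succ_sub] at this
          rwa [iteratedFDeriv_zero_eq_comp, iteratedFDeriv_zero_eq_comp, Function.comp_apply,
            Function.comp_apply, ← map_sub, LinearIsometryEquiv.norm_map] at this)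
      have hL := ContinuousLinearMap.norm_compL_le ℝ D E F
      have e1 : ‖iteratedFDeriv ℝ j (fun y => ContinuousLinearMap.compL ℝ D E F
          (fderiv ℝ f (a y) - fderiv ℝ g (b y)) (fderiv ℝ a y)) z‖ ≤
          1 * (2 ^ r * (compConst M r * ε * M)) := by
        refine (norm_iteratedFDeriv_bilinear_le _ hfg1 ha1 z hjr
          (fun i hi => hIH i (by omega)) (b := M) (fun i hi => ?_)).trans ?_
        · rw [norm_iteratedFDeriv_fderiv]
          exact haM _ (by omega) (by omega)
        · gcongr
          exact one_le_two
      have e2 : ‖iteratedFDeriv ℝ j (fun y => ContinuousLinearMap.compL ℝ D E F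
          (fderiv ℝ g (b y)) (fderiv ℝ a y - fderiv ℝ b y)) z‖ ≤
          1 * (2 ^ r * (r.factorial * M * M ^ r * ε)) := by
        refine (norm_iteratedFDeriv_bilinear_le _ hgb1 hab1 z hjr (a := r.factorial * M * M ^ r)
          (b := ε) (fun i hi => ?_) (fun i hi => ?_)).trans ?_
        · have hi' : (i : WithTop ℕ∞) ≤ (r : WithTop ℕ∞) := by exact_mod_cast hi.trans hj'
          refine (norm_iteratedFDeriv_comp_le (g := fderiv ℝ g) (f := b) hg1 hb0 hi' z (C := M)
            (D := M) (fun l hl => ?_) (fun l h1 hl => ?_)).trans ?_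
          · rw [norm_iteratedFDeriv_fderiv]
            exact hgM _ (by omega) (by omega)
          · exact (hbM l h1 (by omega)).trans (le_self_pow₀ hM (by omega))
          · have : (i.factorial : ℝ) ≤ r.factorial := by
              exact_mod_cast Nat.factorial_le (hi.trans hj')
            have := pow_le_pow_right₀ hM (hi.trans hj')
            gcongr
        · rw [fun_iteratedFDeriv_sub_apply (ha1.of_le (by exact_mod_cast hi.trans hj')).contDiffAt
            (hb1.of_le (by exact_mod_cast hi.trans hj')).contDiffAt,
            ← norm_iteratedFDeriv_succ_sub]
          exact hab _ (by omega) (by omega)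
        · gcongr
          exact one_le_two
      rw [← norm_iteratedFDeriv_fderiv, hfd]
      have c1 : ContDiff ℝ j (fun y => ContinuousLinearMap.compL ℝ D E F
          (fderiv ℝ f (a y) - fderiv ℝ g (b y)) (fderiv ℝ a y)) :=
        (hfg1.clm_comp ha1).of_le hjr
      have c2 : ContDiff ℝ j (fun y => ContinuousLinearMap.compL ℝ D E F
          (fderiv ℝ g (b y)) (fderiv ℝ a y - fderiv ℝ b y)) :=
        (hgb1.clm_comp hab1).of_le hjr
      rw [fun_iteratedFDeriv_add_apply c1.contDiffAt c2.contDiffAt]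
      refine (norm_add_le _ _).trans ((add_le_add e1 e2).trans ?_)
      rw [compConst]
      nlinarith

/-- The derivatives of an affine contraction. -/
lemma norm_iteratedFDeriv_affine_le (L : E →L[ℝ] F) (hL : ‖L‖ ≤ 1) (c : F) {j : ℕ} (hj : 1 ≤ j)
    (z : E) : ‖iteratedFDeriv ℝ j (fun z => L z + c) z‖ ≤ 1 := by
  obtain ⟨j, rfl⟩ := Nat.exists_eq_add_of_le' hj
  have h : fderiv ℝ (fun z => L z + c) = fun _ => L :=
    funext fun z => (L.hasFDerivAt.add_const c).fderiv
  rw [← norm_iteratedFDeriv_fderiv, h]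
  rcases j with _ | j
  · simpa using hL
  · rw [iteratedFDeriv_succ_const]
    simp

/-- The spatial derivatives of a smooth family of maps with compact support are bounded. -/
lemma exists_bound_iteratedFDeriv {Z : ℝ × E → F} (hZ : ContDiff ℝ ∞ Z) {S : Set E}
    (hS : IsCompact S) (hZS : ∀ t, ∀ z ∉ S, Z (t, z) = 0) (a b : ℝ) (r : ℕ) :
    ∃ C, 0 ≤ C ∧ ∀ t ∈ Icc a b, ∀ i ≤ r, ∀ z, ‖iteratedFDeriv ℝ i (fun z => Z (t, z)) z‖ ≤ C := by
  have hK : IsCompact (Icc a b ×ˢ S) := isCompact_Icc.prod hS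
  have hbd : ∀ i : ℕ, ∃ C, ∀ q ∈ Icc a b ×ˢ S, ‖iteratedFDeriv ℝ i Z q‖ ≤ C := fun i =>
    hK.exists_bound_of_continuousOn (hZ.continuous_iteratedFDeriv
      (by exact_mod_cast le_top)).continuousOn
  choose C hC using hbd
  set M := ∑ i ∈ Finset.range (r + 1), |C i| with hM
  have hMi : ∀ i ≤ r, C i ≤ M := fun i hi => (le_abs_self _).trans
    (Finset.single_le_sum (f := fun i => |C i|) (fun _ _ => abs_nonneg _)
      (Finset.mem_range.2 (by omega)))
  have hM0 : 0 ≤ M := Finset.sum_nonneg fun _ _ => abs_nonneg _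
  refine ⟨r.factorial * M, by positivity, fun t ht i hi z => ?_⟩
  by_cases hz : z ∈ S
  · have := norm_iteratedFDeriv_comp_le (g := Z) (f := fun z : E => ((t, z) : ℝ × E)) hZ
      (by fun_prop : ContDiff ℝ ∞ _) (n := i) (by exact_mod_cast le_top) z (C := M) (D := 1)
      (fun l hl => (hC l (t, z) ⟨ht, hz⟩).trans (hMi l (by omega)))
      (fun l h1 _ => by
        have := norm_iteratedFDeriv_affine_le (ContinuousLinearMap.inr ℝ ℝ E)
          (ContinuousLinearMap.norm_inr_le_one ℝ ℝ E) (t, 0) h1 z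
        simpa using this)
    refine this.trans ?_
    rw [one_pow, mul_one]
    gcongr
  · have : (fun z => Z (t, z)) =ᶠ[𝓝 z] fun _ => 0 := by
      filter_upwards [hS.isClosed.isOpen_compl.mem_nhds hz] with y hy using hZS t y hy
    rw [(this.iteratedFDeriv ℝ i).eq_of_nhds]
    simp only [iteratedFDeriv_fun_zero, Pi.zero_apply, norm_zero]
    positivity

end Estimates

/-! ### The global error of one-step maps -/

section GlobalError

variable {E : Type} [NormedAddCommGroup E] [NormedSpace ℝ E]

lemma contDiff_iterate {ψ : E → E} {N : WithTop ℕ∞} (hψ : ContDiff ℝ N ψ) (k : ℕ) :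
    ContDiff ℝ N ψ^[k] := by
  induction k with
  | zero => exact contDiff_id
  | succ k ih =>
    rw [Function.iterate_succ]
    exact ih.comp hψ

/-- The constant in `norm_iteratedFDeriv_iterate_sub_le`. -/
noncomputable def iterateConst (r : ℕ) (M : ℝ) : ℝ :=
  r.factorial * (compConst M r * (M * 1)) * (M + 1) ^ r

/-- Accumulation of the local errors. -/
lemma norm_iteratedFDeriv_iterate_sub_le {r : ℕ} {M ε : ℝ} (hM : 1 ≤ M) (hε : 0 ≤ ε)
    {φ : ℕ → E → E} {ψ : E → E} (hφ : ∀ k, ContDiff ℝ ∞ (φ k)) (hψ : ContDiff ℝ ∞ ψ)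
    (h0 : φ 0 = id) (hsucc : ∀ k z, φ (k + 1) z = φ k (φ 1 z)) {N : ℕ} (hN : 1 ≤ N)
    (hφM : ∀ k ≤ N, ∀ i, 1 ≤ i → i ≤ r + 1 → ∀ z, ‖iteratedFDeriv ℝ i (φ k) z‖ ≤ M)
    (hψM : ∀ i, 1 ≤ i → i ≤ r → ∀ z, ‖iteratedFDeriv ℝ i ψ z‖ ≤ M)
    (hloc : ∀ i ≤ r, ∀ z, ‖iteratedFDeriv ℝ i (fun z => ψ z - φ 1 z) z‖ ≤ ε)
    (hsmall : N * (iterateConst r M * ε) ≤ 1) :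
    ∀ k ≤ N, ∀ i ≤ r, ∀ z, ‖iteratedFDeriv ℝ i (fun z => ψ^[k] z - φ k z) z‖ ≤
      k * (iterateConst r M * ε) := by
  have hM0 : 0 ≤ M := by linarith
  have hC0 : 0 ≤ compConst M r := by linarith [one_le_compConst hM r]
  have hI0 : 0 ≤ iterateConst r M := by unfold iterateConst; positivity
  have hle : ∀ i : ℕ, ((i : ℕ) : WithTop ℕ∞) ≤ (∞ : WithTop ℕ∞) := fun i => by exact_mod_cast le_top
  have hψk : ∀ k, ContDiff ℝ ∞ (ψ^[k]) := fun k => contDiff_iterate hψ k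
  -- This is where bounds for `φ` of order `r + 1` are spent: comparing `φ l ∘ ψ` with `φ l ∘ φ 1`
  -- in `C^r` costs one derivative of `φ l`.
  have hlip : ∀ l ≤ N, ∀ i ≤ r, ∀ x y,
      ‖iteratedFDeriv ℝ i (φ l) x - iteratedFDeriv ℝ i (φ l) y‖ ≤ M * ‖x - y‖ := by
    intro l hl i hi x y
    refine Convex.norm_image_sub_le_of_norm_fderiv_le (𝕜 := ℝ) (s := univ) (fun x _ => ?_)
      (fun x _ => ?_) convex_univ (mem_univ _) (mem_univ _)
    · exact ((hφ l).differentiable_iteratedFDeriv (by exact_mod_cast ENat.natCast_lt_top i)) x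
    · rw [norm_fderiv_iteratedFDeriv]
      exact hφM l hl _ (by omega) (by omega) x
  -- one step
  have hstep : ∀ l ≤ N, ∀ i ≤ r, ∀ z,
      ‖iteratedFDeriv ℝ i (fun z => φ l (ψ z) - φ l (φ 1 z)) z‖ ≤ compConst M r * (M * ε) := by
    intro l hl i hi z
    have hsub : ∀ i ≤ r, ∀ z, ‖iteratedFDeriv ℝ i ψ z - iteratedFDeriv ℝ i (φ 1) z‖ ≤ ε := by
      intro i hi z
      have := hloc i hi z
      rwa [fun_iteratedFDeriv_sub_apply (hψ.of_le (hle i)).contDiffAt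
        ((hφ 1).of_le (hle i)).contDiffAt] at this
    have hεM : ε ≤ M * ε := le_mul_of_one_le_left hε hM
    refine norm_iteratedFDeriv_comp_sub_comp_le hM r ((hφ l).of_le (hle r))
      ((hφ l).of_le (hle r)) (hψ.of_le (hle r)) ((hφ 1).of_le (hle r))
      (fun i h1 h2 => hφM l hl i h1 (by omega) _) (fun i h1 h2 => hψM i h1 h2 z)
      (fun i h1 h2 => hφM 1 hN i h1 (by omega) z) (fun i hi => ?_)
      (fun i h1 h2 => (hsub i h2 z).trans hεM) i hi
    refine (hlip l hl i hi _ _).trans ?_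
    gcongr
    have := hloc 0 (Nat.zero_le _) z
    rwa [norm_iteratedFDeriv_zero] at this
  intro k
  induction k using Nat.strong_induction_on with
  | _ k ih =>
    intro hkN
    -- The error bounds of the earlier iterates, together with `hsmall`, keep the derivatives of
    -- `ψ^[j]` within `1` of those of the exact flow, so no growth in `j` occurs.
    have hψM' : ∀ j < k, ∀ i, 1 ≤ i → i ≤ r → ∀ z, ‖iteratedFDeriv ℝ i (ψ^[j]) z‖ ≤ M + 1 := by
      intro j hj i h1 h2 z
      have e1 := ih j hj (by omega) i h2 z
      rw [fun_iteratedFDeriv_sub_apply ((hψk j).of_le (hle i)).contDiffAt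
        ((hφ j).of_le (hle i)).contDiffAt] at e1
      have e2 := hφM j (by omega) i h1 (by omega) z
      have e3 : (j : ℝ) * (iterateConst r M * ε) ≤ 1 := by
        refine le_trans ?_ hsmall
        have : (j : ℝ) ≤ N := by exact_mod_cast (by omega : j ≤ N)
        gcongr
      have e4 := norm_le_norm_add_norm_sub' (iteratedFDeriv ℝ i (ψ^[j]) z)
        (iteratedFDeriv ℝ i (φ j) z)
      linarith
    have hu : ∀ j, ContDiff ℝ ∞ fun z => φ (k - j) (ψ^[j] z) := fun j => (hφ _).comp (hψk j)
    have hu0 : (fun z => φ (k - 0) (ψ^[0] z)) = φ k := by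
      funext z
      simp
    -- Telescoping: the maps `φ (k - j) ∘ ψ^[j]` lead from `φ k` to `ψ^[k]`, and neighbours differ
    -- by one local error transported by the exact flow.
    have hchain : ∀ j ≤ k, ∀ i ≤ r, ∀ z,
        ‖iteratedFDeriv ℝ i (fun z => φ (k - j) (ψ^[j] z) - φ k z) z‖ ≤
        j * (iterateConst r M * ε) := by
      intro j
      induction j with
      | zero =>
        intro _ i _ z
        simp
      | succ j ihj =>
        intro hj i hi z
        have e1 := ihj (by omega) i hi z
        obtain ⟨l, hl⟩ : ∃ l, k - j = l + 1 := ⟨k - j - 1, by omega⟩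
        have hl' : k - (j + 1) = l := by omega
        have hsplit : (fun z => φ (k - (j + 1)) (ψ^[j + 1] z) - φ k z) =
            fun z => ((fun z => φ l (ψ z) - φ l (φ 1 z)) ∘ ψ^[j]) z +
              (φ (k - j) (ψ^[j] z) - φ k z) := by
          funext z
          rw [hl, hl', Function.iterate_succ_apply', hsucc]
          simp
        have hv : ContDiff ℝ ∞ fun z => φ l (ψ z) - φ l (φ 1 z) :=
          ((hφ l).comp hψ).sub ((hφ l).comp (hφ 1))
        have e2 : ‖iteratedFDeriv ℝ i ((fun z => φ l (ψ z) - φ l (φ 1 z)) ∘ ψ^[j]) z‖ ≤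
            iterateConst r M * ε := by
          refine (norm_iteratedFDeriv_comp_le hv (hψk j) (hle i) z
            (fun i' hi' => hstep l (by omega) i' (by omega) _) (D := M + 1)
            (fun i' h1 h2 => (hψM' j (by omega) i' h1 (by omega) z).trans
              (le_self_pow₀ (by linarith) (by omega)))).trans ?_
          have f1 : (i.factorial : ℝ) ≤ r.factorial := by exact_mod_cast Nat.factorial_le hi
          have f2 : (M + 1) ^ i ≤ (M + 1) ^ r := pow_le_pow_right₀ (by linarith) hi
          calc (i.factorial : ℝ) * (compConst M r * (M * ε)) * (M + 1) ^ i
              ≤ r.factorial * (compConst M r * (M * ε)) * (M + 1) ^ r := by gcongr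
            _ = iterateConst r M * ε := by unfold iterateConst; ring
        rw [hsplit, fun_iteratedFDeriv_add_apply ((hv.comp (hψk j)).of_le (hle i)).contDiffAt
          (((hu j).sub (hφ k)).of_le (hle i)).contDiffAt]
        refine (norm_add_le _ _).trans ((add_le_add e2 e1).trans (le_of_eq ?_))
        push_cast
        ring
    intro i hi z
    have := hchain k le_rfl i hi z
    simpa [h0] using this

end GlobalError

section GlobalError

variable {E : Type} [NormedAddCommGroup E] [NormedSpace ℝ E]

lemma norm_iteratedFDeriv_le_add_one {f : E → E} {i : ℕ} (hf : ContDiff ℝ i f) (hi : 1 ≤ i) {z : E}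
    {C : ℝ} (h : ‖iteratedFDeriv ℝ i (fun z => f z - z) z‖ ≤ C) :
    ‖iteratedFDeriv ℝ i f z‖ ≤ C + 1 := by
  have hid := norm_iteratedFDeriv_affine_le (ContinuousLinearMap.id ℝ E)
    ContinuousLinearMap.norm_id_le 0 hi z
  simp only [ContinuousLinearMap.coe_id', id_eq, add_zero] at hid
  rw [fun_iteratedFDeriv_sub_apply hf.contDiffAt contDiff_fun_id.contDiffAt] at h
  linarith [norm_le_norm_add_norm_sub' (iteratedFDeriv ℝ i f z)
    (iteratedFDeriv ℝ i (fun z : E => z) z)]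

variable [CompleteSpace E]

/-- A one-step map with local error `O(h ^ (q + 1))` has global error `O(h ^ q)`, in every `C^r`
norm. -/
theorem exists_global_error {X : E → E} {Φ Ψ : ℝ → E → E} {K : ℝ≥0} {e : E → E}
    (hΦ : IsGlobalFlow X Φ) (hL : LipschitzWith K X) (hX : ContDiff ℝ ∞ X)
    {S : Set E} (hS : IsCompact S) (hΦS : ∀ t, ∀ z ∉ S, Φ t z = z) (hΨS : ∀ t, ∀ z ∉ S, Ψ t z = z)
    (hΨ : ContDiff ℝ ∞ fun q : ℝ × E => Ψ q.1 q.2) {q : ℕ} (hq : 1 ≤ q)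
    (happ : IsApprox Φ (2 * (q + 1)) 1 Ψ e) (r : ℕ) (T : ℝ) :
    ∃ C h₀ : ℝ, 0 < C ∧ 0 < h₀ ∧ h₀ ≤ 1 ∧ ∀ h, 0 < h → h < h₀ → ∀ k : ℕ, k * h ≤ T →
      ∀ i ≤ r, ∀ z, ‖iteratedFDeriv ℝ i (fun z => Φ (k * h) z - (Ψ √h)^[k] z) z‖ ≤ C * h ^ q := by
  have hs := hΦ.contDiff hL hX
  obtain ⟨R, hR, hRΨ, -⟩ := happ
  -- Off `S` both maps are the identity, which determines `R` for `t ≠ 0`; the value at `t = 0`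
  -- follows by density.
  have hRS : ∀ t, ∀ z ∉ S, R (t, z) = 0 := by
    intro t z hz
    have hne : ∀ t : ℝ, t ≠ 0 → R (t, z) = 0 := by
      intro t ht
      have := hRΨ t z
      rw [hΨS t z hz, hΦS _ z hz] at this
      simpa [ht] using this
    have hcl : IsClosed {t : ℝ | R (t, z) = 0} :=
      isClosed_eq (hR.continuous.comp (by fun_prop)) continuous_const
    have hd : Dense {t : ℝ | R (t, z) = 0} :=
      (dense_compl_singleton (0 : ℝ)).mono fun t ht => hne t ht
    have : t ∈ closure {t : ℝ | R (t, z) = 0} := hd t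
    rwa [hcl.closure_eq] at this
  -- The maximum with `1` makes room for one step `h < 1` even if `h > T`, since the telescoping
  -- uses `φ 1` for every `k`.
  set T₁ := max T 1 with hT₁
  have hT₁0 : 0 < T₁ := lt_max_of_lt_right one_pos
  obtain ⟨C₁, hC₁, hb₁⟩ := exists_bound_iteratedFDeriv (Z := fun q : ℝ × E => Φ q.1 q.2 - q.2)
    (hs.sub contDiff_snd) hS (fun t z hz => by simp [hΦS t z hz]) 0 T₁ (r + 1)
  obtain ⟨C₂, hC₂, hb₂⟩ := exists_bound_iteratedFDeriv (Z := fun q : ℝ × E => Ψ q.1 q.2 - q.2)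
    (hΨ.sub contDiff_snd) hS (fun t z hz => by simp [hΨS t z hz]) 0 1 (r + 1)
  obtain ⟨C₃, hC₃, hb₃⟩ := exists_bound_iteratedFDeriv hR hS hRS 0 1 r
  have hΦt : ∀ t, ContDiff ℝ ∞ (Φ t) := fun t =>
    hs.comp (f := fun z : E => (t, z)) (by fun_prop)
  have hΨt : ∀ t, ContDiff ℝ ∞ (Ψ t) := fun t =>
    hΨ.comp (f := fun z : E => (t, z)) (by fun_prop)
  have hle : ∀ i : ℕ, ((i : ℕ) : WithTop ℕ∞) ≤ (∞ : WithTop ℕ∞) := fun i => by exact_mod_cast le_top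
  set M := 1 + C₁ + C₂ with hM
  have hM1 : 1 ≤ M := by linarith
  have hI0 : 0 ≤ iterateConst r M := by
    have : 0 ≤ compConst M r := by linarith [one_le_compConst hM1 r]
    unfold iterateConst
    positivity
  set C := T₁ * (iterateConst r M * C₃) + 1 with hC
  have hC1 : 1 ≤ C := by
    have : 0 ≤ T₁ * (iterateConst r M * C₃) := by positivity
    linarith
  have hC0 : 0 < C := by linarith
  -- For `h < C⁻¹` the accumulated error is at most `1`, as the telescoping requires.
  refine ⟨C, C⁻¹, hC0, inv_pos.2 hC0, inv_le_one_of_one_le₀ hC1, fun h h0 hh k hk i hi z => ?_⟩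
  have hh1 : h < 1 := hh.trans_le (inv_le_one_of_one_le₀ hC1)
  have hτ : √h ∈ Icc (0 : ℝ) 1 := ⟨Real.sqrt_nonneg h, Real.sqrt_le_one.2 hh1.le⟩
  have hτ2 : √h ^ 2 = h := Real.sq_sqrt h0.le
  have hτm : √h ^ (2 * (q + 1)) = h ^ (q + 1) := by rw [pow_mul, hτ2]
  have hhq : h ^ q ≤ h := by
    calc h ^ q ≤ h ^ 1 := pow_le_pow_of_le_one h0.le hh1.le hq
      _ = h := pow_one h
  have hNh : ((max k 1 : ℕ) : ℝ) * h ≤ T₁ := by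
    rcases le_total k 1 with h1 | h1
    · rw [max_eq_right h1]
      rw [Nat.cast_one, one_mul]
      exact hh1.le.trans (le_max_right T 1)
    · rw [max_eq_left h1]
      exact hk.trans (le_max_left T 1)
  have hε : 0 ≤ C₃ * h ^ (q + 1) := by positivity
  have key := norm_iteratedFDeriv_iterate_sub_le (r := r) hM1 hε (φ := fun k : ℕ => Φ (k * h))
    (ψ := Ψ √h) (fun k => hΦt _) (hΨt _) (by funext z; simp [hΦ.zero])
    (fun k z => by
      rw [← hΦ.add hL]
      push_cast
      ring_nf) (N := max k 1) (le_max_right k 1)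
    (fun j hj i h1 h2 z => by
      have hj0 : (j : ℝ) * h ∈ Icc 0 T₁ := by
        refine ⟨by positivity, le_trans ?_ hNh⟩
        have : (j : ℝ) ≤ (max k 1 : ℕ) := by exact_mod_cast hj
        gcongr
      have := norm_iteratedFDeriv_le_add_one (f := Φ (j * h)) ((hΦt _).of_le (hle i)) h1
        (hb₁ _ hj0 i h2 z)
      exact this.trans (by linarith))
    (fun i h1 h2 z => by
      have := norm_iteratedFDeriv_le_add_one ((hΨt _).of_le (hle i)) h1
        (hb₂ _ hτ i (by omega) z)
      exact this.trans (by linarith))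
    (fun i hi z => by
      have hfun : (fun z => Ψ √h z - Φ ((1 : ℕ) * h) z) =
          fun z => h ^ (q + 1) • R (√h, z) := by
        funext z
        rw [hRΨ, hτ2, hτm]
        simp
      have hRc : ContDiffAt ℝ i (fun z => R (√h, z)) z :=
        ((hR.comp (f := fun z : E => (√h, z)) (by fun_prop)).of_le (hle i)).contDiffAt
      rw [hfun, iteratedFDeriv_const_smul_apply' hRc, norm_smul,
        Real.norm_of_nonneg (by positivity), mul_comm]
      gcongr
      exact hb₃ _ hτ i hi z)
    (by
      calc ((max k 1 : ℕ) : ℝ) * (iterateConst r M * (C₃ * h ^ (q + 1)))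
          = ((max k 1 : ℕ) * h) * (iterateConst r M * C₃) * h ^ q := by ring
        _ ≤ T₁ * (iterateConst r M * C₃) * C⁻¹ := by
            gcongr
            exact hhq.trans hh.le
        _ ≤ C * C⁻¹ := by
            gcongr
            linarith
        _ = 1 := mul_inv_cancel₀ hC0.ne')
    k (le_max_left k 1) i hi z
  have hneg : (fun z => Φ (k * h) z - (Ψ √h)^[k] z) = -fun z => (Ψ √h)^[k] z - Φ (k * h) z := by
    funext z
    simp
  rw [hneg, iteratedFDeriv_neg_apply, norm_neg]
  refine key.trans ?_
  calc (k : ℝ) * (iterateConst r M * (C₃ * h ^ (q + 1)))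
      = (k * h) * (iterateConst r M * C₃) * h ^ q := by ring
    _ ≤ T₁ * (iterateConst r M * C₃) * h ^ q := by
        gcongr
        exact hk.trans (le_max_left T 1)
    _ ≤ C * h ^ q := by
        gcongr
        linarith

end GlobalError

/-! ### Contact Hamiltonian vector fields -/

namespace J1

variable {n : ℕ} {H K : J1 n → ℝ}

lemma map_eq_sum {F : Type*} [AddCommGroup F] [Module ℝ F] [TopologicalSpace F] (ℓ : J1 n →L[ℝ] F)
    (v : J1 n) : ℓ v = ∑ i, v.1 i • ℓ (Pi.single i 1, 0, 0) + v.2.1 • ℓ (0, 1, 0) +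
      ∑ i, v.2.2 i • ℓ (0, 0, Pi.single i 1) := by
  have hv : v = ∑ i, v.1 i • ((Pi.single i 1, 0, 0) : J1 n) + v.2.1 • ((0, 1, 0) : J1 n) +
      ∑ i, v.2.2 i • ((0, 0, Pi.single i 1) : J1 n) := by
    refine Prod.ext ?_ (Prod.ext ?_ ?_)
    · ext j
      simp [Prod.fst_sum, Pi.single_apply]
    · simp [Prod.fst_sum, Prod.snd_sum]
    · ext j
      simp [Prod.snd_sum, Pi.single_apply]
  conv_lhs => rw [hv]
  simp only [map_add, map_sum, map_smul]

lemma fderiv_eq_sum (z v : J1 n) : fderiv ℝ H z v = ∑ i, v.1 i * dx H i z + v.2.1 * du H z +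
    ∑ i, v.2.2 i * dp H i z := map_eq_sum (fderiv ℝ H z) v

/-- The second derivative. -/
noncomputable def hess (H : J1 n → ℝ) (z v w : J1 n) : ℝ := fderiv ℝ (fderiv ℝ H) z v w

lemma hess_symm (hH : ContDiff ℝ 2 H) (z v w : J1 n) : hess H z v w = hess H z w v :=
  (hH.contDiffAt.isSymmSndFDerivAt (by simp)).eq v w

lemma hess_eq_sum (z v w : J1 n) : hess H z v w =
    ∑ i, v.1 i * hess H z (Pi.single i 1, 0, 0) w + v.2.1 * hess H z (0, 1, 0) w +
    ∑ i, v.2.2 i * hess H z (0, 0, Pi.single i 1) w :=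
  map_eq_sum ((ContinuousLinearMap.apply ℝ ℝ w).comp (fderiv ℝ (fderiv ℝ H) z)) v

lemma hasFDerivAt_fderiv_apply (hH : ContDiff ℝ 2 H) (z w : J1 n) :
    HasFDerivAt (fun z => fderiv ℝ H z w)
      ((ContinuousLinearMap.apply ℝ ℝ w).comp (fderiv ℝ (fderiv ℝ H) z)) z := by
  have h1 : ContDiff ℝ 1 (fderiv ℝ H) := hH.fderiv_right (by norm_num)
  exact (ContinuousLinearMap.apply ℝ ℝ w).hasFDerivAt.comp z
    (h1.differentiable one_ne_zero z).hasFDerivAt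

lemma hasFDerivAt_momentum (i : Fin n) (z : J1 n) :
    HasFDerivAt (fun z : J1 n => z.2.2 i) ((ContinuousLinearMap.proj i).comp
      ((ContinuousLinearMap.snd ℝ ℝ (Fin n → ℝ)).comp
        (ContinuousLinearMap.snd ℝ (Fin n → ℝ) (ℝ × (Fin n → ℝ))))) z :=
  ((ContinuousLinearMap.proj (R := ℝ) (φ := fun _ : Fin n => ℝ) i).comp
    ((ContinuousLinearMap.snd ℝ ℝ (Fin n → ℝ)).comp
      (ContinuousLinearMap.snd ℝ (Fin n → ℝ) (ℝ × (Fin n → ℝ))))).hasFDerivAt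

lemma fderiv_contactField (hH : ContDiff ℝ 2 H) (z w : J1 n) :
    DifferentiableAt ℝ (contactField H) z ∧ fderiv ℝ (contactField H) z w =
      (fun i => hess H z w (0, 0, Pi.single i 1),
       (∑ i, (w.2.2 i * dp H i z + z.2.2 i * hess H z w (0, 0, Pi.single i 1))) - fderiv ℝ H z w,
       fun i => -(hess H z w (Pi.single i 1, 0, 0) +
         (w.2.2 i * du H z + z.2.2 i * hess H z w (0, 1, 0)))) := by
  have hp := fun i => hasFDerivAt_fderiv_apply hH z (0, 0, Pi.single i 1)
  have hx := fun i => hasFDerivAt_fderiv_apply hH z (Pi.single i 1, 0, 0)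
  have hu := hasFDerivAt_fderiv_apply hH z (0, 1, 0)
  have hd := (hH.differentiable two_ne_zero z).hasFDerivAt
  have hm := fun i => hasFDerivAt_momentum i z
  have h := (hasFDerivAt_pi.2 hp).prodMk (((HasFDerivAt.fun_sum (u := Finset.univ)
    fun i _ => (hm i).mul (hp i)).sub hd).prodMk
    (hasFDerivAt_pi.2 fun i => ((hx i).add ((hm i).mul hu)).neg))
  have h' : HasFDerivAt (contactField H) _ z := h
  refine ⟨h'.differentiableAt, ?_⟩
  rw [h'.fderiv]
  refine Prod.ext ?_ (Prod.ext ?_ ?_)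
  · rfl
  · simp only [ContinuousLinearMap.prod_apply, sub_apply, sum_apply]
    congr 1
    refine Finset.sum_congr rfl fun i _ => ?_
    simp [hess, dp]
    ring
  · funext i
    simp [hess, du]
    ring

lemma fderiv_jacobi (hH : ContDiff ℝ 2 H) (hK : ContDiff ℝ 2 K) (z w : J1 n) :
    fderiv ℝ (jacobi H K) z w =
      ∑ i, (hess H z w (0, 0, Pi.single i 1) * dx K i z +
          dp H i z * hess K z w (Pi.single i 1, 0, 0) -
        (hess H z w (Pi.single i 1, 0, 0) * dp K i z +
          dx H i z * hess K z w (0, 0, Pi.single i 1))) +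
      (hess H z w (0, 1, 0) * euler K z + du H z * (fderiv ℝ K z w -
        ∑ i, (w.2.2 i * dp K i z + z.2.2 i * hess K z w (0, 0, Pi.single i 1)))) -
      (hess K z w (0, 1, 0) * euler H z + du K z * (fderiv ℝ H z w -
        ∑ i, (w.2.2 i * dp H i z + z.2.2 i * hess H z w (0, 0, Pi.single i 1)))) := by
  have hp := fun i => hasFDerivAt_fderiv_apply hH z (0, 0, Pi.single i 1)
  have hx := fun i => hasFDerivAt_fderiv_apply hH z (Pi.single i 1, 0, 0)
  have hu := hasFDerivAt_fderiv_apply hH z (0, 1, 0)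
  have hd := (hH.differentiable two_ne_zero z).hasFDerivAt
  have kp := fun i => hasFDerivAt_fderiv_apply hK z (0, 0, Pi.single i 1)
  have kx := fun i => hasFDerivAt_fderiv_apply hK z (Pi.single i 1, 0, 0)
  have ku := hasFDerivAt_fderiv_apply hK z (0, 1, 0)
  have kd := (hK.differentiable two_ne_zero z).hasFDerivAt
  have hm := fun i => hasFDerivAt_momentum i z
  have h := ((HasFDerivAt.fun_sum (u := Finset.univ) fun i _ =>
    ((hp i).mul (kx i)).sub ((hx i).mul (kp i))).add
    (hu.mul (kd.sub (HasFDerivAt.fun_sum (u := Finset.univ) fun i _ => (hm i).mul (kp i))))).sub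
    (ku.mul (hd.sub (HasFDerivAt.fun_sum (u := Finset.univ) fun i _ => (hm i).mul (hp i))))
  have h' : HasFDerivAt (jacobi H K) _ z := h
  rw [h'.fderiv]
  simp only [add_apply, sub_apply, sum_apply,
    smul_apply, smul_eq_mul, ContinuousLinearMap.comp_apply,
    ContinuousLinearMap.apply_apply, ContinuousLinearMap.proj_apply,
    ContinuousLinearMap.coe_snd', hess, euler, dp, dx, du]
  congr 1
  · congr 1
    · refine Finset.sum_congr rfl fun i _ => ?_
      ring
    · rw [add_comm]
      congr 1
      · exact mul_comm _ _
      · congr 2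
        refine Finset.sum_congr rfl fun i _ => ?_
        ring
  · rw [add_comm]
    congr 1
    · exact mul_comm _ _
    · congr 2
      refine Finset.sum_congr rfl fun i _ => ?_
      ring

/-- The derivative of the contact-Jacobi bracket in terms of the contact vector fields. -/
lemma fderiv_jacobi_eq (hH : ContDiff ℝ 2 H) (hK : ContDiff ℝ 2 K) (z w : J1 n) :
    fderiv ℝ (jacobi H K) z w =
      hess K z (contactField H z) w - hess H z (contactField K z) w +
      du H z * (fderiv ℝ K z w - ∑ i, w.2.2 i * dp K i z) -
      du K z * (fderiv ℝ H z w - ∑ i, w.2.2 i * dp H i z) := by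
  -- By symmetry of the Hessians the direction `w` becomes the second argument throughout; the
  -- second-order terms are then the Hessians contracted with the contact fields.
  rw [fderiv_jacobi hH hK, hess_eq_sum z (contactField H z), hess_eq_sum z (contactField K z)]
  simp only [contactField, euler, hess_symm hH z w, hess_symm hK z w]
  simp only [mul_sub, Finset.mul_sum, Finset.sum_add_distrib, Finset.sum_sub_distrib, add_mul,
    neg_mul, Finset.sum_neg_distrib, sub_mul, mul_add, Finset.sum_mul]
  have e : ∀ i, z.2.2 i * du H z * hess K z (0, 0, Pi.single i 1) w =
      du H z * (z.2.2 i * hess K z (0, 0, Pi.single i 1) w) := fun i => by ring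
  have e' : ∀ i, z.2.2 i * du K z * hess H z (0, 0, Pi.single i 1) w =
      du K z * (z.2.2 i * hess H z (0, 0, Pi.single i 1) w) := fun i => by ring
  have e₁ : ∀ i, z.2.2 i * dp H i z * hess K z (0, 1, 0) w =
      hess K z (0, 1, 0) w * (z.2.2 i * dp H i z) := fun i => by ring
  have e₂ : ∀ i, z.2.2 i * dp K i z * hess H z (0, 1, 0) w =
      hess H z (0, 1, 0) w * (z.2.2 i * dp K i z) := fun i => by ring
  have e₃ : ∀ i, hess H z (0, 0, Pi.single i 1) w * dx K i z =
      dx K i z * hess H z (0, 0, Pi.single i 1) w := fun i => by ring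
  have e₄ : ∀ i, hess H z (Pi.single i 1, 0, 0) w * dp K i z =
      dp K i z * hess H z (Pi.single i 1, 0, 0) w := fun i => by ring
  simp only [e, e', e₁, e₂, e₃, e₄]
  ring

/-- The contact vector field of a contact-Jacobi bracket is a Lie bracket. -/
theorem contactField_jacobi (hH : ContDiff ℝ 2 H) (hK : ContDiff ℝ 2 K) :
    contactField (jacobi H K) = VectorField.lieBracket ℝ (contactField H) (contactField K) := by
  funext z
  rw [VectorField.lieBracket_eq]
  simp only [(fderiv_contactField hH z _).2, (fderiv_contactField hK z _).2]
  -- The first-order terms of `fderiv_jacobi_eq` cancel in the directions of `p` and `u`; in the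
  -- direction of `x` they leave `H_u K_x - K_u H_x`.
  have hp : ∀ i, dp (jacobi H K) i z = hess K z (contactField H z) (0, 0, Pi.single i 1) -
      hess H z (contactField K z) (0, 0, Pi.single i 1) := by
    intro i
    rw [dp, fderiv_jacobi_eq hH hK]
    have h1 : ∀ L : J1 n → ℝ, ∑ j, (Pi.single i (1 : ℝ) : Fin n → ℝ) j * dp L j z = dp L i z :=
      fun L => by simp [Pi.single_apply]
    rw [h1, h1]
    simp [dp]
  have hx : ∀ i, dx (jacobi H K) i z = hess K z (contactField H z) (Pi.single i 1, 0, 0) -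
      hess H z (contactField K z) (Pi.single i 1, 0, 0) + du H z * dx K i z -
      du K z * dx H i z := by
    intro i
    rw [dx, fderiv_jacobi_eq hH hK]
    simp [dx]
  have hu : du (jacobi H K) z = hess K z (contactField H z) (0, 1, 0) -
      hess H z (contactField K z) (0, 1, 0) := by
    rw [du, fderiv_jacobi_eq hH hK]
    simp [du, mul_comm]
  refine Prod.ext ?_ (Prod.ext ?_ ?_)
  · funext i
    exact hp i
  · rw [fderiv_eq_sum z (contactField H z), fderiv_eq_sum z (contactField K z)]
    simp only [contactField, hp, Prod.snd_sub, Prod.fst_sub]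
    simp only [jacobi, poisson, euler, mul_sub, neg_mul, add_mul,
      Finset.sum_add_distrib, Finset.sum_sub_distrib, Finset.sum_neg_distrib]
    have e₃ : ∀ i, dp K i z * dx H i z = dx H i z * dp K i z := fun i => mul_comm _ _
    simp only [e₃]
    ring
  · funext i
    simp only [contactField, hx, hu, Prod.snd_sub, Pi.sub_apply]
    ring

end J1

set_option maxSynthPendingDepth 3

/-! ### Regularity, linearity and conformality of contact flows -/

namespace J1

variable {n : ℕ} {H K : J1 n → ℝ}

/-- The part of the contact vector field that depends on the differential only. -/
noncomputable def contactLin (n : ℕ) : (J1 n →L[ℝ] ℝ) →L[ℝ] J1 n :=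
  ∑ i, ((ContinuousLinearMap.apply ℝ ℝ ((0, 0, Pi.single i 1) : J1 n)).smulRight
      ((Pi.single i 1, 0, 0) : J1 n) -
    (ContinuousLinearMap.apply ℝ ℝ ((Pi.single i 1, 0, 0) : J1 n)).smulRight
      ((0, 0, Pi.single i 1) : J1 n))

/-- The part of the contact vector field that is bilinear in the point and the differential. -/
noncomputable def contactBilin (n : ℕ) : J1 n →L[ℝ] (J1 n →L[ℝ] ℝ) →L[ℝ] J1 n :=
  ∑ i, ((ContinuousLinearMap.proj (R := ℝ) (φ := fun _ : Fin n => ℝ) i).comp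
      ((ContinuousLinearMap.snd ℝ ℝ (Fin n → ℝ)).comp
        (ContinuousLinearMap.snd ℝ (Fin n → ℝ) (ℝ × (Fin n → ℝ))))).smulRight
    ((ContinuousLinearMap.apply ℝ ℝ ((0, 0, Pi.single i 1) : J1 n)).smulRight
      ((0, 1, 0) : J1 n) -
    (ContinuousLinearMap.apply ℝ ℝ ((0, 1, 0) : J1 n)).smulRight
      ((0, 0, Pi.single i 1) : J1 n))

/-- The field is a fixed linear and bilinear expression in `z`, `DH(z)` and `H(z)`; regularity,
additivity and estimates of contact fields all reduce to those of `H` and `DH`. -/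
lemma contactField_eq (H : J1 n → ℝ) (z : J1 n) : contactField H z =
    contactLin n (fderiv ℝ H z) + contactBilin n z (fderiv ℝ H z) - H z • (0, 1, 0) := by
  refine Prod.ext ?_ (Prod.ext ?_ ?_)
  · funext j
    simp [contactField, contactLin, contactBilin, Prod.fst_sum, dp, Pi.single_apply]
  · simp [contactField, contactLin, contactBilin, Prod.fst_sum, Prod.snd_sum, dp]
  · funext j
    simp [contactField, contactLin, contactBilin, Prod.snd_sum, dx, du, Pi.single_apply]
    ring

lemma contDiffOn_contactField {V : Set (J1 n)} (hV : IsOpen V) {r : WithTop ℕ∞}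
    (hH : ContDiffOn ℝ (r + 1) H V) : ContDiffOn ℝ r (contactField H) V := by
  have h1 : ContDiffOn ℝ r (fderiv ℝ H) V := hH.fderiv_of_isOpen hV le_rfl
  have h0 : ContDiffOn ℝ r H V := hH.of_le le_self_add
  have : contactField H = fun z => contactLin n (fderiv ℝ H z) +
      contactBilin n z (fderiv ℝ H z) - H z • (0, 1, 0) := funext (contactField_eq H)
  rw [this]
  fun_prop

lemma contDiff_contactField {r : WithTop ℕ∞} (hH : ContDiff ℝ (r + 1) H) :
    ContDiff ℝ r (contactField H) :=
  contDiffOn_univ.1 (contDiffOn_contactField isOpen_univ hH.contDiffOn)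

lemma contDiff_infty_contactField (hH : ContDiff ℝ ∞ H) : ContDiff ℝ ∞ (contactField H) :=
  contDiff_contactField hH

lemma contactField_congr {z : J1 n} (h : H =ᶠ[𝓝 z] K) : contactField H z = contactField K z := by
  rw [contactField_eq, contactField_eq, h.fderiv_eq, h.eq_of_nhds]

lemma contactField_neg (H : J1 n → ℝ) : contactField (-H) = -contactField H := by
  funext z
  simp only [contactField_eq, Pi.neg_apply, fderiv_neg, map_neg, neg_smul]
  abel

lemma contactField_add {z : J1 n} (hH : DifferentiableAt ℝ H z) (hK : DifferentiableAt ℝ K z) :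
    contactField (fun z => H z + K z) z = contactField H z + contactField K z := by
  simp only [contactField_eq, fderiv_fun_add hH hK, map_add, add_smul]
  abel

lemma contactField_sum {ι : Type*} (s : Finset ι) {f : ι → J1 n → ℝ} {z : J1 n}
    (hf : ∀ i ∈ s, DifferentiableAt ℝ (f i) z) :
    contactField (fun z => ∑ i ∈ s, f i z) z = ∑ i ∈ s, contactField (f i) z := by
  simp only [contactField_eq, fderiv_fun_sum hf, map_sum, Finset.sum_smul,
    Finset.sum_sub_distrib, Finset.sum_add_distrib]

lemma contactField_eq_zero {z : J1 n} (hz : z ∉ tsupport H) : contactField H z = 0 := by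
  have h : H =ᶠ[𝓝 z] 0 := notMem_tsupport_iff_eventuallyEq.1 hz
  rw [contactField_congr h]
  refine Prod.ext ?_ (Prod.ext ?_ ?_)
  · funext i
    simp [contactField, dp]
  · simp [contactField, dp]
  · funext i
    simp [contactField, dx, du]

lemma hasCompactSupport_contactField (hH : HasCompactSupport H) :
    HasCompactSupport (contactField H) :=
  HasCompactSupport.intro hH fun _ hz => contactField_eq_zero hz

/-- Along the flow of `H`, the contact form is multiplied by a positive function. -/
lemma exists_conformal_of_nonneg (hH : ContDiff ℝ ∞ H) {Φ : ℝ → J1 n → J1 n} {L : ℝ≥0}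
    (hΦ : IsGlobalFlow (contactField H) Φ) (hL : LipschitzWith L (contactField H)) {t : ℝ}
    (ht : 0 ≤ t) (z : J1 n) :
    ∃ lam : ℝ, ∀ v, contactForm (Φ t z) (fderiv ℝ (Φ t) z v) = Real.exp lam * contactForm z v := by
  have hX := contDiff_infty_contactField hH
  have hH2 : ContDiff ℝ 2 H := hH.of_le (by norm_cast)
  have hΦ0 : Φ 0 = id := funext hΦ.zero
  obtain ⟨-, h2, -⟩ := exists_hasFDerivAt_of_integralCurves (T := t) ht
    (hX.of_le (by exact_mod_cast le_top))
    (fun z s _ => (hΦ.deriv z s).hasDerivWithinAt) (hΦ.continuous hL).continuousOn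
    (by rw [hΦ0]; exact contDiff_id)
  have hduc : Continuous (du H) :=
    (hH2.continuous_fderiv two_ne_zero).clm_apply continuous_const
  have hcont : Continuous fun s => du H (Φ s z) := hduc.comp (hΦ.continuous_curve z)
  -- The Lie derivative of the contact form is `-H_u α`, so `θ' = -H_u θ` along a trajectory, and
  -- `g` is chosen to make `θ exp g` constant.
  set g : ℝ → ℝ := fun s => ∫ σ in (0 : ℝ)..s, du H (Φ σ z) with hg
  have hgd : ∀ s, HasDerivAt g (du H (Φ s z)) s := fun s =>
    intervalIntegral.integral_hasDerivAt_right (hcont.intervalIntegrable _ _)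
      (hcont.stronglyMeasurableAtFilter _ _) hcont.continuousAt
  refine ⟨-g t, fun v => ?_⟩
  set θ : ℝ → ℝ := fun s => contactForm (Φ s z) (fderiv ℝ (Φ s) z v) with hθ
  have hθd : ∀ s ∈ Icc 0 t, HasDerivWithinAt θ (-(du H (Φ s z) * θ s)) (Icc 0 t) s := by
    intro s hs
    have hw := (h2 z s hs).clm_apply (hasDerivWithinAt_const s (Icc 0 t) v)
    simp only [map_zero, add_zero, ContinuousLinearMap.comp_apply] at hw
    set y := Φ s z with hy
    set w := fderiv ℝ (Φ s) z v with hwdef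
    have hz := (hΦ.deriv z s).hasDerivWithinAt (s := Icc 0 t)
    have hz2 : ∀ i, HasDerivWithinAt (fun s => (Φ s z).2.2 i) ((contactField H y).2.2 i)
        (Icc 0 t) s := fun i =>
      ((ContinuousLinearMap.proj (R := ℝ) (φ := fun _ : Fin n => ℝ) i).comp
        ((ContinuousLinearMap.snd ℝ ℝ (Fin n → ℝ)).comp
          (ContinuousLinearMap.snd ℝ (Fin n → ℝ) (ℝ × (Fin n → ℝ))))).hasFDerivAt
        |>.comp_hasDerivWithinAt s hz
    have hw1 : ∀ i, HasDerivWithinAt (fun s => (fderiv ℝ (Φ s) z v).1 i)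
        ((fderiv ℝ (contactField H) y w).1 i) (Icc 0 t) s := fun i =>
      ((ContinuousLinearMap.proj (R := ℝ) (φ := fun _ : Fin n => ℝ) i).comp
        (ContinuousLinearMap.fst ℝ (Fin n → ℝ) (ℝ × (Fin n → ℝ)))).hasFDerivAt
        |>.comp_hasDerivWithinAt s hw
    have hw2 : HasDerivWithinAt (fun s => (fderiv ℝ (Φ s) z v).2.1)
        ((fderiv ℝ (contactField H) y w).2.1) (Icc 0 t) s :=
      ((ContinuousLinearMap.fst ℝ ℝ (Fin n → ℝ)).comp
        (ContinuousLinearMap.snd ℝ (Fin n → ℝ) (ℝ × (Fin n → ℝ)))).hasFDerivAt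
        |>.comp_hasDerivWithinAt s hw
    have hd := hw2.sub (HasDerivWithinAt.fun_sum (u := Finset.univ)
      fun i _ => (hz2 i).mul (hw1 i))
    have hd' : HasDerivWithinAt θ _ (Icc 0 t) s := hd
    convert hd' using 1
    simp only [(fderiv_contactField hH2 y w).2, fderiv_eq_sum y w]
    simp only [hθ, contactField, contactForm, ← hy, ← hwdef]
    simp only [mul_sub, Finset.mul_sum, Finset.sum_add_distrib, neg_mul,
      add_mul, Finset.sum_neg_distrib]
    have e₁ : ∀ i, y.2.2 i * du H y * w.1 i = du H y * (y.2.2 i * w.1 i) := fun i => by ring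
    have e₂ : ∀ i, dx H i y * w.1 i = w.1 i * dx H i y := fun i => by ring
    simp only [e₁, e₂]
    ring
  have hθc : ContinuousOn θ (Icc 0 t) := fun s hs => (hθd s hs).continuousWithinAt
  have hconst : ∀ s ∈ Icc 0 t, θ s * Real.exp (g s) = θ 0 * Real.exp (g 0) := by
    refine constant_of_has_deriv_right_zero (f := fun s => θ s * Real.exp (g s)) ?_ ?_
    · exact hθc.mul (Real.continuous_exp.comp
        (continuous_iff_continuousAt.2 fun s => (hgd s).continuousAt)).continuousOn
    · intro s hs
      have h1 := (hθd s (Ico_subset_Icc_self hs)).Ici_of_Icc hs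
      have h3 := h1.mul ((hgd s).exp.hasDerivWithinAt (s := Ici s))
      refine h3.congr_deriv ?_
      ring
  have h3 := hconst t ⟨ht, le_rfl⟩
  have h4 : g 0 = 0 := by simp [hg]
  have h5 : θ 0 = contactForm z v := by
    simp [hθ, hΦ0]
  rw [h4, h5, Real.exp_zero, mul_one] at h3
  change θ t = _
  rw [← h3, Real.exp_neg]
  field_simp

/-- A contactomorphism of the jet space. -/
structure IsContactDiffeo (ψ : J1 n → J1 n) : Prop where
  smooth : ContDiff ℝ ∞ ψ
  exists_inverse : ∃ φ : J1 n → J1 n, ContDiff ℝ ∞ φ ∧ (∀ z, φ (ψ z) = z) ∧ ∀ z, ψ (φ z) = z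
  conformal : ∀ z, ∃ lam : ℝ, ∀ v,
    contactForm (ψ z) (fderiv ℝ ψ z v) = Real.exp lam * contactForm z v

lemma IsContactDiffeo.id : IsContactDiffeo fun z : J1 n => z where
  smooth := contDiff_id
  exists_inverse := ⟨fun z => z, contDiff_id, fun _ => rfl, fun _ => rfl⟩
  conformal z := ⟨0, fun v => by simp⟩

lemma IsContactDiffeo.comp {ψ φ : J1 n → J1 n} (hψ : IsContactDiffeo ψ) (hφ : IsContactDiffeo φ) :
    IsContactDiffeo fun z => ψ (φ z) where
  smooth := hψ.smooth.comp hφ.smooth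
  exists_inverse := by
    obtain ⟨ψ', h1, h2, h3⟩ := hψ.exists_inverse
    obtain ⟨φ', h4, h5, h6⟩ := hφ.exists_inverse
    exact ⟨fun z => φ' (ψ' z), h4.comp h1, fun z => by simp only [h2, h5], fun z => by simp only [h6, h3]⟩
  conformal z := by
    obtain ⟨l₁, h1⟩ := hφ.conformal z
    obtain ⟨l₂, h2⟩ := hψ.conformal (φ z)
    refine ⟨l₂ + l₁, fun v => ?_⟩
    have : fderiv ℝ (fun z => ψ (φ z)) z = (fderiv ℝ ψ (φ z)).comp (fderiv ℝ φ z) :=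
      fderiv_comp z (hψ.smooth.differentiable (by simp) _) (hφ.smooth.differentiable (by simp) _)
    rw [this, ContinuousLinearMap.comp_apply, h2, h1, Real.exp_add, mul_assoc]

lemma IsContactDiffeo.isContactMapOn {ψ : J1 n → J1 n} (hψ : IsContactDiffeo ψ) (W : Set (J1 n)) :
    IsContactMapOn ψ W where
  smooth := hψ.smooth.contDiffOn
  injOn := by
    obtain ⟨φ, -, h, -⟩ := hψ.exists_inverse
    exact fun x _ y _ hxy => by rw [← h x, hxy, h]
  bijective z _ := by
    obtain ⟨φ, h1, h2, h3⟩ := hψ.exists_inverse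
    have hd := hψ.smooth.differentiable (by simp) z
    have hd' := h1.differentiable (by simp) (ψ z)
    have hc : (fderiv ℝ φ (ψ z)).comp (fderiv ℝ ψ z) = ContinuousLinearMap.id ℝ (J1 n) := by
      rw [← fderiv_comp z hd' hd, show φ ∘ ψ = _root_.id from funext h2, fderiv_id]
    have hinj : Function.Injective (fderiv ℝ ψ z) := by
      refine Function.LeftInverse.injective (g := fderiv ℝ φ (ψ z)) fun v => ?_
      exact congrArg (fun ℓ : J1 n →L[ℝ] J1 n => ℓ v) hc
    exact ⟨hinj, LinearMap.surjective_of_injective (f := (fderiv ℝ ψ z : J1 n →ₗ[ℝ] J1 n)) hinj⟩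
  conformal := by
    choose lam h using hψ.conformal
    exact ⟨lam, fun z _ => h z⟩

lemma isContactDiffeo_flow (hH : ContDiff ℝ ∞ H) {Φ : ℝ → J1 n → J1 n} {L : ℝ≥0}
    (hΦ : IsGlobalFlow (contactField H) Φ) (hL : LipschitzWith L (contactField H)) (t : ℝ) :
    IsContactDiffeo (Φ t) := by
  have hs := hΦ.contDiff hL (contDiff_infty_contactField hH)
  have hst : ∀ t, ContDiff ℝ ∞ (Φ t) := fun t =>
    hs.comp (f := fun z : J1 n => (t, z)) (by fun_prop)
  refine ⟨hst t, ⟨Φ (-t), hst _, hΦ.neg_apply hL t, hΦ.apply_neg hL t⟩, fun z => ?_⟩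
  rcases le_total 0 t with ht | ht
  · exact exists_conformal_of_nonneg hH hΦ hL ht z
  · have := exists_conformal_of_nonneg (H := -H) hH.neg (Φ := fun t => Φ (-t)) (L := L)
      (by rw [contactField_neg]; exact hΦ.neg) (by rw [contactField_neg]; exact hL.neg)
      (neg_nonneg.2 ht) z
    simpa only [neg_neg] using this

end J1

/-! ### The composition scheme of a depth-one representation -/

namespace J1

variable {n : ℕ}

lemma contDiff_of_mem_prolongedHam {H : J1 n → ℝ} (hH : H ∈ prolongedHam n) : ContDiff ℝ ∞ H := by
  obtain ⟨f, g, hf, hg, h⟩ := hH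
  have : H = fun z => f (z.1, z.2.1) + ∑ i, g i (z.1, z.2.1) * z.2.2 i := by
    funext z
    exact h z.1 z.2.1 z.2.2
  rw [this]
  have h1 : ∀ i, ContDiff ℝ ∞ fun z : J1 n => g i (z.1, z.2.1) := fun i =>
    (hg i).comp (f := fun z : J1 n => (z.1, z.2.1)) (by fun_prop)
  have h2 : ContDiff ℝ ∞ fun z : J1 n => f (z.1, z.2.1) :=
    hf.comp (f := fun z : J1 n => (z.1, z.2.1)) (by fun_prop)
  fun_prop

lemma contDiff_jacobi {H K : J1 n → ℝ} (hH : ContDiff ℝ ∞ H) (hK : ContDiff ℝ ∞ K) :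
    ContDiff ℝ ∞ (jacobi H K) := by
  have h1 : ContDiff ℝ ∞ (fderiv ℝ H) := hH.fderiv_right (by simp)
  have h2 : ContDiff ℝ ∞ (fderiv ℝ K) := hK.fderiv_right (by simp)
  unfold jacobi poisson euler dp dx du
  fun_prop

/-- The smooth Hamiltonians. -/
abbrev SmoothHam (n : ℕ) : Type := {g : J1 n → ℝ // ContDiff ℝ ∞ g}

/-- The factor with the time `c τ ^ k`, where `τ = √h`. -/
noncomputable def toFactor (f : SmoothHam n × ℝ × ℕ) : Factor n := ⟨f.1.1, f.2.1, (f.2.2 : ℝ) / 2⟩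

/-- The commutator of two flows. -/
def commWord (a b : SmoothHam n) : List (SmoothHam n × ℝ × ℕ) :=
  [(a, 1, 1), (b, 1, 1), (a, -1, 1), (b, -1, 1)]

namespace DepthOne

variable (R : DepthOne n)

/-- The strict generator `sᵢ`. -/
def strictGen (i : Fin R.m) : SmoothHam n := ⟨R.s i, (R.s_mem i).1⟩

/-- The prolonged generator `dᵢ`. -/
def prolongedGen (i : Fin R.m) : SmoothHam n := ⟨R.d i, contDiff_of_mem_prolongedHam (R.d_mem i)⟩

/-- The composition of the flows of `s₀` and `d₀` and of the commutators of the flows of `sᵢ` and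
`dᵢ`. -/
def baseWord : List (SmoothHam n × ℝ × ℕ) :=
  (⟨R.s₀, R.s₀_mem.1⟩, 1, 2) :: (⟨R.d₀, contDiff_of_mem_prolongedHam R.d₀_mem⟩, 1, 2) ::
    (List.finRange R.m).flatMap fun i => commWord (R.strictGen i) (R.prolongedGen i)

/-- The composition scheme of order `p + 1`. -/
noncomputable def scheme (p : ℕ) : List (Factor n) :=
  -- From order `3` in `τ`, `2p + 1` raisings lead to order `2p + 4`: local error `h^(p+2)`, global
  -- error `h^(p+1)`. The order beyond `p` makes the error tend to `0` also for `p = 0`.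
  (orderWord R.baseWord (2 * p + 1)).map toFactor

lemma mem_baseWord {f : SmoothHam n × ℝ × ℕ} (hf : f ∈ R.baseWord) :
    f.1.1 ∈ R.generators ∧ 0 < f.2.2 := by
  simp only [baseWord, List.mem_cons, List.mem_flatMap, commWord, List.not_mem_nil, or_false,
    List.mem_finRange, true_and] at hf
  rcases hf with rfl | rfl | ⟨i, rfl | rfl | rfl | rfl⟩ <;>
    simp [generators, strictGen, prolongedGen]

lemma exists_mem_baseWord {p : ℕ} {f : SmoothHam n × ℝ × ℕ}
    (hf : f ∈ orderWord R.baseWord p) : f.1.1 ∈ R.generators ∧ 0 < f.2.2 := by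
  obtain ⟨f', hf', h1, h2⟩ := exists_mem_of_mem_orderWord _ _ f hf
  rw [h1, h2]
  exact R.mem_baseWord hf'

lemma mem_scheme {p : ℕ} {f : Factor n} (hf : f ∈ R.scheme p) :
    f.gen ∈ R.generators ∧ 0 < f.expo := by
  obtain ⟨f', hf', rfl⟩ := List.mem_map.1 hf
  obtain ⟨h1, h2⟩ := R.exists_mem_baseWord hf'
  refine ⟨h1, ?_⟩
  have : (0 : ℝ) < f'.2.2 := by exact_mod_cast h2
  simp only [toFactor]
  positivity

end DepthOne

section Word

variable {A : SmoothHam n → J1 n → J1 n} {fl : SmoothHam n → ℝ → J1 n → J1 n}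
  {L : SmoothHam n → ℝ≥0}

lemma isQuadratic_commWord (hfl : ∀ g, IsGlobalFlow (A g) (fl g))
    (hL : ∀ g, LipschitzWith (L g) (A g)) (hA : ∀ g, ContDiff ℝ ∞ (A g)) (a b : SmoothHam n) :
    IsQuadratic (evalWord fl (commWord a b)) (VectorField.lieBracket ℝ (A a) (A b)) := by
  have := isQuadratic_commutator (hfl a) (hL a) (hA a) (hfl b) (hL b) (hA b)
  simpa [evalWord, commWord] using this

lemma contDiff_lieBracket {X Y : J1 n → J1 n} (hX : ContDiff ℝ ∞ X) (hY : ContDiff ℝ ∞ Y) :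
    ContDiff ℝ ∞ (VectorField.lieBracket ℝ X Y) := by
  have h1 : ContDiff ℝ ∞ (fderiv ℝ X) := hX.fderiv_right (by simp)
  have h2 : ContDiff ℝ ∞ (fderiv ℝ Y) := hY.fderiv_right (by simp)
  rw [VectorField.lieBracket_eq]
  fun_prop

lemma isQuadratic_flatMap_commWord (hfl : ∀ g, IsGlobalFlow (A g) (fl g))
    (hL : ∀ g, LipschitzWith (L g) (A g)) (hA : ∀ g, ContDiff ℝ ∞ (A g)) {ι : Type}
    (a b : ι → SmoothHam n) (l : List ι) :
    IsQuadratic (evalWord fl (l.flatMap fun i => commWord (a i) (b i)))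
      (fun z => (l.map fun i => VectorField.lieBracket ℝ (A (a i)) (A (b i)) z).sum) ∧
    ContDiff ℝ ∞ fun z => (l.map fun i => VectorField.lieBracket ℝ (A (a i)) (A (b i)) z).sum := by
  induction l with
  | nil => exact ⟨⟨fun _ => 0, contDiff_const, fun τ z => by simp [evalWord]⟩, contDiff_const⟩
  | cons i l ih =>
    have hc := contDiff_lieBracket (hA (a i)) (hA (b i))
    have := ih.1.comp (isQuadratic_commWord hfl hL hA (a i) (b i)) ih.2 hc
    simp only [List.flatMap_cons, List.map_cons, List.sum_cons]
    refine ⟨?_, hc.add ih.2⟩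
    have he : evalWord fl (commWord (a i) (b i) ++ l.flatMap fun i => commWord (a i) (b i)) =
        fun τ z => evalWord fl (l.flatMap fun i => commWord (a i) (b i)) τ
          (evalWord fl (commWord (a i) (b i)) τ z) := by
      funext τ z
      exact evalWord_append _ _ _ _ _
    rw [he]
    exact this

/-- The vector field that is approximated by the composition `R.baseWord`. -/
noncomputable def DepthOne.baseField (R : DepthOne n) (A : SmoothHam n → J1 n → J1 n) (z : J1 n) :
    J1 n :=
  A ⟨R.s₀, R.s₀_mem.1⟩ z + A ⟨R.d₀, contDiff_of_mem_prolongedHam R.d₀_mem⟩ z +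
    ∑ i, VectorField.lieBracket ℝ (A (R.strictGen i)) (A (R.prolongedGen i)) z

lemma DepthOne.contDiff_baseField (R : DepthOne n) (hA : ∀ g, ContDiff ℝ ∞ (A g)) :
    ContDiff ℝ ∞ (R.baseField A) :=
  ((hA _).add (hA _)).add (ContDiff.sum fun _ _ => contDiff_lieBracket (hA _) (hA _))

lemma DepthOne.isQuadratic_baseWord (R : DepthOne n) (hfl : ∀ g, IsGlobalFlow (A g) (fl g))
    (hL : ∀ g, LipschitzWith (L g) (A g)) (hA : ∀ g, ContDiff ℝ ∞ (A g)) :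
    IsQuadratic (evalWord fl R.baseWord) (R.baseField A) := by
  obtain ⟨h1, h2⟩ := isQuadratic_flatMap_commWord hfl hL hA R.strictGen R.prolongedGen
    (List.finRange R.m)
  have h3 := IsQuadratic.of_flow (hfl ⟨R.s₀, R.s₀_mem.1⟩) (hL _) (hA _)
  have h4 := IsQuadratic.of_flow (hfl ⟨R.d₀, contDiff_of_mem_prolongedHam R.d₀_mem⟩) (hL _) (hA _)
  have h5 := h1.comp (h4.comp h3 (hA _) (hA _)) h2 ((hA _).add (hA _))
  have hb : R.baseField A = _ := funext fun z => by
    rw [baseField, ← List.sum_ofFn, List.ofFn_eq_map]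
  rw [hb]
  convert h5 using 1
  funext τ z
  simp only [baseWord, evalWord, one_mul]

lemma evalWord_of_fixed {S : Set (J1 n)} (hS : ∀ g t, ∀ z ∉ S, fl g t z = z)
    (w : List (SmoothHam n × ℝ × ℕ)) (τ : ℝ) : ∀ z ∉ S, evalWord fl w τ z = z := by
  induction w with
  | nil => exact fun z _ => rfl
  | cons f w ih =>
    intro z hz
    rw [evalWord, hS _ _ z hz, ih z hz]

lemma isContactDiffeo_evalWord {χ : J1 n → ℝ} (hχ : ContDiff ℝ ∞ χ)
    (hfl : ∀ g : SmoothHam n, IsGlobalFlow (contactField fun z => χ z * g.1 z) (fl g))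
    (hL : ∀ g : SmoothHam n, LipschitzWith (L g) (contactField fun z => χ z * g.1 z))
    (w : List (SmoothHam n × ℝ × ℕ)) (τ : ℝ) : IsContactDiffeo (evalWord fl w τ) := by
  induction w with
  | nil => exact IsContactDiffeo.id
  | cons f w ih => exact ih.comp (isContactDiffeo_flow (hχ.mul f.1.2) (hfl f.1) (hL f.1) _)

/-- Where `χ = 1`, the cut-off flows are exact flows of the generators. A factor moves points by at
most `M |t|`, which tends to `0` with `h` because its exponent is positive; so it stays in a
slightly larger ball, from which the induction continues. -/
lemma eventually_realizes {χ : J1 n → ℝ} {ρ : ℝ}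
    (hχ : ∀ z, ‖z‖ < ρ → χ =ᶠ[𝓝 z] 1)
    (hfl : ∀ g : SmoothHam n, IsGlobalFlow (contactField fun z => χ z * g.1 z) (fl g))
    (hb : ∀ g : SmoothHam n, ∃ M, ∀ z, ‖contactField (fun z => χ z * g.1 z) z‖ ≤ M)
    (w : List (SmoothHam n × ℝ × ℕ)) (hw : ∀ f ∈ w, 0 < f.2.2) {a : ℝ} (ha : a < ρ) :
    ∀ᶠ h in 𝓝[>] (0 : ℝ), ∀ z, ‖z‖ < a →
      Realizes (w.map toFactor) h z (evalWord fl w √h z) := by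
  induction w generalizing a with
  | nil => exact Eventually.of_forall fun h z _ => rfl
  | cons f w ih =>
    obtain ⟨b, hab, hbρ⟩ := exists_between ha
    obtain ⟨M, hM⟩ := hb f.1
    have hf := hw f List.mem_cons_self
    have hlim : Tendsto (fun h : ℝ => M * ‖f.2.1 * √h ^ f.2.2‖) (𝓝[>] 0) (𝓝 0) := by
      have hc : Continuous fun h : ℝ => M * ‖f.2.1 * √h ^ f.2.2‖ := by fun_prop
      have := (hc.tendsto 0).mono_left (nhdsWithin_le_nhds (s := Ioi 0))
      simpa [hf.ne'] using this
    filter_upwards [ih (fun f hf => hw f (List.mem_cons_of_mem _ hf)) hbρ,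
      hlim.eventually_lt_const (sub_pos.2 hab), self_mem_nhdsWithin] with h h1 h2 (h3 : 0 < h) z hz
    set t := f.2.1 * √h ^ f.2.2 with ht
    have hdisp : ∀ s ∈ uIcc 0 t, ‖fl f.1 s z‖ < b := by
      intro s hs
      have hd := convex_univ.norm_image_sub_le_of_norm_hasDerivWithin_le
        (f := fun s => fl f.1 s z) (x := 0) (y := s)
        (fun s _ => ((hfl f.1).deriv z s).hasDerivWithinAt) (fun s _ => hM _) (mem_univ _)
        (mem_univ _)
      rw [(hfl f.1).zero, sub_zero] at hd
      have hM0 : 0 ≤ M := (norm_nonneg _).trans (hM z)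
      have hst : ‖s‖ ≤ ‖t‖ := by
        rw [Real.norm_eq_abs, Real.norm_eq_abs]
        simpa using abs_sub_left_of_mem_uIcc hs
      have h4 : M * ‖s‖ ≤ M * ‖t‖ := by gcongr
      have h5 := norm_le_norm_add_norm_sub' (fl f.1 s z) z
      linarith
    have hexp : h ^ ((f.2.2 : ℝ) / 2) = √h ^ f.2.2 := by
      rw [Real.sqrt_eq_rpow, ← Real.rpow_natCast, ← Real.rpow_mul h3.le]
      ring_nf
    refine ⟨fl f.1 t z, ⟨fun s => fl f.1 s z, (hfl f.1).zero z, ?_, ?_⟩,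
      h1 _ (hdisp t right_mem_uIcc)⟩
    · simp only [toFactor, hexp, ← ht]
    · simp only [toFactor, hexp, ← ht]
      intro s hs
      have h6 := ((hfl f.1).deriv z s).hasDerivWithinAt (s := uIcc 0 t)
      rwa [contactField_congr (K := f.1.1) (by
        filter_upwards [hχ _ ((hdisp s hs).trans hbρ)] with y hy
        simp [hy])] at h6

end Word

end J1

/-! ### The splitting error -/

namespace J1

variable {n : ℕ}

/-- Lie brackets involve first derivatives, so the cut-off has to be `1` as a germ at `z`; then each
bracket is the contact field of a Jacobi bracket, and contact fields are additive. -/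
lemma baseField_eq_contactField (R : DepthOne n) {χ : J1 n → ℝ} {z : J1 n}
    (hz : χ =ᶠ[𝓝 z] 1) :
    R.baseField (fun g => contactField fun z => χ z * g.1 z) z = contactField R.ham z := by
  have hA : ∀ g : SmoothHam n, (contactField fun z => χ z * g.1 z) =ᶠ[𝓝 z] contactField g.1 := by
    intro g
    filter_upwards [hz.eventuallyEq_nhds] with y hy
    refine contactField_congr ?_
    filter_upwards [hy] with x hx
    simp [hx]
  have hs0 := R.s₀_mem.1
  have hd0 := contDiff_of_mem_prolongedHam R.d₀_mem
  have hj : ∀ i, ContDiff ℝ ∞ (jacobi (R.s i) (R.d i)) := fun i =>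
    contDiff_jacobi (R.s_mem i).1 (contDiff_of_mem_prolongedHam (R.d_mem i))
  have h2 : ∀ {f : J1 n → ℝ}, ContDiff ℝ ∞ f → ContDiff ℝ 2 f := fun h => h.of_le (by norm_cast)
  have hham : contactField R.ham z = contactField R.s₀ z + contactField R.d₀ z +
      ∑ i, contactField (jacobi (R.s i) (R.d i)) z := by
    have e1 := contactField_add (H := fun z => R.s₀ z + R.d₀ z)
      (K := fun z => ∑ i, jacobi (R.s i) (R.d i) z) (z := z)
      ((hs0.add hd0).differentiable (by simp) z)
      ((ContDiff.sum fun i _ => hj i).differentiable (by simp) z)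
    have e2 := contactField_add (hs0.differentiable (by simp) z) (hd0.differentiable (by simp) z)
    have e3 := contactField_sum (Finset.univ) (f := fun i => jacobi (R.s i) (R.d i)) (z := z)
      fun i _ => (hj i).differentiable (by simp) z
    rw [← e2, ← e3]
    exact e1
  rw [hham, DepthOne.baseField, (hA _).eq_of_nhds, (hA _).eq_of_nhds]
  congr 1
  refine Finset.sum_congr rfl fun i _ => ?_
  rw [contactField_jacobi (h2 (R.s_mem i).1) (h2 (contDiff_of_mem_prolongedHam (R.d_mem i)))]
  rw [VectorField.lieBracket, VectorField.lieBracket, (hA (R.strictGen i)).fderiv_eq,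
    (hA (R.prolongedGen i)).fderiv_eq, (hA (R.strictGen i)).eq_of_nhds,
    (hA (R.prolongedGen i)).eq_of_nhds]
  rfl

lemma baseField_eq_zero (R : DepthOne n) {A : SmoothHam n → J1 n → J1 n} {z : J1 n}
    (hA : ∀ g, A g z = 0) : R.baseField A z = 0 := by
  rw [DepthOne.baseField, hA, hA, Finset.sum_eq_zero, add_zero, add_zero]
  exact fun i _ => VectorField.lieBracket_eq_zero_of_eq_zero (hA _) (hA _)

/-- The scheme of a depth-one representation realizes contact maps near a compact set, which
approximate a complete flow that extends the contact flow. -/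
theorem exists_splitting (R : DepthOne n) (p r : ℕ) {U : Set (J1 n)} (hU : IsCompact U) (T : ℝ) :
    ∃ (C h₀ : ℝ) (W : Set (J1 n)) (Ψ Φ : ℝ → J1 n → J1 n) (X : J1 n → J1 n) (L : ℝ≥0),
      0 < C ∧ U ⊆ W ∧ IsOneStepMap (R.scheme p) h₀ W Ψ ∧ h₀ ≤ 1 ∧ (∀ h, ContDiff ℝ ∞ (Ψ h)) ∧
      ContDiff ℝ ∞ X ∧ LipschitzWith L X ∧ IsGlobalFlow X Φ ∧ EqOn X (contactField R.ham) W ∧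
      ∀ h, 0 < h → h < h₀ → ∀ k : ℕ, k * h ≤ T →
        (∀ z, Φ (k * h) z ∈ U → (Ψ h)^[k] z ∈ W) ∧
        ∀ i ≤ r, ∀ z, ‖iteratedFDeriv ℝ i (fun z => Φ (k * h) z - (Ψ h)^[k] z) z‖
          ≤ C * h ^ (p + 1) := by
  obtain ⟨ρ₀, hρ₀⟩ := hU.isBounded.subset_closedBall (0 : J1 n)
  set ρ := max ρ₀ 0 + 1 with hρ
  have hρ1 : 1 ≤ ρ := by linarith [le_max_right ρ₀ 0]
  -- Cutting off the Hamiltonians, and not the fields, keeps the flows contact. `U` lies in the ball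
  -- of radius `ρ - 1` and `W` is that of radius `ρ`, while `χ = 1` up to `ρ + 1`: one unit of room
  -- for the iterates and one for the intermediate points of a composition.
  let b : ContDiffBump (0 : J1 n) := ⟨ρ + 1, ρ + 2, by linarith, by linarith⟩
  let χ : J1 n → ℝ := b
  have hχ : ContDiff ℝ ∞ χ := b.contDiff
  have hχc : HasCompactSupport χ := b.hasCompactSupport
  have hχ1 : ∀ z, ‖z‖ < ρ + 1 → χ =ᶠ[𝓝 z] 1 := fun z hz =>
    b.eventuallyEq_one_of_mem_ball (by simpa using hz)
  let A : SmoothHam n → J1 n → J1 n := fun g => contactField fun z => χ z * g.1 z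
  have hA : ∀ g, ContDiff ℝ ∞ (A g) := fun g => contDiff_infty_contactField (hχ.mul g.2)
  have hAc : ∀ g, HasCompactSupport (A g) := fun g =>
    hasCompactSupport_contactField hχc.mul_right
  choose L hL using fun g => (hA g).lipschitzWith_of_hasCompactSupport (hAc g) (by simp)
  have hb := fun g => (hAc g).exists_bound_of_continuous (hA g).continuous
  have hflow : ∀ g, ∃ Φ, IsGlobalFlow (A g) Φ := fun g => exists_isGlobalFlow (hL g) (hb g).choose_spec
  choose fl hfl using hflow
  set S := tsupport χ with hS
  have hAS : ∀ g, ∀ z ∉ S, A g z = 0 := fun g z hz =>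
    contactField_eq_zero fun h => hz (tsupport_mul_subset_left h)
  set X := R.baseField A with hXdef
  have hX : ContDiff ℝ ∞ X := R.contDiff_baseField hA
  have hXS : ∀ z ∉ S, X z = 0 := fun z hz => baseField_eq_zero R fun g => hAS g z hz
  have hXc : HasCompactSupport X := HasCompactSupport.intro hχc hXS
  obtain ⟨LX, hLX⟩ := hX.lipschitzWith_of_hasCompactSupport hXc (by simp)
  obtain ⟨MX, hMX⟩ := hXc.exists_bound_of_continuous hX.continuous
  obtain ⟨Φ, hΦ⟩ := exists_isGlobalFlow hLX hMX
  set w := orderWord R.baseWord (2 * p + 1) with hw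
  obtain ⟨e, he⟩ := isApprox_orderWord hfl hL hA hΦ hLX hX (R.isQuadratic_baseWord hfl hL hA)
    (2 * p + 1)
  have hm : 2 * p + 1 + 3 = 2 * (p + 1 + 1) := by ring
  rw [hm] at he
  have hsm := contDiff_evalWord hfl hL hA w
  obtain ⟨C, h₀, hC, hh₀, hh₁, herr⟩ := exists_global_error hΦ hLX hX hχc
    (fun t z hz => hΦ.fixed hLX (hXS z hz) t)
    (fun t z hz => evalWord_of_fixed (fun g t z hz => (hfl g).fixed (hL g) (hAS g z hz) t) w t z hz)
    hsm (q := p + 1) (by omega) he r T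
  have hreal := eventually_realizes (ρ := ρ + 1) hχ1 hfl hb w
    (fun f hf => (R.exists_mem_baseWord hf).2) (a := ρ) (by linarith)
  obtain ⟨h₂, hh₂, hreal⟩ := mem_nhdsGT_iff_exists_Ioo_subset.1 hreal
  have hh₂ : 0 < h₂ := hh₂
  -- For `h < C⁻¹` the error `C h^(p+1)` is less than `1`, the margin between `U` and the boundary
  -- of `W`.
  refine ⟨C, min (min h₀ h₂) C⁻¹, Metric.ball 0 ρ, fun h => evalWord fl w √h, Φ, X, LX, hC, ?_,
    ⟨lt_min (lt_min hh₀ hh₂) (inv_pos.2 hC), Metric.isOpen_ball, ?_, ?_⟩,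
    (min_le_left _ _).trans ((min_le_left _ _).trans hh₁), ?_, hX, hLX, hΦ, ?_, ?_⟩
  · intro z hz
    have h1 := hρ₀ hz
    rw [mem_closedBall_zero_iff] at h1
    rw [mem_ball_zero_iff]
    linarith [le_max_left ρ₀ 0]
  · intro h h0 hh z hz
    exact hreal ⟨h0, hh.trans_le ((min_le_left _ _).trans (min_le_right _ _))⟩ z
      (by simpa using hz)
  · intro h h0 hh
    exact (isContactDiffeo_evalWord hχ hfl hL w _).isContactMapOn _
  · exact fun h => hsm.comp (f := fun z : J1 n => (√h, z)) (by fun_prop)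
  · intro z hz
    rw [mem_ball_zero_iff] at hz
    exact baseField_eq_contactField R (hχ1 z (by linarith))
  · intro h h0 hh k hk
    have hhh := herr h h0 (hh.trans_le ((min_le_left _ _).trans (min_le_left _ _))) k hk
    refine ⟨fun z hz => ?_, hhh⟩
    have h1 := hhh 0 (Nat.zero_le _) z
    rw [norm_iteratedFDeriv_zero] at h1
    have h2 : h ≤ 1 := hh.le.trans ((min_le_left _ _).trans ((min_le_left _ _).trans hh₁))
    have h3 : C * h ^ (p + 1) < 1 := by
      calc C * h ^ (p + 1) ≤ C * h := by
            gcongr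
            exact pow_le_of_le_one h0.le h2 (by omega)
        _ < C * C⁻¹ := by
            gcongr
            exact hh.trans_le (min_le_right _ _)
        _ = 1 := mul_inv_cancel₀ hC.ne'
    have h4 := hρ₀ hz
    rw [mem_closedBall_zero_iff] at h4
    rw [mem_ball_zero_iff]
    have h5 := norm_le_norm_add_norm_sub (Φ (k * h) z) ((evalWord fl w √h)^[k] z)
    linarith [le_max_left ρ₀ 0]

end J1

/-! ### Depth-one representations of polynomial Hamiltonians -/

namespace J1

variable {n : ℕ}

/-- `G` has a depth-one representation. -/
def IsDepthOne (G : J1 n → ℝ) : Prop :=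
  ∃ s₀ ∈ strictHam n, ∃ d₀ ∈ prolongedHam n, ∃ l : List ((J1 n → ℝ) × (J1 n → ℝ)),
    (∀ e ∈ l, e.1 ∈ strictHam n ∧ e.2 ∈ prolongedHam n) ∧
    ∀ z, G z = s₀ z + d₀ z + (l.map fun e => jacobi e.1 e.2 z).sum

lemma IsDepthOne.exists_ham {G : J1 n → ℝ} (h : IsDepthOne G) : ∃ R : DepthOne n, R.ham = G := by
  obtain ⟨s₀, hs₀, d₀, hd₀, l, hl, hG⟩ := h
  refine ⟨⟨l.length, s₀, d₀, fun i => l[i].1, fun i => l[i].2, hs₀, hd₀,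
    fun i => (hl _ (List.getElem_mem _)).1, fun i => (hl _ (List.getElem_mem _)).2⟩, ?_⟩
  funext z
  rw [hG, DepthOne.ham]
  congr 1
  exact Fin.sum_univ_fun_getElem l fun e => jacobi e.1 e.2 z

lemma zero_mem_strictHam : (fun _ => 0 : J1 n → ℝ) ∈ strictHam n :=
  ⟨contDiff_const, fun z => by simp [du]⟩

lemma add_mem_strictHam {f g : J1 n → ℝ} (hf : f ∈ strictHam n) (hg : g ∈ strictHam n) :
    (fun z => f z + g z) ∈ strictHam n := by
  refine ⟨hf.1.add hg.1, fun z => ?_⟩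
  have h1 := hf.2 z
  have h2 := hg.2 z
  rw [du] at h1 h2 ⊢
  rw [fderiv_fun_add (hf.1.differentiable (by simp) z) (hg.1.differentiable (by simp) z),
    add_apply, h1, h2, add_zero]

lemma zero_mem_prolongedHam : (fun _ => 0 : J1 n → ℝ) ∈ prolongedHam n :=
  ⟨fun _ => 0, fun _ _ => 0, contDiff_const, fun _ => contDiff_const, fun x u p => by simp⟩

lemma add_mem_prolongedHam {f g : J1 n → ℝ} (hf : f ∈ prolongedHam n) (hg : g ∈ prolongedHam n) :
    (fun z => f z + g z) ∈ prolongedHam n := by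
  obtain ⟨a, b, ha, hb, h1⟩ := hf
  obtain ⟨a', b', ha', hb', h2⟩ := hg
  refine ⟨fun q => a q + a' q, fun i q => b i q + b' i q, ha.add ha', fun i => (hb i).add (hb' i),
    fun x u p => ?_⟩
  simp only [h1, h2, add_mul, Finset.sum_add_distrib]
  ring

lemma IsDepthOne.add {f g : J1 n → ℝ} (hf : IsDepthOne f) (hg : IsDepthOne g) :
    IsDepthOne fun z => f z + g z := by
  obtain ⟨s₀, hs₀, d₀, hd₀, l, hl, hG⟩ := hf
  obtain ⟨s₀', hs₀', d₀', hd₀', l', hl', hG'⟩ := hg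
  refine ⟨_, add_mem_strictHam hs₀ hs₀', _, add_mem_prolongedHam hd₀ hd₀', l ++ l',
    fun e he => ?_, fun z => ?_⟩
  · rcases List.mem_append.1 he with h | h
    · exact hl e h
    · exact hl' e h
  · simp only [hG, hG', List.map_append, List.sum_append]
    ring

lemma isDepthOne_of_prolonged {f : J1 n → ℝ} (hf : f ∈ prolongedHam n) : IsDepthOne f :=
  ⟨_, zero_mem_strictHam, f, hf, [], by simp, fun z => by simp⟩

lemma isDepthOne_jacobi {f g : J1 n → ℝ} (hf : f ∈ strictHam n) (hg : g ∈ prolongedHam n) :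
    IsDepthOne (jacobi f g) :=
  ⟨_, zero_mem_strictHam, _, zero_mem_prolongedHam, [(f, g)], by simp [hf, hg], fun z => by simp⟩

lemma IsDepthOne.sum {ι : Type*} (s : Finset ι) {f : ι → J1 n → ℝ}
    (hf : ∀ i ∈ s, IsDepthOne (f i)) : IsDepthOne fun z => ∑ i ∈ s, f i z := by
  classical
  induction s using Finset.induction_on with
  | empty => simpa using isDepthOne_of_prolonged zero_mem_prolongedHam
  | insert i s hi ih =>
    simp only [Finset.sum_insert hi]
    exact (hf i (Finset.mem_insert_self i s)).add
      (ih fun j hj => hf j (Finset.mem_insert_of_mem hj))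

/-- The monomial `p ^ a`. -/
def mono (a : Fin n → ℕ) (z : J1 n) : ℝ := ∏ i, z.2.2 i ^ a i

lemma contDiff_mono (a : Fin n → ℕ) : ContDiff ℝ ∞ (mono a) := by
  unfold mono
  exact contDiff_prod fun i _ => by fun_prop

/-- A function of `(x, u)`, as a Hamiltonian. -/
def lift (f : (Fin n → ℝ) × ℝ → ℝ) (z : J1 n) : ℝ := f (z.1, z.2.1)

/-- If `a i = 0`, the truncated exponent `a i - 1` is again `0`, and the factor `a i` removes the
term. -/
lemma fderiv_mono (a : Fin n → ℕ) (z v : J1 n) : fderiv ℝ (mono a) z v =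
    ∑ i, a i * v.2.2 i * mono (Function.update a i (a i - 1)) z := by
  have h : HasFDerivAt (mono a) _ z := HasFDerivAt.finsetProd (u := Finset.univ)
    fun i _ => (hasFDerivAt_momentum i z).pow (a i)
  rw [h.fderiv, sum_apply]
  refine Finset.sum_congr rfl fun i _ => ?_
  have h1 : mono (Function.update a i (a i - 1)) z =
      z.2.2 i ^ (a i - 1) * ∏ j ∈ Finset.univ.erase i, z.2.2 j ^ a j := by
    rw [mono, ← Finset.mul_prod_erase _ _ (Finset.mem_univ i)]
    congr 1
    · simp
    · refine Finset.prod_congr rfl fun j hj => ?_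
      rw [Function.update_of_ne (Finset.ne_of_mem_erase hj)]
  rw [h1]
  simp
  ring

lemma dp_mono (a : Fin n → ℕ) (i : Fin n) (z : J1 n) :
    dp (mono a) i z = a i * mono (Function.update a i (a i - 1)) z := by
  simp [dp, fderiv_mono, Pi.single_apply]

lemma dx_mono (a : Fin n → ℕ) (i : Fin n) (z : J1 n) : dx (mono a) i z = 0 := by
  simp [dx, fderiv_mono]

lemma du_mono (a : Fin n → ℕ) (z : J1 n) : du (mono a) z = 0 := by
  simp [du, fderiv_mono]

lemma mul_dp_mono (a : Fin n → ℕ) (i : Fin n) (z : J1 n) :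
    z.2.2 i * dp (mono a) i z = a i * mono a z := by
  rw [dp_mono]
  rcases Nat.eq_zero_or_pos (a i) with h | h
  · simp [h]
  have h1 : z.2.2 i * mono (Function.update a i (a i - 1)) z = mono a z := by
    rw [mono, mono, ← Finset.mul_prod_erase _ _ (Finset.mem_univ i),
      ← Finset.mul_prod_erase _ (fun j => z.2.2 j ^ a j) (Finset.mem_univ i), ← mul_assoc]
    congr 1
    · simp only [Function.update_self]
      rw [← pow_succ', Nat.sub_add_cancel h]
    · refine Finset.prod_congr rfl fun j hj => ?_
      rw [Function.update_of_ne (Finset.ne_of_mem_erase hj)]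
  rw [mul_left_comm, h1]

lemma fderiv_lift {f : (Fin n → ℝ) × ℝ → ℝ} (hf : ContDiff ℝ ∞ f) (z v : J1 n) :
    fderiv ℝ (lift f) z v = fderiv ℝ f (z.1, z.2.1) (v.1, v.2.1) := by
  have h1 : HasFDerivAt (fun z : J1 n => (z.1, z.2.1))
      ((ContinuousLinearMap.fst ℝ (Fin n → ℝ) (ℝ × (Fin n → ℝ))).prod
        ((ContinuousLinearMap.fst ℝ ℝ (Fin n → ℝ)).comp
          (ContinuousLinearMap.snd ℝ (Fin n → ℝ) (ℝ × (Fin n → ℝ))))) z :=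
    ((ContinuousLinearMap.fst ℝ (Fin n → ℝ) (ℝ × (Fin n → ℝ))).prod
        ((ContinuousLinearMap.fst ℝ ℝ (Fin n → ℝ)).comp
          (ContinuousLinearMap.snd ℝ (Fin n → ℝ) (ℝ × (Fin n → ℝ))))).hasFDerivAt
  have h2 : HasFDerivAt f (fderiv ℝ f (z.1, z.2.1)) (z.1, z.2.1) :=
    (hf.differentiable (by simp) _).hasFDerivAt
  have h3 : HasFDerivAt (lift f) _ z := h2.comp z h1
  rw [h3.fderiv]
  rfl

/-- The primitive in `u` is written as `u ∫₀¹ f(x, s u) ds`, over a fixed interval, so that its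
joint smoothness follows from that of parametric integrals. -/
lemma exists_antiderivative {f : (Fin n → ℝ) × ℝ → ℝ} (hf : ContDiff ℝ ∞ f) :
    ∃ F : (Fin n → ℝ) × ℝ → ℝ, ContDiff ℝ ∞ F ∧ ∀ q, fderiv ℝ F q (0, 1) = f q := by
  have hg : ContDiff ℝ ∞ fun y : ℝ × ((Fin n → ℝ) × ℝ) => f (y.2.1, y.1 * y.2.2) :=
    hf.comp (f := fun y : ℝ × ((Fin n → ℝ) × ℝ) => (y.2.1, y.1 * y.2.2)) (by fun_prop)
  have hF : ContDiff ℝ ∞ fun q : (Fin n → ℝ) × ℝ => q.2 * ∫ s in (0 : ℝ)..1, f (q.1, s * q.2) :=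
    contDiff_snd.mul (contDiff_parametric_intervalIntegral hg)
  refine ⟨_, hF, fun q => ?_⟩
  have h1 : HasDerivAt (fun s : ℝ => (q.1, s)) ((0, 1) : (Fin n → ℝ) × ℝ) q.2 :=
    (hasDerivAt_const q.2 q.1).prodMk (hasDerivAt_id q.2)
  have h2 := (hF.differentiable (by simp) (q.1, q.2)).hasFDerivAt.comp_hasDerivAt q.2 h1
  have h3 : (fun q : (Fin n → ℝ) × ℝ => q.2 * ∫ s in (0 : ℝ)..1, f (q.1, s * q.2)) ∘
      (fun s : ℝ => (q.1, s)) = fun u => ∫ s in (0 : ℝ)..u, f (q.1, s) := by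
    funext u
    have := intervalIntegral.mul_integral_comp_mul_right (a := 0) (b := 1)
      (f := fun s => f (q.1, s)) u
    simpa using this
  have hc : Continuous fun s => f (q.1, s) := hf.continuous.comp (by fun_prop)
  have h4 : HasDerivAt (fun u => ∫ s in (0 : ℝ)..u, f (q.1, s)) (f (q.1, q.2)) q.2 :=
    intervalIntegral.integral_hasDerivAt_right (hc.intervalIntegrable _ _)
      (hc.stronglyMeasurableAtFilter _ _) hc.continuousAt
  rw [h3] at h2
  exact h2.unique h4

/-- For `|a| = k` one has `p^a - p·∂_p p^a = (1 - k) p^a`, so `[p^a, F] = (k - 1) F_u p^a + ∑ aᵢ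
p^(a - eᵢ) F_{xᵢ}`. With `F_u = f / (k - 1)` this is `f p^a` up to degree `k - 1`. The division
fails only at `k = 1`, where the Hamiltonian is already prolonged. -/
lemma isDepthOne_mul_mono (k : ℕ) : ∀ (a : Fin n → ℕ), ∑ i, a i = k →
    ∀ f : (Fin n → ℝ) × ℝ → ℝ, ContDiff ℝ ∞ f → IsDepthOne fun z => lift f z * mono a z := by
  induction k using Nat.strong_induction_on with
  | _ k ih =>
    intro a ha f hf
    rcases Nat.lt_or_ge k 2 with hk | hk
    · refine isDepthOne_of_prolonged ?_
      interval_cases k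
      · have h0 : ∀ i, a i = 0 := fun i => (Finset.sum_eq_zero_iff.1 ha) i (Finset.mem_univ i)
        exact ⟨f, fun _ _ => 0, hf, fun _ => contDiff_const, fun x u p => by
          simp [lift, mono, h0]⟩
      · obtain ⟨i, hi⟩ : ∃ i, a i ≠ 0 := by
          by_contra! h
          simp [h] at ha
        have hs := Finset.add_sum_erase Finset.univ a (Finset.mem_univ i)
        have h0 : ∀ j ∈ Finset.univ.erase i, a j = 0 := by
          refine Finset.sum_eq_zero_iff.1 ?_
          omega
        have h1 : a i = 1 := by
          rw [Finset.sum_eq_zero h0] at hs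
          omega
        refine ⟨fun _ => 0, fun j => if j = i then f else fun _ => 0, contDiff_const, fun j => ?_,
          fun x u p => ?_⟩
        · dsimp only
          split_ifs
          · exact hf
          · exact contDiff_const
        · have : ∏ j, p j ^ a j = p i := by
            rw [← Finset.mul_prod_erase _ _ (Finset.mem_univ i), h1, pow_one,
              Finset.prod_eq_one fun j hj => by rw [h0 j hj, pow_zero], mul_one]
          simp only [lift, mono, this, zero_add]
          rw [Finset.sum_eq_single i (fun j _ hj => by simp [hj]) (by simp)]
          simp
    · obtain ⟨F₀, hF₀, hFu⟩ := exists_antiderivative hf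
      have hk0 : ((k : ℝ) - 1) ≠ 0 := by
        have : (2 : ℝ) ≤ k := by exact_mod_cast hk
        linarith
      set F : (Fin n → ℝ) × ℝ → ℝ := fun q => ((k : ℝ) - 1)⁻¹ * F₀ q with hFdef
      have hF : ContDiff ℝ ∞ F := contDiff_const.mul hF₀
      have hdF : ∀ q v, fderiv ℝ F q v = ((k : ℝ) - 1)⁻¹ * fderiv ℝ F₀ q v := by
        intro q v
        rw [hFdef, fderiv_const_mul (hF₀.differentiable (by simp) q)]
        simp
      have hdp : ∀ i z, dp (lift F) i z = 0 := fun i z => by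
        rw [dp, fderiv_lift hF]
        exact map_zero _
      have hdu : ∀ z, du (lift F) z = ((k : ℝ) - 1)⁻¹ * lift f z := fun z => by
        rw [du, fderiv_lift hF, hdF, hFu, lift]
      have hdx : ∀ i z, dx (lift F) i z =
          lift (fun q => fderiv ℝ F q (Pi.single i 1, 0)) z := fun i z => by
        rw [dx, fderiv_lift hF, lift]
      have hlin : ∑ i, (a i : ℝ) = k := by exact_mod_cast ha
      have hjac : ∀ z, jacobi (mono a) (lift F) z =
          ∑ i, a i * mono (Function.update a i (a i - 1)) z *
            lift (fun q => fderiv ℝ F q (Pi.single i 1, 0)) z + lift f z * mono a z := by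
        intro z
        have he : ∑ i, z.2.2 i * dp (mono a) i z = k * mono a z := by
          simp only [mul_dp_mono, ← Finset.sum_mul, hlin]
        rw [jacobi, poisson, euler, euler, he]
        simp only [dx_mono, du_mono, hdp, hdu, hdx, dp_mono]
        simp only [zero_mul, sub_zero, add_zero]
        field_simp
        ring
      have hstrict : mono a ∈ strictHam n := ⟨contDiff_mono a, du_mono a⟩
      have hprol : lift F ∈ prolongedHam n :=
        ⟨F, fun _ _ => 0, hF, fun _ => contDiff_const, fun x u p => by simp [lift]⟩
      have hmain := (isDepthOne_jacobi hstrict hprol).add (IsDepthOne.sum Finset.univ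
        (f := fun i z => lift (fun q => -(a i * fderiv ℝ F q (Pi.single i 1, 0))) z *
          mono (Function.update a i (a i - 1)) z) fun i _ => ?_)
      · convert hmain using 1
        funext z
        rw [hjac, add_comm, ← add_assoc, ← Finset.sum_add_distrib, Finset.sum_eq_zero, zero_add]
        intro i _
        simp only [lift]
        ring
      · have hsm : ContDiff ℝ ∞ fun q => -(a i * fderiv ℝ F q (Pi.single i 1, 0)) := by
          have : ContDiff ℝ ∞ (fderiv ℝ F) := hF.fderiv_right (by simp)
          fun_prop
        -- If `a i = 0`, truncated subtraction does not lower the degree, but the coefficient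
        -- vanishes.
        rcases Nat.eq_zero_or_pos (a i) with h0 | h0
        · refine isDepthOne_of_prolonged ?_
          simpa [lift, h0] using zero_mem_prolongedHam
        · refine ih (k - 1) (by omega) _ ?_ _ hsm
          have h1 := Finset.add_sum_erase Finset.univ a (Finset.mem_univ i)
          rw [← Finset.add_sum_erase Finset.univ _ (Finset.mem_univ i), Function.update_self,
            Finset.sum_congr rfl fun j hj =>
              Function.update_of_ne (Finset.ne_of_mem_erase hj) (a i - 1) a]
          change a i - 1 + ∑ j ∈ Finset.univ.erase i, a j = _
          omega

/-- Every Hamiltonian that is polynomial in `p` has a depth-one representation. -/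
theorem exists_depthOne {N : ℕ} {G : J1 n → ℝ} (hG : G ∈ polyHam n N) :
    ∃ R : DepthOne n, R.ham = G := by
  obtain ⟨f, hf, h⟩ := hG
  refine IsDepthOne.exists_ham ?_
  have := IsDepthOne.sum (n := n)
    (Finset.univ.filter fun a : Fin n → Fin (N + 1) => ∑ i, (a i : ℕ) ≤ N)
    (f := fun a z => lift (f a) z * mono (fun i => (a i : ℕ)) z)
    fun a _ => isDepthOne_mul_mono _ _ rfl _ (hf a)
  convert this using 1
  funext z
  exact h z.1 z.2.1 z.2.2

end J1

/-! ### Comparison of flows in `C^r` -/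

section FlowComparison

variable {E : Type} [NormedAddCommGroup E] [NormedSpace ℝ E]

/-- The top derivative of `Φ` enters only through `DX(Φ) · D^(j+1)Φ`; everything else involves
derivatives of `Φ` of order at most `j`. This makes the Gronwall estimate for the top order linear.
-/
lemma norm_iteratedFDeriv_comp_le_linear {X Φ : E → E} {j : ℕ} (hX : ContDiff ℝ (j + 1) X)
    (hΦ : ContDiff ℝ (j + 1) Φ) {z : E} {M N : ℝ} (hN : 1 ≤ N)
    (hXM : ∀ i, 1 ≤ i → i ≤ j + 1 → ‖iteratedFDeriv ℝ i X (Φ z)‖ ≤ M)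
    (hΦN : ∀ i, 1 ≤ i → i ≤ j → ‖iteratedFDeriv ℝ i Φ z‖ ≤ N) :
    ‖iteratedFDeriv ℝ (j + 1) (X ∘ Φ) z‖ ≤ M * ‖iteratedFDeriv ℝ (j + 1) Φ z‖ +
      2 ^ j * (j.factorial * M * N ^ j * N) := by
  have hM0 : 0 ≤ M := (norm_nonneg _).trans (hXM 1 le_rfl (by omega))
  have hj0 : ((j : WithTop ℕ∞) + 1) ≠ 0 := by
    simp
  have h1 : fderiv ℝ (X ∘ Φ) = fun z =>
      (ContinuousLinearMap.compL ℝ E E E) (fderiv ℝ X (Φ z)) (fderiv ℝ Φ z) := by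
    funext z
    exact fderiv_comp z (hX.differentiable hj0 _) (hΦ.differentiable hj0 _)
  have hDX : ContDiff ℝ j (fderiv ℝ X) := hX.fderiv_right le_rfl
  have hDΦ : ContDiff ℝ j (fderiv ℝ Φ) := hΦ.fderiv_right le_rfl
  have hΦj : ContDiff ℝ j Φ := hΦ.of_le le_self_add
  rw [← norm_iteratedFDeriv_fderiv, h1]
  refine ((ContinuousLinearMap.compL ℝ E E E).norm_iteratedFDeriv_le_of_bilinear_of_le_one
    (hDX.comp hΦj) hDΦ z le_rfl (ContinuousLinearMap.norm_compL_le ℝ E E E)).trans ?_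
  rw [Finset.sum_range_succ', add_comm]
  have hpos : 0 ≤ (j.factorial : ℝ) * M * N ^ j * N := by positivity
  refine add_le_add ?_ ?_
  · simp only [Nat.choose_zero_right, Nat.cast_one, one_mul, norm_iteratedFDeriv_zero,
      Function.comp_apply, Nat.sub_zero, norm_iteratedFDeriv_fderiv]
    gcongr
    have := hXM 1 le_rfl (by omega)
    rwa [← norm_iteratedFDeriv_fderiv, norm_iteratedFDeriv_zero] at this
  · calc ∑ i ∈ Finset.range j, (j.choose (i + 1) : ℝ) *
          ‖iteratedFDeriv ℝ (i + 1) (fderiv ℝ X ∘ Φ) z‖ *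
          ‖iteratedFDeriv ℝ (j - (i + 1)) (fderiv ℝ Φ) z‖
        ≤ ∑ i ∈ Finset.range j, (j.choose (i + 1) : ℝ) * (j.factorial * M * N ^ j * N) := by
          refine Finset.sum_le_sum fun i hi => ?_
          have hi' : i < j := Finset.mem_range.1 hi
          have e1 : ‖iteratedFDeriv ℝ (i + 1) (fderiv ℝ X ∘ Φ) z‖ ≤ j.factorial * M * N ^ j := by
            refine (norm_iteratedFDeriv_comp_le (N := j) hDX hΦj (n := i + 1)
              (by exact_mod_cast hi') z (C := M) (D := N) (fun k hk => ?_)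
              (fun k hk1 hk2 => ?_)).trans ?_
            · rw [norm_iteratedFDeriv_fderiv]
              exact hXM _ (by omega) (by omega)
            · exact (hΦN k hk1 (by omega)).trans (le_self_pow₀ hN (by omega))
            · gcongr
              · exact hi'
              · exact hi'
          have e2 : ‖iteratedFDeriv ℝ (j - (i + 1)) (fderiv ℝ Φ) z‖ ≤ N := by
            rw [norm_iteratedFDeriv_fderiv]
            exact hΦN _ (by omega) (by omega)
          rw [mul_assoc]
          gcongr
      _ = (∑ i ∈ Finset.range j, (j.choose (i + 1) : ℝ)) * (j.factorial * M * N ^ j * N) := by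
          rw [Finset.sum_mul]
      _ ≤ 2 ^ j * (j.factorial * M * N ^ j * N) := by
          gcongr
          have h2 : ∑ i ∈ Finset.range (j + 1), (j.choose i : ℝ) = 2 ^ j := by
            exact_mod_cast Nat.sum_range_choose j
          rw [Finset.sum_range_succ'] at h2
          have : (0 : ℝ) ≤ (j.choose 0 : ℝ) := by positivity
          linarith

variable [CompleteSpace E]

variable (E) in
/-- A priori bounds for the derivatives of a flow. -/
lemma exists_flow_bound (r : ℕ) (M T : ℝ) (hM : 0 ≤ M) :
    ∃ N : ℝ, 1 ≤ N ∧ ∀ (X : E → E) (Φ : ℝ → E → E) (L : ℝ≥0), IsGlobalFlow X Φ →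
      LipschitzWith L X → ContDiff ℝ r X → ∀ z,
      (∀ t ∈ Icc 0 T, ∀ i, 1 ≤ i → i ≤ r → ‖iteratedFDeriv ℝ i X (Φ t z)‖ ≤ M) →
      ∀ t ∈ Icc 0 T, ∀ i, 1 ≤ i → i ≤ r → ‖iteratedFDeriv ℝ i (Φ t) z‖ ≤ N := by
  induction r with
  | zero => exact ⟨1, le_rfl, fun X Φ L _ _ _ z _ t _ i h1 h2 => by omega⟩
  | succ r ih =>
    obtain ⟨N, hN, ih⟩ := ih
    set c : ℝ := 2 ^ r * (r.factorial * M * N ^ r * N) with hc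
    have hc0 : 0 ≤ c := by positivity
    refine ⟨max N (gronwallBound 1 M c T), le_max_of_le_left hN,
      fun X Φ L hΦ hL hX z hb t ht i h1 h2 => ?_⟩
    have hXr : ContDiff ℝ r X := hX.of_le (by exact_mod_cast Nat.le_succ r)
    have ih' := ih X Φ L hΦ hL hXr z fun t ht i h1 h2 => hb t ht i h1 (by omega)
    rcases Nat.lt_or_ge r i with h3 | h3
    · obtain rfl : i = r + 1 := by omega
      refine le_max_of_le_right ?_
      have hd := fun t ht => (hΦ.contDiff_of_nat hL hX (T := T) t ht)
      have hg := norm_le_gronwallBound_of_norm_deriv_right_le (a := 0) (b := T) (δ := 1) (K := M)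
        (ε := c) (f := fun s => iteratedFDeriv ℝ (r + 1) (Φ s) z)
        (f' := fun s => iteratedFDeriv ℝ (r + 1) (X ∘ Φ s) z)
        (fun s hs => ((hd s hs).2 _ le_rfl z).continuousWithinAt)
        (fun s hs => ((hd s (Ico_subset_Icc_self hs)).2 _ le_rfl z).Ici_of_Icc hs)
        (by
          have h0 : Φ 0 = fun z => ContinuousLinearMap.id ℝ E z + 0 := by
            funext z
            simp [hΦ.zero]
          rw [h0]
          exact norm_iteratedFDeriv_affine_le _ ContinuousLinearMap.norm_id_le 0 h1 z)
        (fun s hs => by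
          have hs' := Ico_subset_Icc_self hs
          exact norm_iteratedFDeriv_comp_le_linear (by exact_mod_cast hX)
            (by exact_mod_cast (hd s hs').1) hN (hb s hs') (ih' s hs')) t ht
      refine hg.trans (gronwallBound_mono zero_le_one hc0 hM ?_)
      linarith [ht.2]
    · exact le_max_of_le_left (ih' t ht i h1 h3)

variable (E) in
/-- If the derivatives of two vector fields are close along the two trajectories of a point, then
so are the derivatives of the two flows. -/
theorem exists_flow_comparison (r : ℕ) (M T : ℝ) (hM : 0 ≤ M) :
    ∃ C : ℝ, 0 < C ∧ ∀ (X Y : E → E) (Φ Ψ : ℝ → E → E) (L L' : ℝ≥0), IsGlobalFlow X Φ →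
      IsGlobalFlow Y Ψ → LipschitzWith L X → LipschitzWith L' Y → ContDiff ℝ r X →
      ContDiff ℝ r Y → ∀ (z : E) (η : ℝ),
      (∀ t ∈ Icc 0 T, ∀ i, 1 ≤ i → i ≤ r → ‖iteratedFDeriv ℝ i X (Φ t z)‖ ≤ M) →
      (∀ t ∈ Icc 0 T, ∀ i, 1 ≤ i → i ≤ r → ‖iteratedFDeriv ℝ i Y (Ψ t z)‖ ≤ M) →
      (∀ t ∈ Icc 0 T, ∀ i ≤ r,
        ‖iteratedFDeriv ℝ i X (Φ t z) - iteratedFDeriv ℝ i Y (Ψ t z)‖ ≤ η) →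
      ∀ t ∈ Icc 0 T, ∀ i ≤ r, ‖iteratedFDeriv ℝ i (Φ t) z - iteratedFDeriv ℝ i (Ψ t) z‖ ≤ C * η := by
  obtain ⟨N, hN, hbound⟩ := exists_flow_bound E r M T hM
  set P := max M N with hP
  have hP1 : 1 ≤ P := hN.trans (le_max_right M N)
  set κ := compConst P r with hκ
  have hκ1 : 1 ≤ κ := one_le_compConst hP1 r
  refine ⟨max (Real.exp (κ * T) - 1) 1, lt_max_of_lt_right one_pos,
    fun X Y Φ Ψ L L' hΦ hΨ hL hL' hX hY z η hXM hYM hη t ht => ?_⟩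
  have hη0 : 0 ≤ η := (norm_nonneg _).trans (hη t ht 0 (Nat.zero_le r))
  have hΦN := hbound X Φ L hΦ hL hX z hXM
  have hΨN := hbound Y Ψ L' hΨ hL' hY z hYM
  have hd := fun t ht => (hΦ.contDiff_of_nat hL hX (T := T) t ht)
  have hd' := fun t ht => (hΨ.contDiff_of_nat hL' hY (T := T) t ht)
  -- The differences of the derivatives of all orders up to `r` form one curve in a finite product
  -- with the maximum norm, for which `‖w'‖ ≤ κ ‖w‖ + κ η`.
  let w : ℝ → (i : Fin (r + 1)) → (E [×(i : ℕ)]→L[ℝ] E) := fun s i =>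
    iteratedFDeriv ℝ i (Φ s) z - iteratedFDeriv ℝ i (Ψ s) z
  let w' : ℝ → (i : Fin (r + 1)) → (E [×(i : ℕ)]→L[ℝ] E) := fun s i =>
    iteratedFDeriv ℝ i (X ∘ Φ s) z - iteratedFDeriv ℝ i (Y ∘ Ψ s) z
  have hw : ∀ s ∈ Icc 0 T, HasDerivWithinAt w (w' s) (Icc 0 T) s := fun s hs =>
    hasDerivWithinAt_pi.2 fun i =>
      ((hd s hs).2 i (by omega) z).sub ((hd' s hs).2 i (by omega) z)
  have hwi : ∀ s, ∀ i ≤ r, ‖iteratedFDeriv ℝ i (Φ s) z - iteratedFDeriv ℝ i (Ψ s) z‖ ≤ ‖w s‖ :=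
    fun s i hi => norm_le_pi_norm (w s) ⟨i, by omega⟩
  have hg := norm_le_gronwallBound_of_norm_deriv_right_le (a := 0) (b := T) (δ := 0) (K := κ)
    (ε := κ * η) (f := w) (f' := w')
    (fun s hs => (hw s hs).continuousWithinAt)
    (fun s hs => (hw s (Ico_subset_Icc_self hs)).Ici_of_Icc hs)
    (by
      have h0 : Φ 0 = Ψ 0 := funext fun z => by rw [hΦ.zero, hΨ.zero]
      have : w 0 = 0 := by
        funext i
        simp [w, h0]
      rw [this, norm_zero])
    (fun s hs => by
      have hs' := Ico_subset_Icc_self hs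
      have hc := norm_iteratedFDeriv_comp_sub_comp_le hP1 r hX hY (hd s hs').1 (hd' s hs').1
        (z := z) (ε := ‖w s‖ + η)
        (fun i h1 h2 => (hYM s hs' i h1 h2).trans (le_max_left M N))
        (fun i h1 h2 => (hΦN s hs' i h1 h2).trans (le_max_right M N))
        (fun i h1 h2 => (hΨN s hs' i h1 h2).trans (le_max_right M N))
        (fun i hi => (hη s hs' i hi).trans (by linarith [norm_nonneg (w s)]))
        (fun i h1 h2 => (hwi s i h2).trans (by linarith))
      have hcc : 0 ≤ κ * ‖w s‖ + κ * η := by positivity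
      rw [pi_norm_le_iff_of_nonneg hcc]
      intro i
      have hi : (i : ℕ) ≤ r := by omega
      have hir : ((i : ℕ) : WithTop ℕ∞) ≤ r := by exact_mod_cast hi
      have : ‖iteratedFDeriv ℝ i (fun y => (X ∘ Φ s) y - (Y ∘ Ψ s) y) z‖ ≤ κ * (‖w s‖ + η) := hc i hi
      rw [fun_iteratedFDeriv_sub_apply (((hX.comp (hd s hs').1).of_le hir).contDiffAt)
        (((hY.comp (hd' s hs').1).of_le hir).contDiffAt)] at this
      calc ‖w' s i‖ ≤ κ * (‖w s‖ + η) := this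
        _ = κ * ‖w s‖ + κ * η := by ring) t ht
  intro i hi
  refine (hwi t i hi).trans (hg.trans ?_)
  rw [gronwallBound_of_K_ne_0 (by linarith)]
  have he : Real.exp (κ * (t - 0)) ≤ Real.exp (κ * T) := by
    rw [sub_zero]
    gcongr
    exact ht.2
  have hκ0 : κ ≠ 0 := by linarith
  have : κ * η / κ = η := by field_simp
  simp only [this, zero_mul, zero_add]
  rw [mul_comm]
  gcongr
  exact le_max_of_le_left (by linarith)

end FlowComparison

/-! ### Lipschitz continuity of products and of compactly supported maps -/

section LipschitzLemmas

variable {E F : Type*} [NormedAddCommGroup E] [NormedAddCommGroup F]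

lemma exists_lipschitzOnWith_smul [NormedSpace ℝ F] {f : E → ℝ} {g : E → F} {z : E}
    (hf : ∃ K, ∃ t ∈ 𝓝 z, LipschitzOnWith K f t) (hg : ∃ K, ∃ t ∈ 𝓝 z, LipschitzOnWith K g t) :
    ∃ K, ∃ t ∈ 𝓝 z, LipschitzOnWith K (fun x => f x • g x) t := by
  obtain ⟨K₁, t₁, ht₁, h₁⟩ := hf
  obtain ⟨K₂, t₂, ht₂, h₂⟩ := hg
  have hp := (h₁.mono (inter_subset_left (t := t₂))).prodMk (h₂.mono (inter_subset_right (s := t₁)))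
  have hs : ContDiffAt ℝ 1 (fun q : ℝ × F => q.1 • q.2) (f z, g z) := by fun_prop
  obtain ⟨K, t, ht, h⟩ := hs.exists_lipschitzOnWith
  have hc : ContinuousAt (fun x => (f x, g x)) z :=
    hp.continuousOn.continuousAt (inter_mem ht₁ ht₂)
  refine ⟨_, _, inter_mem (inter_mem ht₁ ht₂) (hc.preimage_mem_nhds ht),
    h.comp (hp.mono inter_subset_left) fun x hx => hx.2⟩

/-- Compactness handles pairs in the ball of radius `R + 1`. If only one point is outside, then
either both values vanish or the distance is at least `1`, and the bound `M` suffices. -/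
lemma LocallyLipschitz.exists_lipschitzWith_of_hasCompactSupport [ProperSpace E] {f : E → F}
    (hf : LocallyLipschitz f) (hs : HasCompactSupport f) : ∃ K, LipschitzWith K f := by
  obtain ⟨R, hR⟩ := hs.isCompact.isBounded.subset_closedBall (0 : E)
  obtain ⟨M, hM⟩ := hs.exists_bound_of_continuous hf.continuous
  have hM0 : 0 ≤ M := (norm_nonneg _).trans (hM 0)
  obtain ⟨K, hK⟩ := ((locallyLipschitzOn_univ.2 hf).mono
    (subset_univ (Metric.closedBall (0 : E) (R + 1)))).exists_lipschitzOnWith_of_compact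
    (isCompact_closedBall _ _)
  refine ⟨K + M.toNNReal, LipschitzWith.of_dist_le_mul fun x y => ?_⟩
  have hcoe : ((K + M.toNNReal : ℝ≥0) : ℝ) = K + M := by
    rw [NNReal.coe_add, Real.coe_toNNReal M hM0]
  rw [hcoe]
  have hzero : ∀ x : E, R < ‖x‖ → f x = 0 := by
    intro x hx
    refine image_eq_zero_of_notMem_tsupport fun h => ?_
    have := hR h
    rw [mem_closedBall_zero_iff] at this
    linarith
  have hfar : ∀ x y : E, ‖x‖ ≤ R + 1 → R + 1 < ‖y‖ → dist (f x) (f y) ≤ (K + M) * dist x y := by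
    intro x y hx hy
    rw [hzero y (by linarith), dist_zero_right]
    rcases le_or_gt ‖x‖ R with h | h
    · have h1 : 1 ≤ dist x y := by
        rw [dist_eq_norm_sub']
        linarith [norm_sub_norm_le y x]
      have hK0 : (0 : ℝ) ≤ K := K.2
      nlinarith [hM x]
    · rw [hzero x h, norm_zero]
      positivity
  rcases le_or_gt ‖x‖ (R + 1) with hx | hx <;> rcases le_or_gt ‖y‖ (R + 1) with hy | hy
  · have := hK.dist_le_mul x (by simpa using hx) y (by simpa using hy)
    nlinarith [dist_nonneg (x := x) (y := y)]
  · exact hfar x y hx hy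
  · rw [dist_comm, dist_comm x]
    exact hfar y x hy hx
  · rw [hzero x (by linarith), hzero y (by linarith), dist_self]
    positivity

end LipschitzLemmas

/-! ### Estimates of contact fields and truncation of Hamiltonians -/

namespace J1

variable {n : ℕ}

lemma norm_iteratedFDeriv_clm_comp_le {F G : Type} [NormedAddCommGroup F] [NormedSpace ℝ F]
    [NormedAddCommGroup G] [NormedSpace ℝ G] (ℓ : F →L[ℝ] G) {f : J1 n → F} {i : ℕ} {x : J1 n}
    (hf : ContDiffAt ℝ i f x) {ε : ℝ} (h : ‖iteratedFDeriv ℝ i f x‖ ≤ ε) :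
    ‖iteratedFDeriv ℝ i (fun v => ℓ (f v)) x‖ ≤ ‖ℓ‖ * ε := by
  have h1 : iteratedFDeriv ℝ i (fun v => ℓ (f v)) x = _ :=
    ContinuousLinearMap.iteratedFDeriv_comp_left ℓ hf le_rfl
  rw [h1]
  refine (ContinuousLinearMap.norm_compContinuousMultilinearMap_le _ _).trans ?_
  gcongr

/-- The derivatives of two contact vector fields, at two points, are close if those of the
Hamiltonians are. -/
lemma exists_contactField_estimate (n r : ℕ) (ρ : ℝ) : ∃ C : ℝ, 0 < C ∧ ∀ H G : J1 n → ℝ,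
    ContDiff ℝ (r + 1) H → ContDiff ℝ (r + 1) G → ∀ (y y' : J1 n) (ε m : ℝ), ‖y‖ ≤ ρ →
    (∀ i ≤ r + 1, ‖iteratedFDeriv ℝ i H y - iteratedFDeriv ℝ i G y'‖ ≤ ε) →
    (∀ i ≤ r + 1, ‖iteratedFDeriv ℝ i G y'‖ ≤ m) → ∀ i ≤ r,
    ‖iteratedFDeriv ℝ i (contactField H) y - iteratedFDeriv ℝ i (contactField G) y'‖
      ≤ C * (ε + m * ‖y - y'‖) := by
  set a := ‖contactLin n‖ with ha
  set b := ‖contactBilin n‖ with hb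
  let Eu : ℝ →L[ℝ] J1 n := (ContinuousLinearMap.id ℝ ℝ).smulRight ((0, 1, 0) : J1 n)
  set ρ' := max ρ 1 with hρ'
  have hρ1 : 1 ≤ ρ' := le_max_right _ _
  refine ⟨a + b * (2 ^ r * ρ') + b + ‖Eu‖ + 1, by positivity,
    fun H G hH hG y y' ε m hy hε hm i hi => ?_⟩
  have hε0 : 0 ≤ ε := (norm_nonneg _).trans (hε 0 (Nat.zero_le _))
  have hm0 : 0 ≤ m := (norm_nonneg _).trans (hm 0 (Nat.zero_le _))
  have hir : ((i : ℕ) : WithTop ℕ∞) ≤ r := by exact_mod_cast hi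
  have hDH : ContDiff ℝ r (fderiv ℝ H) := hH.fderiv_right le_rfl
  have hDG : ContDiff ℝ r (fderiv ℝ G) := hG.fderiv_right le_rfl
  have hH0 : ContDiff ℝ r H := hH.of_le le_self_add
  have hG0 : ContDiff ℝ r G := hG.of_le le_self_add
  have sH : ContDiff ℝ r fun v => H (y + v) := hH0.comp (by fun_prop)
  have sG : ContDiff ℝ r fun v => G (y' + v) := hG0.comp (by fun_prop)
  have sDH : ContDiff ℝ r fun v => fderiv ℝ H (y + v) := hDH.comp (by fun_prop)
  have sDG : ContDiff ℝ r fun v => fderiv ℝ G (y' + v) := hDG.comp (by fun_prop)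
  -- Both base points are translated to `v = 0`, so the derivatives at two points become those of
  -- one function there. Only the bilinear part of the field produces a term with `y - y'`.
  set h : J1 n → ℝ := fun v => H (y + v) - G (y' + v) with hh
  set k : J1 n → (J1 n →L[ℝ] ℝ) := fun v => fderiv ℝ H (y + v) - fderiv ℝ G (y' + v) with hk
  set l : J1 n → (J1 n →L[ℝ] ℝ) := fun v => fderiv ℝ G (y' + v) with hl
  have sh : ContDiff ℝ r h := sH.sub sG
  have sk : ContDiff ℝ r k := sDH.sub sDG
  have sX : ContDiff ℝ r fun v => contactField H (y + v) :=
    (contDiff_contactField hH).comp (by fun_prop)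
  have sY : ContDiff ℝ r fun v => contactField G (y' + v) :=
    (contDiff_contactField hG).comp (by fun_prop)
  have hbh : ∀ i ≤ r, ‖iteratedFDeriv ℝ i h 0‖ ≤ ε := by
    intro i hi
    have hir : ((i : ℕ) : WithTop ℕ∞) ≤ r := by exact_mod_cast hi
    rw [hh, fun_iteratedFDeriv_sub_apply (sH.of_le hir).contDiffAt (sG.of_le hir).contDiffAt,
      iteratedFDeriv_comp_add_left, iteratedFDeriv_comp_add_left, add_zero, add_zero]
    exact hε i (by omega)
  have hbk : ∀ i ≤ r, ‖iteratedFDeriv ℝ i k 0‖ ≤ ε := by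
    intro i hi
    have hir : ((i : ℕ) : WithTop ℕ∞) ≤ r := by exact_mod_cast hi
    rw [hk, fun_iteratedFDeriv_sub_apply (sDH.of_le hir).contDiffAt (sDG.of_le hir).contDiffAt,
      iteratedFDeriv_comp_add_left, iteratedFDeriv_comp_add_left, add_zero, add_zero,
      ← norm_iteratedFDeriv_succ_sub]
    exact hε (i + 1) (by omega)
  have hbl : ‖iteratedFDeriv ℝ i l 0‖ ≤ m := by
    rw [hl, iteratedFDeriv_comp_add_left, add_zero, norm_iteratedFDeriv_fderiv]
    exact hm (i + 1) (by omega)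
  have hby : ∀ i ≤ r, ‖iteratedFDeriv ℝ i (fun v : J1 n => v + y) 0‖ ≤ ρ' := by
    intro i hi
    rcases Nat.eq_zero_or_pos i with rfl | hpos
    · rw [norm_iteratedFDeriv_zero, zero_add]
      exact hy.trans (le_max_left _ _)
    · exact (norm_iteratedFDeriv_affine_le (ContinuousLinearMap.id ℝ (J1 n))
        ContinuousLinearMap.norm_id_le y hpos 0).trans hρ1
  have e1 : iteratedFDeriv ℝ i (contactField H) y - iteratedFDeriv ℝ i (contactField G) y' =
      iteratedFDeriv ℝ i (fun v => contactField H (y + v) - contactField G (y' + v)) 0 := by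
    rw [fun_iteratedFDeriv_sub_apply (sX.of_le hir).contDiffAt (sY.of_le hir).contDiffAt,
      iteratedFDeriv_comp_add_left, iteratedFDeriv_comp_add_left, add_zero, add_zero]
  have e2 : (fun v => contactField H (y + v) - contactField G (y' + v)) = fun v =>
      contactLin n (k v) + contactBilin n (v + y) (k v) + contactBilin n (y - y') (l v) -
        Eu (h v) := by
    funext v
    rw [contactField_eq, contactField_eq]
    simp only [hk, hl, hh, map_sub, map_add, sub_apply, add_apply, Eu,
      ContinuousLinearMap.smulRight_apply, ContinuousLinearMap.id_apply]
    abel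
  have c1 : ContDiff ℝ r fun v => contactLin n (k v) := by fun_prop
  have c2 : ContDiff ℝ r fun v => contactBilin n (v + y) (k v) := by fun_prop
  have c3 : ContDiff ℝ r fun v => contactBilin n (y - y') (l v) := by fun_prop
  have c4 : ContDiff ℝ r fun v => Eu (h v) := by fun_prop
  have b1 := norm_iteratedFDeriv_clm_comp_le (contactLin n) (sk.of_le hir).contDiffAt (hbk i hi)
  have b2 := norm_iteratedFDeriv_bilinear_le (contactBilin n) (f := fun v : J1 n => v + y)
    (N := r) (by fun_prop) sk 0 hir (a := ρ') (b := ε) (fun j hj => hby j (by omega))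
    (fun j hj => hbk j (by omega))
  have b3 := norm_iteratedFDeriv_clm_comp_le (contactBilin n (y - y'))
    (sDG.of_le hir).contDiffAt hbl
  have b4 := norm_iteratedFDeriv_clm_comp_le Eu (sh.of_le hir).contDiffAt (hbh i hi)
  rw [e1, e2, fun_iteratedFDeriv_sub_apply (((c1.add c2).add c3).of_le hir).contDiffAt
    (c4.of_le hir).contDiffAt, fun_iteratedFDeriv_add_apply ((c1.add c2).of_le hir).contDiffAt
    (c3.of_le hir).contDiffAt, fun_iteratedFDeriv_add_apply (c1.of_le hir).contDiffAt
    (c2.of_le hir).contDiffAt]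
  have h2i : (2 : ℝ) ^ i ≤ 2 ^ r := pow_le_pow_right₀ one_le_two hi
  have b2' : b * (2 ^ i * (ρ' * ε)) ≤ b * (2 ^ r * ρ') * ε := by
    have : b * (2 ^ r * ρ') * ε = b * (2 ^ r * (ρ' * ε)) := by ring
    rw [this]
    gcongr
  have b3' : ‖contactBilin n (y - y')‖ * m ≤ b * (m * ‖y - y'‖) := by
    calc ‖contactBilin n (y - y')‖ * m ≤ (b * ‖y - y'‖) * m := by
          gcongr
          exact ContinuousLinearMap.le_opNorm _ _
      _ = b * (m * ‖y - y'‖) := by ring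
  refine (norm_sub_le _ _).trans ((add_le_add ((norm_add_le _ _).trans (add_le_add
    ((norm_add_le _ _).trans (add_le_add b1 (b2.trans b2'))) (b3.trans b3'))) b4).trans ?_)
  set q := m * ‖y - y'‖ with hq
  have hq0 : 0 ≤ q := by positivity
  have hb0 : 0 ≤ b := norm_nonneg _
  have ha0 : 0 ≤ a := norm_nonneg _
  have p1 : 0 ≤ a * q := by positivity
  have p2 : 0 ≤ b * (2 ^ r * ρ') * q := by positivity
  have p3 : 0 ≤ ‖Eu‖ * q := by positivity
  have p4 : 0 ≤ b * ε := by positivity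
  nlinarith

/-- A Hamiltonian that is regular near a compact set agrees there with a regular Hamiltonian of
compact support. -/
lemma exists_truncation {r : ℕ} {U : Set (J1 n)} (hU : IsCompact U) {H : J1 n → ℝ}
    (hH : RegularNear r U H) : ∃ (H' : J1 n → ℝ) (V : Set (J1 n)) (L : ℝ≥0), IsOpen V ∧ U ⊆ V ∧
      EqOn H' H V ∧ ContDiff ℝ (r + 1) H' ∧ HasCompactSupport H' ∧
      LipschitzWith L (contactField H') := by
  obtain ⟨V, hV, hUV, hHV, hLip⟩ := hH
  obtain ⟨S, hS, hUS, hSV⟩ := exists_compact_between hU hV hUV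
  obtain ⟨χ, hχ1, hχ0, -⟩ := exists_contMDiffMap_one_nhds_of_subset_interior
    (modelWithCornersSelf ℝ (J1 n)) (n := ⊤) hU.isClosed hUS
  have hχ : ContDiff ℝ ∞ χ := χ.contMDiff.contDiff
  have hχS : tsupport χ ⊆ S := closure_minimal (fun x hx => by
    by_contra h
    exact hx (hχ0 x h)) hS.isClosed
  have hχc : HasCompactSupport χ := hS.of_isClosed_subset (isClosed_tsupport _) hχS
  obtain ⟨O, hO, hUO, hO1⟩ := eventually_nhdsSet_iff_exists.1 hχ1
  set H' : J1 n → ℝ := fun z => χ z * H z with hH'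
  have hzero : ∀ z ∉ tsupport χ, H' =ᶠ[𝓝 z] fun _ => 0 := by
    intro z hz
    filter_upwards [notMem_tsupport_iff_eventuallyEq.1 hz] with y hy
    simp [hH', hy]
  have hsm : ContDiff ℝ (r + 1) H' := by
    rw [contDiff_iff_contDiffAt]
    intro z
    by_cases hz : z ∈ tsupport χ
    · exact ((hχ.of_le (by exact_mod_cast le_top)).contDiffAt).mul
        (hHV.contDiffAt (hV.mem_nhds (hSV (hχS hz))))
    · exact contDiffAt_const.congr_of_eventuallyEq (hzero z hz)
  have hcs : HasCompactSupport H' := hχc.mul_right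
  -- For `r = 0` differentiability of `H` does not give this. It follows from the assumption on the
  -- field of `H`, since `X_{χH}` is `χ X_H` plus `H` times a smooth field.
  have hll : LocallyLipschitz (contactField H') := by
    intro z
    by_cases hz : z ∈ tsupport χ
    · have hzV : z ∈ V := hSV (hχS hz)
      have hQ : ContDiff ℝ ∞ fun z => contactLin n (fderiv ℝ χ z) +
          contactBilin n z (fderiv ℝ χ z) := by
        have : ContDiff ℝ ∞ (fderiv ℝ χ) := hχ.fderiv_right (by simp)
        fun_prop
      have h1 := exists_lipschitzOnWith_smul
        ((hχ.of_le (by norm_cast) : ContDiff ℝ 1 χ).contDiffAt (x := z)).exists_lipschitzOnWith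
        (g := contactField H) (by
          obtain ⟨K, t, ht, h⟩ := hLip hzV
          exact ⟨K, t, by rwa [hV.nhdsWithin_eq hzV] at ht, h⟩)
      have h2 := exists_lipschitzOnWith_smul (f := H) (z := z)
        (((hHV.of_le (by simp)).contDiffAt (hV.mem_nhds hzV)).exists_lipschitzOnWith)
        ((hQ.of_le (by norm_cast) : ContDiff ℝ 1 _).contDiffAt (x := z)).exists_lipschitzOnWith
      obtain ⟨K₁, t₁, ht₁, h1⟩ := h1
      obtain ⟨K₂, t₂, ht₂, h2⟩ := h2
      have h3 := (h1.mono (inter_subset_left (t := t₂))).add (h2.mono (inter_subset_right (s := t₁)))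
      refine ⟨K₁ + K₂, V ∩ (t₁ ∩ t₂), inter_mem (hV.mem_nhds hzV) (inter_mem ht₁ ht₂), ?_⟩
      intro x hx y hy
      have e : ∀ x ∈ V, contactField H' x = χ x • contactField H x +
          H x • (contactLin n (fderiv ℝ χ x) + contactBilin n x (fderiv ℝ χ x)) := by
        intro x hx
        have hd : fderiv ℝ H' x = χ x • fderiv ℝ H x + H x • fderiv ℝ χ x :=
          fderiv_mul (hχ.differentiable (by simp) x)
            ((hHV.contDiffAt (hV.mem_nhds hx)).differentiableAt (by simp))
        rw [contactField_eq, contactField_eq, hd]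
        simp only [hH', map_add, map_smul]
        module
      rw [e x hx.1, e y hy.1]
      exact h3 hx.2 hy.2
    · have hmem : (tsupport χ)ᶜ ∈ 𝓝 z := (isClosed_tsupport _).isOpen_compl.mem_nhds hz
      refine ⟨0, _, hmem, fun x hx y hy => ?_⟩
      have e : ∀ x ∉ tsupport χ, contactField H' x = 0 := fun x hx =>
        contactField_eq_zero fun h => hx (tsupport_mul_subset_left h)
      rw [e x hx, e y hy, edist_self]
      simp
  obtain ⟨L, hL⟩ := hll.exists_lipschitzWith_of_hasCompactSupport
    (hasCompactSupport_contactField hcs)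
  exact ⟨H', O, L, hO, hUO, fun z hz => by simp [hH', hO1 z hz], hsm, hcs, hL⟩

end J1

/-! ### Uniform bounds under compact support -/

section Bounds

variable {E F : Type*} [NormedAddCommGroup E] [NormedSpace ℝ E] [NormedAddCommGroup F]
  [NormedSpace ℝ F]

lemma exists_bound_iteratedFDeriv_of_hasCompactSupport {f : E → F} (hs : HasCompactSupport f) {r : ℕ}
    (hf : ContDiff ℝ r f) : ∃ M, 0 ≤ M ∧ ∀ i ≤ r, ∀ z, ‖iteratedFDeriv ℝ i f z‖ ≤ M := by
  have h : ∀ i : Fin (r + 1), ∃ M, ∀ z, ‖iteratedFDeriv ℝ i f z‖ ≤ M := fun i =>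
    (hs.iteratedFDeriv i).exists_bound_of_continuous
      (hf.continuous_iteratedFDeriv (by exact_mod_cast Nat.lt_succ_iff.1 i.2))
  choose M hM using h
  refine ⟨∑ i, |M i|, Finset.sum_nonneg fun _ _ => abs_nonneg _, fun i hi z => ?_⟩
  exact (hM ⟨i, by omega⟩ z).trans ((le_abs_self _).trans
    (Finset.single_le_sum (f := fun i => |M i|) (fun _ _ => abs_nonneg _) (Finset.mem_univ _)))

lemma exists_lipschitz_iteratedFDeriv_of_hasCompactSupport {f : E → F} (hs : HasCompactSupport f)
    {r : ℕ} (hf : ContDiff ℝ (r + 1) f) : ∃ L : ℝ, 0 ≤ L ∧ ∀ i ≤ r, ∀ y z,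
      ‖iteratedFDeriv ℝ i f y - iteratedFDeriv ℝ i f z‖ ≤ L * ‖y - z‖ := by
  have h : ∀ i : Fin (r + 1), ∃ K, LipschitzWith K (iteratedFDeriv ℝ i f) := fun i =>
    (hf.iteratedFDeriv_right (m := 1) (by
      rw [add_comm]
      have := Nat.lt_succ_iff.1 i.2
      gcongr)).lipschitzWith_of_hasCompactSupport (hs.iteratedFDeriv i) one_ne_zero
  choose K hK using h
  refine ⟨∑ i, (K i : ℝ), Finset.sum_nonneg fun i _ => (K i).2, fun i hi y z => ?_⟩
  have h1 := (hK ⟨i, by omega⟩).dist_le_mul y z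
  rw [dist_eq_norm, dist_eq_norm] at h1
  refine h1.trans ?_
  gcongr
  exact Finset.single_le_sum (f := fun i => (K i : ℝ)) (fun i _ => (K i).2) (Finset.mem_univ _)

end Bounds

/-! ### Comparison of contact flows -/

namespace J1

variable {n : ℕ}

/-- The flow of `H` and that of a surrogate `G` are close in `C^r` along trajectories in `U` if
`H` and `G` are close in `C^{r+1}(U)`, and their top derivatives are close along the two
trajectories. -/
theorem exists_contact_comparison {r : ℕ} {U : Set (J1 n)} (hU : IsCompact U) (T : ℝ)
    {H : J1 n → ℝ} (hH : ContDiff ℝ (r + 1) H) (hHs : HasCompactSupport H) {L : ℝ≥0}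
    (hL : LipschitzWith L (contactField H)) {Φ : ℝ → J1 n → J1 n}
    (hΦ : IsGlobalFlow (contactField H) Φ) (B : ℝ) (hB : 0 ≤ B) :
    ∃ C : ℝ, 0 < C ∧ ∀ (G : J1 n → ℝ) (X : J1 n → J1 n) (Ψ : ℝ → J1 n → J1 n) (L' : ℝ≥0)
      (W : Set (J1 n)) (ε : ℝ), ContDiff ℝ ∞ G → ContDiff ℝ ∞ X → LipschitzWith L' X →
      IsGlobalFlow X Ψ → IsOpen W → U ⊆ W → EqOn X (contactField G) W → ε ≤ B →
      (∀ i ≤ r + 1, ∀ y ∈ U, ‖iteratedFDeriv ℝ i H y - iteratedFDeriv ℝ i G y‖ ≤ ε) →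
      ∀ z, (∀ t ∈ Icc 0 T, Φ t z ∈ U) → (∀ t ∈ Icc 0 T, Ψ t z ∈ U) →
      (∀ t ∈ Icc 0 T, ‖Φ t z - Ψ t z‖ ≤ C * ε) ∧
      ∀ η, (∀ t ∈ Icc 0 T,
          ‖iteratedFDeriv ℝ (r + 1) H (Φ t z) - iteratedFDeriv ℝ (r + 1) G (Ψ t z)‖ ≤ η) →
        ∀ t ∈ Icc 0 T, ∀ i ≤ r,
          ‖iteratedFDeriv ℝ i (Φ t) z - iteratedFDeriv ℝ i (Ψ t) z‖ ≤ C * (ε + η) := by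
  obtain ⟨ρ, hρ⟩ := hU.isBounded.subset_closedBall (0 : J1 n)
  have hρ' : ∀ y ∈ U, ‖y‖ ≤ ρ := fun y hy => by simpa using hρ hy
  obtain ⟨CU, hCU, hest⟩ := exists_contactField_estimate n r ρ
  have hXH : ContDiff ℝ r (contactField H) := contDiff_contactField hH
  obtain ⟨MH, hMH, hMHb⟩ := exists_bound_iteratedFDeriv_of_hasCompactSupport hHs (r := r + 1)
    (by exact_mod_cast hH)
  obtain ⟨MX, hMX, hMXb⟩ :=
    exists_bound_iteratedFDeriv_of_hasCompactSupport (hasCompactSupport_contactField hHs) hXH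
  obtain ⟨LH, hLH, hLHb⟩ := exists_lipschitz_iteratedFDeriv_of_hasCompactSupport hHs hH
  -- `M` bounds the derivatives of the field of `H`, and on `U` also those of the surrogate field,
  -- which enters only through `B`. Hence the constants do not depend on the surrogate.
  set M := MX + CU * B with hM
  have hM0 : 0 ≤ M := by positivity
  obtain ⟨C₂, hC₂, hcomp⟩ := exists_flow_comparison (J1 n) r M T hM0
  set C₀ := CU * Real.exp ((L + 1) * T) with hC₀
  have hC₀0 : 0 < C₀ := by positivity
  set C₁ := C₂ * (CU * (LH * C₀ + 1 + (MH + B) * C₀)) with hC₁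
  have hC₁0 : 0 ≤ C₁ := by positivity
  refine ⟨C₀ + C₁, by positivity,
    fun G X Ψ L' W ε hG hX hL' hΨ hW hUW hXG hεB hε z hΦU hΨU => ?_⟩
  have hG1 : ContDiff ℝ (r + 1) G := hG.of_le (by exact_mod_cast le_top)
  rcases lt_or_ge T 0 with hT | hT
  · rw [Icc_eq_empty (not_le.2 hT)]
    exact ⟨fun t ht => absurd ht (notMem_empty t), fun η _ t ht => absurd ht (notMem_empty t)⟩
  have hε0 : 0 ≤ ε := (norm_nonneg _).trans (hε 0 (Nat.zero_le _) _ (hΦU 0 ⟨le_rfl, hT⟩))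
  have hXeq : ∀ y ∈ U, ∀ i, iteratedFDeriv ℝ i X y = iteratedFDeriv ℝ i (contactField G) y :=
    fun y hy i => ((hXG.eventuallyEq_of_mem (hW.mem_nhds (hUW hy))).iteratedFDeriv ℝ i).eq_of_nhds
  have hGm : ∀ y ∈ U, ∀ i ≤ r + 1, ‖iteratedFDeriv ℝ i G y‖ ≤ MH + B := by
    intro y hy i hi
    have h1 := norm_le_norm_add_norm_sub (iteratedFDeriv ℝ i H y) (iteratedFDeriv ℝ i G y)
    linarith [hMHb i hi y, hε i hi y hy]
  have hsame : ∀ y ∈ U, ∀ i ≤ r,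
      ‖iteratedFDeriv ℝ i (contactField H) y - iteratedFDeriv ℝ i X y‖ ≤ CU * ε := by
    intro y hy i hi
    have := hest H G hH hG1 y y ε (MH + B) (hρ' y hy) (fun i hi => hε i hi y hy) (hGm y hy) i hi
    rw [sub_self, norm_zero, mul_zero, add_zero] at this
    rwa [hXeq y hy]
  -- The difference is split so that only the Lipschitz constant of the field of `H` occurs, not
  -- that of `X`. Taking `L + 1` avoids the degenerate Gronwall bound at `L = 0`.
  have hclose : ∀ t ∈ Icc 0 T, ‖Φ t z - Ψ t z‖ ≤ C₀ * ε := by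
    intro t ht
    have hg := norm_le_gronwallBound_of_norm_deriv_right_le (a := 0) (b := T) (δ := 0)
      (K := (L : ℝ) + 1) (ε := CU * ε) (f := fun t => Φ t z - Ψ t z)
      (f' := fun t => contactField H (Φ t z) - X (Ψ t z))
      ((hΦ.continuous_curve z).sub (hΨ.continuous_curve z)).continuousOn
      (fun s _ => ((hΦ.deriv z s).sub (hΨ.deriv z s)).hasDerivWithinAt)
      (by rw [hΦ.zero, hΨ.zero, sub_self, norm_zero])
      (fun s hs => by
        have hs' := Ico_subset_Icc_self hs
        have h1 := hsame _ (hΨU s hs') 0 (Nat.zero_le r)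
        rw [iteratedFDeriv_zero_eq_comp, iteratedFDeriv_zero_eq_comp, Function.comp_apply,
          Function.comp_apply, ← map_sub, LinearIsometryEquiv.norm_map] at h1
        have h2 := hL.dist_le_mul (Φ s z) (Ψ s z)
        rw [dist_eq_norm, dist_eq_norm] at h2
        have h3 := norm_sub_le_norm_sub_add_norm_sub (contactField H (Φ s z))
          (contactField H (Ψ s z)) (X (Ψ s z))
        linarith [norm_nonneg (Φ s z - Ψ s z)]) t ht
    refine hg.trans ?_
    have hL1 : (0 : ℝ) < L + 1 := by positivity
    rw [gronwallBound_of_K_ne_0 hL1.ne']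
    simp only [zero_mul, zero_add, sub_zero]
    have he : Real.exp ((L + 1) * t) ≤ Real.exp ((L + 1) * T) := by
      gcongr
      exact ht.2
    have he1 : 0 ≤ Real.exp ((L + 1) * t) - 1 := by
      have : 0 ≤ ((L : ℝ) + 1) * t := mul_nonneg hL1.le ht.1
      linarith [Real.one_le_exp this]
    have hdiv : CU * ε / (L + 1) ≤ CU * ε :=
      div_le_self (by positivity) (by linarith [L.coe_nonneg])
    calc CU * ε / (L + 1) * (Real.exp ((L + 1) * t) - 1)
        ≤ CU * ε * Real.exp ((L + 1) * T) := by
          gcongr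
          linarith
      _ = C₀ * ε := by rw [hC₀]; ring
  refine ⟨fun t ht => (hclose t ht).trans ?_, fun η hη t ht i hi => ?_⟩
  · gcongr
    linarith
  have hη0 : 0 ≤ η := (norm_nonneg _).trans (hη t ht)
  -- Derivatives of `H` of order at most `r` are Lipschitz, so the distance of the trajectories
  -- controls their change; the top order is what `η` accounts for.
  have hfield : ∀ s ∈ Icc 0 T, ∀ i ≤ r,
      ‖iteratedFDeriv ℝ i (contactField H) (Φ s z) - iteratedFDeriv ℝ i X (Ψ s z)‖ ≤
        CU * (LH * C₀ + 1 + (MH + B) * C₀) * (ε + η) := by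
    intro s hs i hi
    have hd := hclose s hs
    have h1 := hest H G hH hG1 (Φ s z) (Ψ s z) (LH * (C₀ * ε) + ε + η) (MH + B)
      (hρ' _ (hΦU s hs)) (fun i hi => by
        rcases Nat.lt_or_ge r i with h | h
        · obtain rfl : i = r + 1 := by omega
          have : 0 ≤ LH * (C₀ * ε) := by positivity
          linarith [hη s hs]
        · have h2 := norm_sub_le_norm_sub_add_norm_sub (iteratedFDeriv ℝ i H (Φ s z))
            (iteratedFDeriv ℝ i H (Ψ s z)) (iteratedFDeriv ℝ i G (Ψ s z))
          have h3 := hLHb i h (Φ s z) (Ψ s z)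
          have h4 : LH * ‖Φ s z - Ψ s z‖ ≤ LH * (C₀ * ε) := by gcongr
          linarith [hε i hi _ (hΨU s hs)])
      (hGm _ (hΨU s hs)) i hi
    rw [hXeq _ (hΨU s hs)]
    refine h1.trans ?_
    have h5 : (MH + B) * ‖Φ s z - Ψ s z‖ ≤ (MH + B) * (C₀ * ε) := by gcongr
    have h6 : 0 ≤ LH * C₀ * η := by positivity
    have h7 : 0 ≤ (MH + B) * C₀ * η := by positivity
    have h8 : (LH * C₀ + 1 + (MH + B) * C₀) * (ε + η) = LH * (C₀ * ε) + ε + η +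
        (MH + B) * (C₀ * ε) + LH * C₀ * η + (MH + B) * C₀ * η := by ring
    rw [mul_assoc CU (LH * C₀ + 1 + (MH + B) * C₀), h8]
    exact mul_le_mul_of_nonneg_left (by linarith) hCU.le
  have h1 := hcomp (contactField H) X Φ Ψ L L' hΦ hΨ hL hL' hXH
    (hX.of_le (by exact_mod_cast le_top)) z _
    (fun s hs i _ hi => (hMXb i hi _).trans (by
      have : 0 ≤ CU * B := by positivity
      linarith))
    (fun s hs i _ hi => by
      have h2 := norm_le_norm_add_norm_sub (iteratedFDeriv ℝ i (contactField H) (Ψ s z))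
        (iteratedFDeriv ℝ i X (Ψ s z))
      have h3 := hsame _ (hΨU s hs) i hi
      have h4 : CU * ε ≤ CU * B := by gcongr
      linarith [hMXb i hi (Ψ s z)])
    hfield t ht i hi
  refine h1.trans ?_
  rw [← mul_assoc]
  have : 0 ≤ ε + η := by positivity
  gcongr
  linarith

end J1

/-! ### Error estimates in `C^r` norms -/

namespace J1

variable {n : ℕ}

section CNorm

variable {F : Type*} [NormedAddCommGroup F] [NormedSpace ℝ F] {r : ℕ} {U : Set (J1 n)}
  {f : J1 n → F}

lemma cNorm_le {c : ℝ≥0∞} (h : ∀ k ≤ r, ∀ z ∈ U, ‖iteratedFDeriv ℝ k f z‖ₑ ≤ c) :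
    cNorm r U f ≤ c :=
  iSup_le fun k => iSup_le fun hk => iSup_le fun z => iSup_le fun hz => h k hk z hz

lemma cNorm_le_ofReal {c : ℝ} (h : ∀ k ≤ r, ∀ z ∈ U, ‖iteratedFDeriv ℝ k f z‖ ≤ c) :
    cNorm r U f ≤ ENNReal.ofReal c := by
  refine cNorm_le fun k hk z hz => ?_
  rw [← ofReal_norm]
  exact ENNReal.ofReal_le_ofReal (h k hk z hz)

lemma enorm_iteratedFDeriv_le_cNorm {k : ℕ} (hk : k ≤ r) {z : J1 n} (hz : z ∈ U) :
    ‖iteratedFDeriv ℝ k f z‖ₑ ≤ cNorm r U f :=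
  le_iSup_of_le k (le_iSup_of_le hk (le_iSup_of_le z (le_iSup_of_le hz le_rfl)))

lemma norm_iteratedFDeriv_le_cNorm (hf : cNorm r U f ≠ ⊤) {k : ℕ} (hk : k ≤ r) {z : J1 n}
    (hz : z ∈ U) : ‖iteratedFDeriv ℝ k f z‖ ≤ (cNorm r U f).toReal := by
  have h := ENNReal.toReal_mono hf (enorm_iteratedFDeriv_le_cNorm (f := f) hk hz)
  rwa [toReal_enorm] at h

end CNorm

/-- `Φ` is the complete flow of a smooth vector field that agrees with the contact vector field of
`G` on the neighbourhood `W` of `U`. -/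
structure IsExtendedFlow (G : J1 n → ℝ) (U W : Set (J1 n)) (X : J1 n → J1 n)
    (Φ : ℝ → J1 n → J1 n) (L : ℝ≥0) : Prop where
  smooth_ham : ContDiff ℝ ∞ G
  smooth : ContDiff ℝ ∞ X
  lipschitz : LipschitzWith L X
  flow : IsGlobalFlow X Φ
  isOpen : IsOpen W
  subset : U ⊆ W
  eqOn : EqOn X (contactField G) W

/-- Near the initial values, a confined flow agrees with the complete flow of any Lipschitz
vector field that extends the given one. -/
lemma IsConfinedFlow.eventually_eq {Y X : J1 n → J1 n} {K U V : Set (J1 n)} {T : ℝ}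
    {Ψ Φ : ℝ → J1 n → J1 n} {L : ℝ≥0} (h : IsConfinedFlow Y K U T Ψ) (hV : IsOpen V) (hUV : U ⊆ V)
    (hΦ : IsGlobalFlow X Φ) (hL : LipschitzWith L X) (hXY : EqOn X Y V) {z : J1 n} (hz : z ∈ K) :
    ∀ᶠ y in 𝓝 z, ∀ t ∈ Icc 0 T, Ψ t y = Φ t y :=
  hΦ.eventually_eq_of_confined hL hV hXY (h.flow.filter_mono (nhds_le_nhdsSet hz))
    fun t ht => hUV (h.mem z hz t ht)

/-- The data of the comparison of the flow of `H` with flows of surrogates: the derivatives of the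
flows differ by at most `Capp B * ‖H - G‖`, and by at most `ε` if `‖H - G‖ < δ ε`. -/
structure IsSurrogateEstimate (r : ℕ) (U : Set (J1 n)) (T : ℝ) (H : J1 n → ℝ) (Capp : ℝ≥0 → ℝ)
    (δ : ℝ → ℝ) (Φ : ℝ → J1 n → J1 n) : Prop where
  contDiff : ∀ t ∈ Icc 0 T, ContDiff ℝ r (Φ t)
  eventually_eq : ∀ K ΦH, IsConfinedFlow (contactField H) K U T ΦH → ∀ z ∈ K,
    ∀ᶠ y in 𝓝 z, ∀ t ∈ Icc 0 T, ΦH t y = Φ t y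
  lipschitz_estimate : ∀ (B : ℝ≥0) G W X Ψ L, IsExtendedFlow G U W X Ψ L →
    cNorm (r + 1) U (fun z => H z - G z) ≤ B →
    (LipschitzOnWith B (iteratedFDeriv ℝ (r + 1) H) U ∨
      LipschitzOnWith B (iteratedFDeriv ℝ (r + 1) G) U) →
    ∀ z, (∀ t ∈ Icc 0 T, Φ t z ∈ U) → (∀ t ∈ Icc 0 T, Ψ t z ∈ U) → ∀ t ∈ Icc 0 T, ∀ i ≤ r,
      ‖iteratedFDeriv ℝ i (Φ t) z - iteratedFDeriv ℝ i (Ψ t) z‖ ≤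
        Capp B * (cNorm (r + 1) U fun z => H z - G z).toReal
  estimate : ∀ ε > 0, ∀ G W X Ψ L, IsExtendedFlow G U W X Ψ L →
    cNorm (r + 1) U (fun z => H z - G z) < ENNReal.ofReal (δ ε) →
    ∀ z, (∀ t ∈ Icc 0 T, Φ t z ∈ U) → (∀ t ∈ Icc 0 T, Ψ t z ∈ U) → ∀ t ∈ Icc 0 T, ∀ i ≤ r,
      ‖iteratedFDeriv ℝ i (Φ t) z - iteratedFDeriv ℝ i (Ψ t) z‖ ≤ ε

/-- A compactly supported truncation of `H` has a complete flow, so `Φ` and all constants are fixed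
before `K` and the surrogate. A Lipschitz bound on the top derivative makes `η` proportional to the
distance of the Hamiltonians; otherwise uniform continuity of the top derivative of the truncation
provides `δ`. -/
lemma exists_isSurrogateEstimate {r : ℕ} {U : Set (J1 n)} (hU : IsCompact U) {T : ℝ}
    {H : J1 n → ℝ} (hH : RegularNear r U H) :
    ∃ Capp δ Φ, (∀ B, 0 < Capp B) ∧ (∀ ε, 0 < δ ε) ∧ IsSurrogateEstimate r U T H Capp δ Φ := by
  obtain ⟨H', V, L, hV, hUV, hHH', hH', hHs, hL⟩ := exists_truncation hU hH
  have hX : ContDiff ℝ r (contactField H') := contDiff_contactField hH'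
  obtain ⟨M, hM⟩ := (hasCompactSupport_contactField hHs).exists_bound_of_continuous hX.continuous
  obtain ⟨Φ, hΦ⟩ := exists_isGlobalFlow hL hM
  have hnear : ∀ y ∈ V, H' =ᶠ[𝓝 y] H := fun y hy => hHH'.eventuallyEq_of_mem (hV.mem_nhds hy)
  have hiter : ∀ y ∈ U, ∀ i, iteratedFDeriv ℝ i H' y = iteratedFDeriv ℝ i H y := fun y hy i =>
    ((hnear y (hUV hy)).iteratedFDeriv ℝ i).eq_of_nhds
  have hdiff : ∀ G : J1 n → ℝ, ContDiff ℝ ∞ G → cNorm (r + 1) U (fun z => H z - G z) ≠ ⊤ →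
      ∀ i ≤ r + 1, ∀ y ∈ U, ‖iteratedFDeriv ℝ i H' y - iteratedFDeriv ℝ i G y‖ ≤
        (cNorm (r + 1) U fun z => H z - G z).toReal := by
    intro G hG hfin i hi y hy
    have hle : ((i : ℕ) : WithTop ℕ∞) ≤ r + 1 := by exact_mod_cast hi
    rw [← fun_iteratedFDeriv_sub_apply (hH'.of_le hle).contDiffAt
      (hG.of_le (by exact_mod_cast le_top)).contDiffAt]
    have e : (fun z => H' z - G z) =ᶠ[𝓝 y] fun z => H z - G z := by
      filter_upwards [hnear y (hUV hy)] with x hx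
      rw [hx]
    rw [(e.iteratedFDeriv ℝ i).eq_of_nhds]
    exact norm_iteratedFDeriv_le_cNorm hfin hi hy
  choose C hC hcomp using fun B : ℝ≥0 =>
    exists_contact_comparison hU T hH' hHs hL hΦ (B : ℝ) B.2
  have hδ : ∀ ε : ℝ, ∃ δ : ℝ, 0 < δ ∧ (0 < ε → ∀ G W X Ψ L, IsExtendedFlow G U W X Ψ L →
      cNorm (r + 1) U (fun z => H z - G z) < ENNReal.ofReal δ →
      ∀ z, (∀ t ∈ Icc 0 T, Φ t z ∈ U) → (∀ t ∈ Icc 0 T, Ψ t z ∈ U) → ∀ t ∈ Icc 0 T, ∀ i ≤ r,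
        ‖iteratedFDeriv ℝ i (Φ t) z - iteratedFDeriv ℝ i (Ψ t) z‖ ≤ ε) := by
    intro ε
    by_cases hε : 0 < ε
    swap
    · exact ⟨1, one_pos, fun h => absurd h hε⟩
    have hunif := (hHs.iteratedFDeriv (𝕜 := ℝ) (r + 1)).uniformContinuous_of_continuous
      (hH'.continuous_iteratedFDeriv (by exact_mod_cast le_rfl))
    have hC1 := hC 1
    obtain ⟨δ₁, hδ₁, hunif⟩ := Metric.uniformContinuous_iff.1 hunif (ε / (3 * C 1)) (by positivity)
    -- The first bound permits `B = 1`, the second keeps the trajectories within the modulus of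
    -- continuity, and the third makes each of the three contributions at most `ε / 3`.
    refine ⟨min 1 (min (δ₁ / C 1) (ε / (3 * C 1))), by positivity, fun _ G W X Ψ L' hG hlt z h1 h2 => ?_⟩
    have hfin : cNorm (r + 1) U (fun z => H z - G z) ≠ ⊤ := (hlt.trans ENNReal.ofReal_lt_top).ne
    set ε' := (cNorm (r + 1) U fun z => H z - G z).toReal with hε'
    have hε'0 : 0 ≤ ε' := ENNReal.toReal_nonneg
    have hlt' : ε' < min 1 (min (δ₁ / C 1) (ε / (3 * C 1))) :=
      (ENNReal.lt_ofReal_iff_toReal_lt hfin).1 hlt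
    have l1 : ε' < 1 := hlt'.trans_le (min_le_left _ _)
    have l2 : ε' < δ₁ / C 1 := hlt'.trans_le ((min_le_right _ _).trans (min_le_left _ _))
    have l3 : ε' < ε / (3 * C 1) := hlt'.trans_le ((min_le_right _ _).trans (min_le_right _ _))
    obtain ⟨ha, hb⟩ := hcomp 1 G X Ψ L' W ε' hG.smooth_ham hG.smooth hG.lipschitz hG.flow hG.isOpen
      hG.subset hG.eqOn (by simpa using l1.le) (hdiff G hG.smooth_ham hfin) z h1 h2
    have hb' := hb (ε / (3 * C 1) + ε') fun t ht => by
      have e1 : dist (Φ t z) (Ψ t z) < δ₁ := by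
        rw [dist_eq_norm]
        refine (ha t ht).trans_lt ?_
        rwa [lt_div_iff₀ hC1, mul_comm] at l2
      have e2 := hunif e1
      rw [dist_eq_norm] at e2
      have e3 := hdiff G hG.smooth_ham hfin (r + 1) le_rfl _ (h2 t ht)
      have e4 := norm_sub_le_norm_sub_add_norm_sub (iteratedFDeriv ℝ (r + 1) H' (Φ t z))
        (iteratedFDeriv ℝ (r + 1) H' (Ψ t z)) (iteratedFDeriv ℝ (r + 1) G (Ψ t z))
      linarith
    intro t ht i hi
    refine (hb' t ht i hi).trans ?_
    calc C 1 * (ε' + (ε / (3 * C 1) + ε'))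
        ≤ C 1 * (ε / (3 * C 1) + (ε / (3 * C 1) + ε / (3 * C 1))) := by gcongr
      _ = ε := by
        field_simp
        ring
  choose δ hδ0 hδ using hδ
  refine ⟨fun B => C B * (2 + B * C B), δ, Φ, fun B => mul_pos (hC B) (by
    have := hC B
    positivity), hδ0, fun t ht => (hΦ.contDiff_of_nat hL hX (T := T) t ht).1,
    fun K ΦH hK z hz => hK.eventually_eq hV hUV hΦ hL
      (fun y hy => contactField_congr (hnear y hy)) hz, ?_, fun ε hε => hδ ε hε⟩
  intro B G W X Ψ L' hG hB hLip z h1 h2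
  have hfin : cNorm (r + 1) U (fun z => H z - G z) ≠ ⊤ := (hB.trans_lt ENNReal.coe_lt_top).ne
  have hεB : (cNorm (r + 1) U fun z => H z - G z).toReal ≤ B := by
    have := ENNReal.toReal_mono ENNReal.coe_ne_top hB
    simpa using this
  set ε := (cNorm (r + 1) U fun z => H z - G z).toReal with hε
  have hd := hdiff G hG.smooth_ham hfin
  obtain ⟨ha, hb⟩ := hcomp B G X Ψ L' W ε hG.smooth_ham hG.smooth hG.lipschitz hG.flow hG.isOpen
    hG.subset hG.eqOn hεB hd z h1 h2
  intro t ht i hi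
  refine (hb (B * (C B * ε) + ε) (fun t ht => ?_) t ht i hi).trans_eq (by ring)
  have hBd : (B : ℝ) * ‖Φ t z - Ψ t z‖ ≤ B * (C B * ε) := by
    gcongr
    exact ha t ht
  -- The intermediate term is the top derivative of `H` at the point of `Ψ` in the first case, and
  -- that of `G` at the point of `Φ` in the second.
  rcases hLip with hLip | hLip
  · have e1 := hLip.dist_le_mul _ (h1 t ht) _ (h2 t ht)
    rw [dist_eq_norm, dist_eq_norm, ← hiter _ (h1 t ht), ← hiter _ (h2 t ht)] at e1
    have e2 := hd (r + 1) le_rfl _ (h2 t ht)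
    have e3 := norm_sub_le_norm_sub_add_norm_sub (iteratedFDeriv ℝ (r + 1) H' (Φ t z))
      (iteratedFDeriv ℝ (r + 1) H' (Ψ t z)) (iteratedFDeriv ℝ (r + 1) G (Ψ t z))
    linarith
  · have e1 := hLip.dist_le_mul _ (h1 t ht) _ (h2 t ht)
    rw [dist_eq_norm, dist_eq_norm] at e1
    have e2 := hd (r + 1) le_rfl _ (h1 t ht)
    have e3 := norm_sub_le_norm_sub_add_norm_sub (iteratedFDeriv ℝ (r + 1) H' (Φ t z))
      (iteratedFDeriv ℝ (r + 1) G (Φ t z)) (iteratedFDeriv ℝ (r + 1) G (Ψ t z))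
    linarith

lemma contDiff_of_mem_polyHam {N : ℕ} {G : J1 n → ℝ} (hG : G ∈ polyHam n N) : ContDiff ℝ ∞ G := by
  obtain ⟨f, hf, h⟩ := hG
  have : G = fun z => ∑ a : Fin n → Fin (N + 1) with ∑ i, (a i : ℕ) ≤ N,
      lift (f a) z * mono (fun i => (a i : ℕ)) z := by
    funext z
    exact h z.1 z.2.1 z.2.2
  rw [this]
  exact ContDiff.sum fun a _ => (((hf a).comp (by fun_prop) :
    ContDiff ℝ ∞ fun z : J1 n => f a (z.1, z.2.1))).mul (contDiff_mono _)

/-- The errors of the composition scheme, in terms of the constants of the comparison of `H` with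
its surrogate. -/
theorem exists_total_error {r : ℕ} {U : Set (J1 n)} {T : ℝ} (hU : IsCompact U) {N : ℕ}
    {G : J1 n → ℝ} {R : DepthOne n} (p : ℕ) (hG : G ∈ polyHam n N) (hR : R.ham = G) :
    ∃ (Csplit h₀ : ℝ) (W : Set (J1 n)) (Ψ : ℝ → J1 n → J1 n),
      0 < Csplit ∧ U ⊆ W ∧ IsOneStepMap (R.scheme p) h₀ W Ψ ∧
      ∀ (K : Set (J1 n)) (ΦG : ℝ → J1 n → J1 n), IsConfinedFlow (contactField G) K U T ΦG →
        (∀ t ∈ Icc 0 T, ∀ z ∈ K, ContDiffAt ℝ r (ΦG t) z) ∧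
        (∀ h, 0 < h → h < h₀ → ∀ k : ℕ, k * h ≤ T →
          (∀ z ∈ K, (Ψ h)^[k] z ∈ W) ∧
          cNorm r K (fun z => ΦG (k * h) z - (Ψ h)^[k] z) ≤ ENNReal.ofReal (Csplit * h ^ p)) ∧
        ∀ (H : J1 n → ℝ) (Capp : ℝ≥0 → ℝ) (δ : ℝ → ℝ) (Φ ΦH : ℝ → J1 n → J1 n),
          (∀ B, 0 < Capp B) → IsSurrogateEstimate r U T H Capp δ Φ →
          IsConfinedFlow (contactField H) K U T ΦH →
          (∀ t ∈ Icc 0 T, ∀ z ∈ K, ContDiffAt ℝ r (ΦH t) z) ∧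
          (∀ B : ℝ≥0, cNorm (r + 1) U (fun z => H z - G z) ≤ B →
            (LipschitzOnWith B (iteratedFDeriv ℝ (r + 1) H) U ∨
              LipschitzOnWith B (iteratedFDeriv ℝ (r + 1) G) U) →
            ∀ h, 0 < h → h < h₀ → ∀ k : ℕ, k * h ≤ T →
              cNorm r K (fun z => ΦH (k * h) z - (Ψ h)^[k] z)
                ≤ ENNReal.ofReal (Capp B) * cNorm (r + 1) U (fun z => H z - G z)
                  + ENNReal.ofReal (Csplit * h ^ p)) ∧
          ∀ ε : ℝ, 0 < ε →
            cNorm (r + 1) U (fun z => H z - G z) < ENNReal.ofReal (δ (ε / 2)) →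
            ∃ h₁, 0 < h₁ ∧ h₁ ≤ h₀ ∧ ∀ h, 0 < h → h < h₁ → ∀ k : ℕ, k * h ≤ T →
              cNorm r K (fun z => ΦH (k * h) z - (Ψ h)^[k] z) < ENNReal.ofReal ε := by
  obtain ⟨C, h₀, W, Ψ, Φ, X, L, hC, hUW, hstep, hh₀, hΨ, hX, hL, hΦ, hXG, herr⟩ :=
    exists_splitting R p r hU T
  rw [hR] at hXG
  have hext : IsExtendedFlow G U W X Φ L :=
    ⟨contDiff_of_mem_polyHam hG, hX, hL, hΦ, hstep.isOpen, hUW, hXG⟩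
  have hle : ∀ i : ℕ, ((i : ℕ) : WithTop ℕ∞) ≤ (∞ : WithTop ℕ∞) := fun i => by
    exact_mod_cast le_top
  have hs := hΦ.contDiff hL hX
  have hΦt : ∀ t, ContDiff ℝ ∞ (Φ t) := fun t =>
    hs.comp (f := fun z : J1 n => (t, z)) (by fun_prop)
  have hpow : ∀ h, 0 < h → h < h₀ → C * h ^ (p + 1) ≤ C * h ^ p := by
    intro h h0 hh
    refine mul_le_mul_of_nonneg_left ?_ hC.le
    exact pow_le_pow_of_le_one h0.le (hh.le.trans hh₀) (Nat.le_succ p)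
  have hkh : ∀ {h : ℝ} {k : ℕ}, 0 < h → k * h ≤ T → (k : ℝ) * h ∈ Icc 0 T := fun h0 hk =>
    ⟨by positivity, hk⟩
  refine ⟨C, h₀, W, Ψ, hC, hUW, hstep, fun K ΦG hconf => ?_⟩
  have heq := fun z hz => hconf.eventually_eq hstep.isOpen hUW hΦ hL hXG (z := z) hz
  have hΦU : ∀ z ∈ K, ∀ t ∈ Icc 0 T, Φ t z ∈ U := fun z hz t ht => by
    rw [← (heq z hz).self_of_nhds t ht]
    exact hconf.mem z hz t ht
  refine ⟨fun t ht z hz => ?_, fun h h0 hh k hk => ⟨fun z hz => ?_, ?_⟩, ?_⟩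
  · refine (((hΦt t).of_le (hle r)).contDiffAt).congr_of_eventuallyEq ?_
    filter_upwards [heq z hz] with y hy using hy t ht
  · exact (herr h h0 hh k hk).1 z (hΦU z hz _ (hkh h0 hk))
  · refine cNorm_le_ofReal fun i hi z hz => ?_
    have e : (fun z => ΦG (k * h) z - (Ψ h)^[k] z) =ᶠ[𝓝 z] fun z => Φ (k * h) z - (Ψ h)^[k] z := by
      filter_upwards [heq z hz] with y hy
      rw [hy _ (hkh h0 hk)]
    rw [(e.iteratedFDeriv ℝ i).eq_of_nhds]
    exact ((herr h h0 hh k hk).2 i hi z).trans (hpow h h0 hh)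
  · intro H Capp δ Φ' ΦH hCapp hest hconf'
    have heq' := hest.eventually_eq K ΦH hconf'
    have hΦ'U : ∀ z ∈ K, ∀ t ∈ Icc 0 T, Φ' t z ∈ U := fun z hz t ht => by
      rw [← (heq' z hz).self_of_nhds t ht]
      exact hconf'.mem z hz t ht
    -- The given flows have the same germs on `K` as the complete flows `Φ'` and `Φ`; the triangle
    -- inequality passes through the flow of `G`.
    have htri : ∀ h, 0 < h → h < h₀ → ∀ k : ℕ, k * h ≤ T → ∀ i ≤ r, ∀ z ∈ K,
        ‖iteratedFDeriv ℝ i (fun z => ΦH (k * h) z - (Ψ h)^[k] z) z‖ ≤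
          ‖iteratedFDeriv ℝ i (Φ' (k * h)) z - iteratedFDeriv ℝ i (Φ (k * h)) z‖ +
            C * h ^ (p + 1) := by
      intro h h0 hh k hk i hi z hz
      have hir : ((i : ℕ) : WithTop ℕ∞) ≤ r := by exact_mod_cast hi
      have e : (fun z => ΦH (k * h) z - (Ψ h)^[k] z) =ᶠ[𝓝 z]
          fun z => Φ' (k * h) z - (Ψ h)^[k] z := by
        filter_upwards [heq' z hz] with y hy
        rw [hy _ (hkh h0 hk)]
      have s1 : ContDiffAt ℝ i (Φ' (k * h)) z :=
        ((hest.contDiff _ (hkh h0 hk)).of_le hir).contDiffAt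
      have s2 : ContDiffAt ℝ i (Φ (k * h)) z := ((hΦt _).of_le (hle i)).contDiffAt
      have s3 : ContDiffAt ℝ i ((Ψ h)^[k]) z := ((contDiff_iterate (hΨ h) k).of_le (hle i)).contDiffAt
      have h1 := (herr h h0 hh k hk).2 i hi z
      rw [fun_iteratedFDeriv_sub_apply s2 s3] at h1
      rw [(e.iteratedFDeriv ℝ i).eq_of_nhds, fun_iteratedFDeriv_sub_apply s1 s3]
      exact (norm_sub_le_norm_sub_add_norm_sub _ (iteratedFDeriv ℝ i (Φ (k * h)) z) _).trans
        (by gcongr)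
    refine ⟨fun t ht z hz => ?_, fun B hB hLip h h0 hh k hk => ?_, fun ε hε hlt => ?_⟩
    · refine ((hest.contDiff t ht).contDiffAt).congr_of_eventuallyEq ?_
      filter_upwards [heq' z hz] with y hy using hy t ht
    · have hfin : cNorm (r + 1) U (fun z => H z - G z) ≠ ⊤ := (hB.trans_lt ENNReal.coe_lt_top).ne
      have hb : cNorm r K (fun z => ΦH (k * h) z - (Ψ h)^[k] z) ≤ ENNReal.ofReal
          (Capp B * (cNorm (r + 1) U fun z => H z - G z).toReal + C * h ^ p) := by
        refine cNorm_le_ofReal fun i hi z hz => (htri h h0 hh k hk i hi z hz).trans ?_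
        exact add_le_add (hest.lipschitz_estimate B G W X Φ L hext hB hLip z (hΦ'U z hz) (hΦU z hz)
          _ (hkh h0 hk) i hi) (hpow h h0 hh)
      rwa [ENNReal.ofReal_add (mul_nonneg (hCapp B).le ENNReal.toReal_nonneg) (by positivity),
        ENNReal.ofReal_mul (hCapp B).le, ENNReal.ofReal_toReal hfin] at hb
    -- The surrogate takes `ε / 2` and the splitting `ε / 4`, which leaves a strict inequality. The
    -- exponent `p + 1` is needed here if `p = 0`.
    · refine ⟨min h₀ (ε / (4 * C)), lt_min hstep.pos (by positivity), min_le_left _ _,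
        fun h h0 hh k hk => ?_⟩
      have hh' : h < h₀ := hh.trans_le (min_le_left _ _)
      have hb : cNorm r K (fun z => ΦH (k * h) z - (Ψ h)^[k] z) ≤
          ENNReal.ofReal (ε / 2 + ε / 4) := by
        refine cNorm_le_ofReal fun i hi z hz => (htri h h0 hh' k hk i hi z hz).trans ?_
        refine add_le_add (hest.estimate (ε / 2) (by positivity) G W X Φ L hext hlt z (hΦ'U z hz)
          (hΦU z hz) _ (hkh h0 hk) i hi) ?_
        calc C * h ^ (p + 1) ≤ C * h := by
              gcongr
              exact pow_le_of_le_one h0.le (hh'.le.trans hh₀) (by omega)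
          _ ≤ C * (ε / (4 * C)) := by
              gcongr
              exact hh.le.trans (min_le_right _ _)
          _ = ε / 4 := by field_simp
      exact hb.trans_lt ((ENNReal.ofReal_lt_ofReal_iff hε).2 (by linarith))

end J1

/-! ### Approximation of Hamiltonians by convolution with a polynomial kernel -/

section Convolution

open MeasureTheory

variable {E F : Type} [NormedAddCommGroup E] [ProperSpace E] [MeasurableSpace E] [BorelSpace E]
  {μ : Measure E} [IsFiniteMeasureOnCompacts μ] [NormedAddCommGroup F] [NormedSpace ℝ F]

/-- Averages with respect to powers of a function with a strict maximum at the origin converge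
uniformly on compact sets. -/
lemma eventually_norm_setIntegral_pow_smul_sub_le [CompleteSpace F] [μ.IsOpenPosMeasure] {c : E → ℝ} {s U : Set E}
    (hs : IsCompact s) (hU : IsCompact U) (hc : Continuous c) (hmax : ∀ v ∈ s, v ≠ 0 → c v < c 0)
    (hnc : ∀ v ∈ s, 0 ≤ c v) (hc₀ : 0 < c 0) (h₀ : (0 : E) ∈ interior s) {g : E → F}
    (hg : Continuous g) {ε : ℝ} (hε : 0 < ε) :
    ∀ᶠ k : ℕ in atTop, ∀ z ∈ U,
      ‖(∫ v in s, c v ^ k ∂μ)⁻¹ • (∫ v in s, c v ^ k • g (z - v) ∂μ) - g z‖ ≤ ε := by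
  have : CompactSpace U := isCompact_iff_compactSpace.1 hU
  -- Viewing the translates as a map into `C(U, F)` turns convergence at one point into convergence
  -- uniform on `U`.
  let g' : C(E, C(U, F)) := ContinuousMap.curry ⟨fun q : E × U => g (q.2 - q.1), by fun_prop⟩
  have hg' : ∀ v (z : U), g' v z = g (z - v) := fun v z => rfl
  have := tendsto_setIntegral_pow_smul_of_unique_maximum_of_isCompact_of_continuousOn (μ := μ) hs
    hc.continuousOn hmax hnc hc₀ (subset_closure h₀) g'.continuous.continuousOn
  filter_upwards [(Metric.tendsto_nhds.1 this) ε hε] with k hk z hz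
  rw [dist_eq_norm] at hk
  have h1 := (ContinuousMap.norm_coe_le_norm _ (⟨z, hz⟩ : U)).trans hk.le
  have hgi : IntegrableOn (fun v => c v ^ k • g' v) s μ :=
    ((hc.pow k).smul g'.continuous).continuousOn.integrableOn_compact hs
  have h2 := (ContinuousMap.evalCLM ℝ (⟨z, hz⟩ : U) (M := F)).integral_comp_comm hgi
  simp only [ContinuousMap.evalCLM_apply, ContinuousMap.smul_apply, hg'] at h2
  simpa [hg', ← h2] using h1

variable [NormedSpace ℝ E]

lemma hasFDerivAt_setIntegral_smul_sub {φ : E → ℝ} {f : E → F} {s : Set E} (hs : IsCompact s)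
    (hφ : Continuous φ) (hf : ContDiff ℝ 1 f) (hfs : HasCompactSupport f) (z : E) :
    HasFDerivAt (fun z => ∫ v in s, φ v • f (z - v) ∂μ) (∫ v in s, φ v • fderiv ℝ f (z - v) ∂μ)
      z := by
  have hf' : Continuous (fderiv ℝ f) := hf.continuous_fderiv one_ne_zero
  obtain ⟨M, hM⟩ := (hfs.fderiv (𝕜 := ℝ)).exists_bound_of_continuous hf'
  have hc : ∀ z, Continuous fun v => φ v • f (z - v) := fun z =>
    hφ.smul (hf.continuous.comp (continuous_const.sub continuous_id))
  have hc' : Continuous fun v => φ v • fderiv ℝ f (z - v) :=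
    hφ.smul (hf'.comp (continuous_const.sub continuous_id))
  refine hasFDerivAt_integral_of_dominated_of_fderiv_le (bound := fun v => |φ v| * M) univ_mem
    (F' := fun z v => φ v • fderiv ℝ f (z - v))
    (Eventually.of_forall fun z => (hc z).aestronglyMeasurable)
    ((hc z).continuousOn.integrableOn_compact hs) hc'.aestronglyMeasurable
    (Eventually.of_forall fun v z _ => ?_)
    ((hφ.abs.mul continuous_const).continuousOn.integrableOn_compact hs)
    (Eventually.of_forall fun v z _ => ?_)
  · rw [norm_smul, Real.norm_eq_abs]
    gcongr
    exact hM _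
  · have := ((hf.differentiable one_ne_zero (z - v)).hasFDerivAt.comp z
      ((hasFDerivAt_id z).sub_const v)).const_smul (φ v)
    simpa [Function.comp_def, Pi.smul_def] using this

/-- The derivatives fall on `f` and not on the kernel, so approximation in `C^m` reduces to uniform
approximation of each derivative. -/
lemma iteratedFDeriv_setIntegral_smul_sub [CompleteSpace F] {φ : E → ℝ} {f : E → F} {s : Set E} (hs : IsCompact s)
    (hφ : Continuous φ) {m : ℕ} (hf : ContDiff ℝ m f) (hfs : HasCompactSupport f) {i : ℕ}
    (hi : i ≤ m) (z : E) : iteratedFDeriv ℝ i (fun z => ∫ v in s, φ v • f (z - v) ∂μ) z =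
      ∫ v in s, φ v • iteratedFDeriv ℝ i f (z - v) ∂μ := by
  induction i generalizing z with
  | zero =>
    simp only [iteratedFDeriv_zero_eq_comp, Function.comp_apply]
    refine (((continuousMultilinearCurryFin0 ℝ E F).symm.toContinuousLinearEquiv.integral_comp_comm
      fun v => φ v • f (z - v)).symm).trans ?_
    simp
  | succ i ih =>
    have hi' : ContDiff ℝ 1 (iteratedFDeriv ℝ i f) :=
      hf.iteratedFDeriv_right (by exact_mod_cast (by omega))
    rw [iteratedFDeriv_succ_eq_comp_left, Function.comp_apply,
      show iteratedFDeriv ℝ i (fun z => ∫ v in s, φ v • f (z - v) ∂μ) = _ from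
        funext (ih (by omega)),
      (hasFDerivAt_setIntegral_smul_sub hs hφ hi' (hfs.iteratedFDeriv i) z).fderiv]
    refine (((continuousMultilinearCurryLeftEquiv ℝ (fun _ : Fin (i + 1) => E)
      F).symm.toContinuousLinearEquiv.integral_comp_comm
        fun v => φ v • fderiv ℝ (iteratedFDeriv ℝ i f) (z - v)).symm).trans ?_
    simp [iteratedFDeriv_succ_eq_comp_left]

end Convolution

/-! ### Density of Hamiltonians that are polynomial in the momenta -/

namespace J1

open MeasureTheory

variable {n : ℕ}

lemma zero_mem_polyHam (N : ℕ) : (fun _ => 0 : J1 n → ℝ) ∈ polyHam n N :=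
  ⟨fun _ _ => 0, fun _ => contDiff_const, fun x u p => by simp⟩

lemma add_mem_polyHam {N : ℕ} {f g : J1 n → ℝ} (hf : f ∈ polyHam n N) (hg : g ∈ polyHam n N) :
    (fun z => f z + g z) ∈ polyHam n N := by
  obtain ⟨f', hf', hf⟩ := hf
  obtain ⟨g', hg', hg⟩ := hg
  refine ⟨fun a y => f' a y + g' a y, fun a => (hf' a).add (hg' a), fun x u p => ?_⟩
  beta_reduce
  rw [hf, hg, ← Finset.sum_add_distrib]
  simp only [add_mul]

lemma const_mul_mem_polyHam {N : ℕ} {f : J1 n → ℝ} (t : ℝ) (hf : f ∈ polyHam n N) :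
    (fun z => t * f z) ∈ polyHam n N := by
  obtain ⟨f', hf', hf⟩ := hf
  refine ⟨fun a y => t * f' a y, fun a => contDiff_const.mul (hf' a), fun x u p => ?_⟩
  beta_reduce
  rw [hf, Finset.mul_sum]
  simp only [mul_assoc]

lemma lift_mul_mono_mem_polyHam {N : ℕ} {f : (Fin n → ℝ) × ℝ → ℝ} (hf : ContDiff ℝ ∞ f)
    {a : Fin n → ℕ} (ha : ∑ i, a i ≤ N) : (fun z => lift f z * mono a z) ∈ polyHam n N := by
  have ha' : ∀ i, a i < N + 1 := fun i =>
    Nat.lt_succ_of_le ((Finset.single_le_sum (fun j _ => Nat.zero_le (a j))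
      (Finset.mem_univ i)).trans ha)
  let b : Fin n → Fin (N + 1) := fun i => ⟨a i, ha' i⟩
  refine ⟨fun c => if c = b then f else fun _ => 0, fun c => ?_, fun x u p => ?_⟩
  · dsimp only
    split_ifs
    · exact hf
    · exact contDiff_const
  · rw [Finset.sum_eq_single b]
    · simp [lift, mono, b]
    · intro c _ hc
      simp [hc]
    · intro h
      exact absurd (by simpa [b] using ha) h

/-- The functions `f(x, u) p ^ a b(w)` of a pair of points `(x, u, p)`, `w`. -/
def separatedTerms (n : ℕ) : Set (J1 n × J1 n → ℝ) :=
  {g | ∃ (f : (Fin n → ℝ) × ℝ → ℝ) (a : Fin n → ℕ) (b : J1 n → ℝ), ContDiff ℝ ∞ f ∧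
    Continuous b ∧ g = fun q => lift f q.1 * mono a q.1 * b q.2}

lemma closure_separatedTerms :
    (Submonoid.closure (separatedTerms n) : Set (J1 n × J1 n → ℝ)) ⊆ separatedTerms n := by
  intro g hg
  induction hg using Submonoid.closure_induction with
  | mem g hg => exact hg
  | one => exact ⟨fun _ => 1, 0, fun _ => 1, contDiff_const, continuous_const, by
      funext q
      simp [lift, mono]⟩
  | mul g g' _ _ h h' =>
    obtain ⟨f, a, b, hf, hb, rfl⟩ := h
    obtain ⟨f', a', b', hf', hb', rfl⟩ := h'
    refine ⟨fun y => f y * f' y, a + a', fun w => b w * b' w, hf.mul hf', hb.mul hb', ?_⟩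
    funext q
    simp only [Pi.mul_apply, lift, mono, Pi.add_apply, pow_add, Finset.prod_mul_distrib]
    ring

/-- The separated terms are closed under products, so the algebra they generate is their span:
membership is checked by algebra, while integrals are treated by linearity. -/
lemma mem_span_separatedTerms {g : J1 n × J1 n → ℝ}
    (hg : g ∈ Algebra.adjoin ℝ (separatedTerms n)) :
    g ∈ Submodule.span ℝ (separatedTerms n) := by
  rw [← Algebra.adjoin_eq_span_of_subset ℝ ((closure_separatedTerms).trans Submodule.subset_span)]
  exact hg

lemma continuous_lift {f : (Fin n → ℝ) × ℝ → ℝ} (hf : Continuous f) : Continuous (lift f) :=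
  hf.comp (by fun_prop)

/-- Averages of functions that are polynomial in `p`, with respect to a parameter, are polynomial
in `p`. -/
lemma integral_mem_polyHam {g : J1 n × J1 n → ℝ} (hg : g ∈ Algebra.adjoin ℝ (separatedTerms n))
    {H : J1 n → ℝ} (hH : Continuous H) (hHs : HasCompactSupport H) :
    Continuous g ∧ ∃ N₀, ∀ N ≥ N₀, (fun z => ∫ w, g (z, w) * H w) ∈ polyHam n N := by
  replace hg := mem_span_separatedTerms hg
  induction hg using Submodule.span_induction with
  | mem g hg =>
    obtain ⟨f, a, b, hf, hb, rfl⟩ := hg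
    refine ⟨(((continuous_lift hf.continuous).comp continuous_fst).mul
      ((contDiff_mono a).continuous.comp continuous_fst)).mul (hb.comp continuous_snd),
      ∑ i, a i, fun N hN => ?_⟩
    have : (fun z => ∫ w, lift f z * mono a z * b w * H w) =
        fun z => (∫ w, b w * H w) * (lift f z * mono a z) := by
      funext z
      simp only [mul_assoc]
      rw [integral_const_mul, integral_const_mul]
      ring
    rw [this]
    exact const_mul_mem_polyHam _ (lift_mul_mono_mem_polyHam hf hN)
  | zero =>
    refine ⟨continuous_const, 0, fun N _ => ?_⟩
    simpa using zero_mem_polyHam N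
  | add g g' _ _ h h' =>
    obtain ⟨hc, N, h⟩ := h
    obtain ⟨hc', N', h'⟩ := h'
    refine ⟨hc.add hc', max N N', fun M hM => ?_⟩
    have hi : ∀ {g : J1 n × J1 n → ℝ}, Continuous g → ∀ z,
        Integrable fun w => g (z, w) * H w := fun hg z =>
      ((hg.comp (Continuous.prodMk_right z)).mul hH).integrable_of_hasCompactSupport hHs.mul_left
    have : (fun z => ∫ w, (g + g') (z, w) * H w) =
        fun z => (∫ w, g (z, w) * H w) + ∫ w, g' (z, w) * H w := by
      funext z
      rw [← integral_add (hi hc z) (hi hc' z)]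
      simp only [Pi.add_apply, add_mul]
    rw [this]
    exact add_mem_polyHam (h M (le_of_max_le_left hM)) (h' M (le_of_max_le_right hM))
  | smul t g _ h =>
    obtain ⟨hc, N, h⟩ := h
    refine ⟨hc.const_smul t, N, fun M hM => ?_⟩
    have : (fun z => ∫ w, (t • g) (z, w) * H w) = fun z => t * ∫ w, g (z, w) * H w := by
      funext z
      simp only [Pi.smul_apply, smul_eq_mul, mul_assoc]
      rw [integral_const_mul]
    rw [this]
    exact const_mul_mem_polyHam _ (h M hM)

/-- The sum of the squares of the coordinates. -/
def sumSq (v : J1 n) : ℝ := ∑ i, v.1 i ^ 2 + v.2.1 ^ 2 + ∑ i, v.2.2 i ^ 2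

lemma continuous_sumSq : Continuous (sumSq (n := n)) := by
  unfold sumSq
  fun_prop

lemma sumSq_pos {v : J1 n} (hv : v ≠ 0) : 0 < sumSq v := by
  contrapose! hv
  have h1 : 0 ≤ ∑ i, v.1 i ^ 2 := Finset.sum_nonneg fun i _ => sq_nonneg _
  have h2 : 0 ≤ ∑ i, v.2.2 i ^ 2 := Finset.sum_nonneg fun i _ => sq_nonneg _
  have h3 := sq_nonneg v.2.1
  unfold sumSq at hv
  have e1 : ∑ i, v.1 i ^ 2 = 0 := by linarith
  have e2 : ∑ i, v.2.2 i ^ 2 = 0 := by linarith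
  have e3 : v.2.1 ^ 2 = 0 := by linarith
  rw [Finset.sum_eq_zero_iff_of_nonneg fun i _ => sq_nonneg _] at e1 e2
  refine Prod.ext (funext fun i => ?_) (Prod.ext ?_ (funext fun i => ?_))
  · simpa using e1 i (Finset.mem_univ i)
  · simpa using e3
  · simpa using e2 i (Finset.mem_univ i)

lemma kernel_mem_adjoin (M : ℝ) (k : ℕ) : (fun q : J1 n × J1 n => (1 - M * sumSq (q.1 - q.2)) ^ k) ∈
    Algebra.adjoin ℝ (separatedTerms n) := by
  have hb : ∀ b : J1 n → ℝ, Continuous b →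
      (fun q : J1 n × J1 n => b q.2) ∈ Algebra.adjoin ℝ (separatedTerms n) := fun b hb =>
    Algebra.subset_adjoin ⟨fun _ => 1, 0, b, contDiff_const, hb, by
      funext q
      simp [lift, mono]⟩
  have hf : ∀ f : (Fin n → ℝ) × ℝ → ℝ, ContDiff ℝ ∞ f →
      (fun q : J1 n × J1 n => f (q.1.1, q.1.2.1)) ∈ Algebra.adjoin ℝ (separatedTerms n) :=
    fun f hf => Algebra.subset_adjoin ⟨f, 0, fun _ => 1, hf, continuous_const, by
      funext q
      simp [lift, mono]⟩
  have hp : ∀ i, (fun q : J1 n × J1 n => q.1.2.2 i) ∈ Algebra.adjoin ℝ (separatedTerms n) :=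
    fun i => Algebra.subset_adjoin ⟨fun _ => 1, Pi.single i 1, fun _ => 1, contDiff_const,
      continuous_const, by
        funext q
        simp [lift, mono, Pi.single_apply, pow_ite, Finset.prod_ite_eq']⟩
  have e : (fun q : J1 n × J1 n => (1 - M * sumSq (q.1 - q.2)) ^ k) = (1 - M •
      (∑ i, ((fun q : J1 n × J1 n => q.1.1 i) - fun q => q.2.1 i) ^ 2 +
        ((fun q : J1 n × J1 n => q.1.2.1) - fun q => q.2.2.1) ^ 2 +
        ∑ i, ((fun q : J1 n × J1 n => q.1.2.2 i) - fun q => q.2.2.2 i) ^ 2)) ^ k := by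
    funext q
    simp only [sumSq, Pi.pow_apply, Pi.sub_apply, Pi.one_apply, Pi.smul_apply, Pi.add_apply,
      Finset.sum_apply, smul_eq_mul, Prod.fst_sub, Prod.snd_sub]
  rw [e]
  refine pow_mem (sub_mem (one_mem _) (Subalgebra.smul_mem _ (add_mem (add_mem
    (sum_mem fun i _ => pow_mem (sub_mem (hf (fun y => y.1 i) (by fun_prop))
      (hb (fun w => w.1 i) (by fun_prop))) 2)
    (pow_mem (sub_mem (hf (fun y => y.2) (by fun_prop)) (hb (fun w => w.2.1) (by fun_prop))) 2))
    (sum_mem fun i _ => pow_mem (sub_mem (hp i) (hb (fun w => w.2.2 i) (by fun_prop))) 2)) _)) k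

lemma isAddHaarMeasure_volume (n : ℕ) : (volume : Measure (J1 n)).IsAddHaarMeasure := by
  have : (volume : Measure (ℝ × (Fin n → ℝ))).IsAddHaarMeasure :=
    Measure.prod.instIsAddHaarMeasure _ _
  exact Measure.prod.instIsAddHaarMeasure _ _

/-- Hamiltonians that are polynomial in `p` are dense in `C^m` on compact sets. -/
theorem exists_polyHam_approx {m : ℕ} {H : J1 n → ℝ} (hH : ContDiff ℝ m H)
    (hHs : HasCompactSupport H) {U : Set (J1 n)} (hU : IsCompact U) {ε : ℝ} (hε : 0 < ε) :
    ∃ N, ∃ G ∈ polyHam n N, ∀ i ≤ m, ∀ z ∈ U,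
      ‖iteratedFDeriv ℝ i H z - iteratedFDeriv ℝ i G z‖ ≤ ε := by
  obtain ⟨a, ha⟩ := (hU.union hHs.isCompact).isBounded.subset_ball (0 : J1 n)
  -- `s` contains all differences of points of `U` and of the support of `H`, so restricting the
  -- kernel to `s` does not change the convolution near `U`.
  set s : Set (J1 n) := Metric.closedBall 0 (2 * max a 1) with hs_def
  have ha1 : 1 ≤ max a 1 := le_max_right _ _
  have hs : IsCompact s := isCompact_closedBall _ _
  obtain ⟨M, hM⟩ := hs.exists_bound_of_continuousOn (continuous_sumSq (n := n)).continuousOn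
  -- This scaling keeps the kernel nonnegative on `s`, with its strict maximum `1` at the origin.
  set M' : ℝ := (|M| + 1)⁻¹ with hM'
  have hM'0 : 0 < M' := by positivity
  set c : J1 n → ℝ := fun v => 1 - M' * sumSq v with hc_def
  have hc : Continuous c := continuous_const.sub (continuous_const.mul continuous_sumSq)
  have hc0 : c 0 = 1 := by simp [hc_def, sumSq]
  have hmax : ∀ v ∈ s, v ≠ 0 → c v < c 0 := fun v _ hv => by
    rw [hc0]
    have := mul_pos hM'0 (sumSq_pos hv)
    simp only [hc_def]
    linarith
  have hnc : ∀ v ∈ s, 0 ≤ c v := fun v hv => by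
    have h1 : sumSq v ≤ |M| + 1 := ((le_abs_self _).trans (hM v hv)).trans (by
      linarith [le_abs_self M])
    have h2 : M' * sumSq v ≤ M' * (|M| + 1) := by gcongr
    rw [hM', inv_mul_cancel₀ (by positivity)] at h2
    simp only [hc_def, hM']
    linarith
  have h0s : (0 : J1 n) ∈ interior s := mem_interior_iff_mem_nhds.2
    (Metric.closedBall_mem_nhds _ (by linarith))
  have hlim : ∀ᶠ k : ℕ in atTop, ∀ i ≤ m, ∀ z ∈ U,
      ‖(∫ v in s, c v ^ k)⁻¹ • (∫ v in s, c v ^ k • iteratedFDeriv ℝ i H (z - v)) -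
        iteratedFDeriv ℝ i H z‖ ≤ ε := by
    have h : ∀ᶠ k : ℕ in atTop, ∀ i ∈ Finset.range (m + 1), ∀ z ∈ U,
      ‖(∫ v in s, c v ^ k)⁻¹ • (∫ v in s, c v ^ k • iteratedFDeriv ℝ i H (z - v)) -
        iteratedFDeriv ℝ i H z‖ ≤ ε := by
      rw [Filter.eventually_all_finset]
      intro i hi
      exact eventually_norm_setIntegral_pow_smul_sub_le hs hU hc hmax hnc (by rw [hc0]; exact one_pos)
        h0s (hH.continuous_iteratedFDeriv
          (by exact_mod_cast Nat.lt_succ_iff.1 (Finset.mem_range.1 hi))) hε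
    filter_upwards [h] with k hk i hi using hk i (Finset.mem_range.2 (by omega))
  obtain ⟨k, hk⟩ := hlim.exists
  obtain ⟨-, N, hN⟩ := integral_mem_polyHam (kernel_mem_adjoin M' k) hH.continuous hHs
  set t : ℝ := (∫ v in s, c v ^ k)⁻¹ with ht
  refine ⟨N, _, const_mul_mem_polyHam t (hN N le_rfl), fun i hi z hz => ?_⟩
  have hzb : ∀ᶠ y in 𝓝 z, y ∈ Metric.ball (0 : J1 n) a :=
    Metric.isOpen_ball.mem_nhds (ha (Or.inl hz))
  -- One convolution, seen in two ways: with `z` in `H`, derivatives converge to those of `H`; with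
  -- `z` in the kernel, the result is polynomial in `p`.
  have e : (fun z => ∫ v in s, c v ^ k • H (z - v)) =ᶠ[𝓝 z]
      fun z => ∫ w, (1 - M' * sumSq (z - w)) ^ k * H w := by
    filter_upwards [hzb] with y hy
    have := isAddHaarMeasure_volume n
    have := Measure.Regular.of_sigmaCompactSpace_of_isLocallyFiniteMeasure
      (volume : Measure (J1 n))
    have h1 : ∫ w, (1 - M' * sumSq (y - w)) ^ k * H w = ∫ v, c v ^ k • H (y - v) := by
      rw [← integral_sub_left_eq_self (fun v => c v ^ k • H (y - v)) volume y]
      simp [hc_def]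
    have h2 : ∫ v, c v ^ k • H (y - v) = ∫ v in s, c v ^ k • H (y - v) := by
      refine (setIntegral_eq_integral_of_forall_compl_eq_zero fun v hv => ?_).symm
      have : H (y - v) = 0 := by
        by_contra hne
        have h3 : y - v ∈ Metric.ball (0 : J1 n) a := ha (Or.inr (subset_tsupport _ hne))
        rw [mem_ball_zero_iff] at h3 hy
        refine hv (mem_closedBall_zero_iff.2 ?_)
        have h4 : ‖v‖ ≤ ‖y‖ + ‖y - v‖ := by
          simpa using norm_sub_le y (y - v)
        linarith [le_max_left a 1]
      rw [this, smul_zero]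
    rw [h1, h2]
  have hsm : ContDiffAt ℝ i (fun z => ∫ v in s, c v ^ k • H (z - v)) z := by
    refine ContDiffAt.congr_of_eventuallyEq ?_ e
    exact ((contDiff_of_mem_polyHam (hN N le_rfl)).of_le (by exact_mod_cast le_top)).contDiffAt
  have e' : (fun z => t * ∫ w, (1 - M' * sumSq (z - w)) ^ k * H w) =ᶠ[𝓝 z]
      t • fun z => ∫ v in s, c v ^ k • H (z - v) := by
    filter_upwards [e] with y hy
    rw [Pi.smul_apply, hy, smul_eq_mul]
  rw [(e'.iteratedFDeriv ℝ i).eq_of_nhds, iteratedFDeriv_const_smul_apply hsm,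
    iteratedFDeriv_setIntegral_smul_sub (φ := fun v => c v ^ k) hs (hc.pow k) hH hHs hi,
    norm_sub_rev]
  exact hk i hi z hz

end J1

/-! ### Surrogates whose trajectories are confined -/

namespace J1

variable {n : ℕ}

/-- If the trajectories of a complete vector field remain in the interior of `U`, then the
trajectories of the vector fields that are close to it on `U` exist and remain in `U`. -/
lemma exists_isConfinedFlow_of_close {X : J1 n → J1 n} {Φ : ℝ → J1 n → J1 n} {L : ℝ≥0}
    (hL : LipschitzWith L X) (hXs : HasCompactSupport X) (hΦ : IsGlobalFlow X Φ)
    {K U : Set (J1 n)} {T : ℝ} (hK : IsCompact K) (hU : IsCompact U)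
    (hmem : ∀ z ∈ K, ∀ t ∈ Icc 0 T, Φ t z ∈ interior U) :
    ∃ η > 0, ∀ Y : J1 n → J1 n, ContDiff ℝ 1 Y → (∀ z ∈ U, ‖Y z - X z‖ ≤ η) →
      ∃ Ψ, IsConfinedFlow Y K U T Ψ := by
  set S : Set (J1 n) := (fun q : ℝ × J1 n => Φ q.1 q.2) '' (Icc 0 T ×ˢ K) with hS_def
  have hS : IsCompact S := (isCompact_Icc.prod hK).image (hΦ.continuous hL)
  have hSU : S ⊆ interior U := by
    rintro _ ⟨q, hq, rfl⟩
    exact hmem q.2 hq.2 q.1 hq.1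
  -- The trajectories fill a compact set `S`, so a closed `d`-tube around it still fits into the
  -- interior of `U`.
  obtain ⟨d, hd, hdU⟩ := hS.exists_cthickening_subset_open isOpen_interior hSU
  obtain ⟨χ, hχ1, hχ0, hχ⟩ := exists_contMDiffMap_one_nhds_of_subset_interior
    (modelWithCornersSelf ℝ (J1 n)) (n := ⊤) (Metric.isClosed_cthickening (δ := d) (E := S)) hdU
  have hχs : ContDiff ℝ ∞ χ := χ.contMDiff.contDiff
  have hχc : HasCompactSupport χ := hU.of_isClosed_subset (isClosed_tsupport _)
    (closure_minimal (fun x hx => by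
      by_contra h
      exact hx (hχ0 x h)) hU.isClosed)
  obtain ⟨O, hO, hdO, hO1⟩ := eventually_nhdsSet_iff_exists.1 hχ1
  obtain ⟨η, hη, hηd⟩ : ∃ η > 0, gronwallBound 0 L η T < d := by
    have hc := (gronwallBound_continuous_ε 0 (L : ℝ) T).continuousWithinAt (s := Ioi 0) (x := 0)
    have h0 : gronwallBound 0 (L : ℝ) 0 T < d := by
      rwa [gronwallBound_ε0_δ0]
    obtain ⟨η, h1, h2⟩ := ((hc.eventually (gt_mem_nhds h0)).and self_mem_nhdsWithin).exists
    exact ⟨η, h2, h1⟩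
  refine ⟨η, hη, fun Y hY hYX => ?_⟩
  have hll : LocallyLipschitz fun z => χ z • (Y z - X z) := fun z => by
    refine exists_lipschitzOnWith_smul
      ((hχs.of_le (by norm_cast) : ContDiff ℝ 1 χ).contDiffAt (x := z)).exists_lipschitzOnWith ?_
    obtain ⟨K', t, ht, h⟩ := (hY.contDiffAt (x := z)).exists_lipschitzOnWith
    exact ⟨K' + L, t, ht, h.sub hL.lipschitzOnWith⟩
  have hcs : HasCompactSupport fun z => χ z • (Y z - X z) := hχc.smul_right
  obtain ⟨L', hL'⟩ := hll.exists_lipschitzWith_of_hasCompactSupport hcs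
  obtain ⟨M, hM⟩ := hXs.exists_bound_of_continuous hL.continuous
  obtain ⟨M', hM'⟩ := hcs.exists_bound_of_continuous hL'.continuous
  -- `Z` is complete, equals `Y` near the tube and is `η`-close to `X` everywhere, although `Y` is
  -- controlled on `U` only. Gronwall then keeps its trajectories in the tube, where they are
  -- trajectories of `Y`.
  set Z : J1 n → J1 n := fun z => X z + χ z • (Y z - X z) with hZ_def
  have hZ : LipschitzWith (L + L') Z := hL.add hL'
  obtain ⟨Ψ, hΨ⟩ := exists_isGlobalFlow hZ (L := M + M')
    fun z => (norm_add_le _ _).trans (add_le_add (hM z) (hM' z))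
  have hZO : EqOn Z Y O := fun z hz => by simp [hZ_def, hO1 z hz]
  have hZX : ∀ z, dist (Z z) (X z) ≤ η := fun z => by
    rw [dist_eq_norm, hZ_def, add_sub_cancel_left, norm_smul, Real.norm_of_nonneg (hχ z).1]
    by_cases hz : z ∈ U
    · exact (mul_le_of_le_one_left (norm_nonneg _) (hχ z).2).trans (hYX z hz)
    · rw [hχ0 z hz, zero_mul]
      exact hη.le
  have hΨS : ∀ z ∈ K, ∀ t ∈ Icc 0 T, Ψ t z ∈ Metric.cthickening d S := by
    intro z hz t ht
    have hg := dist_le_of_approx_trajectories_ODE (v := fun _ => X) (K := L) (a := 0) (b := T)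
      (f := fun t => Ψ t z) (f' := fun t => Z (Ψ t z)) (g := fun t => Φ t z)
      (g' := fun t => X (Φ t z)) (εf := η) (εg := 0) (δ := 0) (fun _ => hL)
      (hΨ.continuous_curve z).continuousOn (fun t _ => (hΨ.deriv z t).hasDerivWithinAt)
      (fun t _ => hZX _) (hΦ.continuous_curve z).continuousOn
      (fun t _ => (hΦ.deriv z t).hasDerivWithinAt) (fun t _ => by simp)
      (by simp [hΨ.zero, hΦ.zero]) t ht
    rw [add_zero, sub_zero] at hg
    exact Metric.mem_cthickening_of_dist_le _ _ _ _ ⟨(t, z), ⟨ht, hz⟩, rfl⟩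
      ((hg.trans (gronwallBound_mono le_rfl hη.le L.2 ht.2)).trans hηd.le)
  refine ⟨Ψ, ⟨?_, fun z hz t ht => interior_subset (hdU (hΨS z hz t ht))⟩⟩
  rw [eventually_nhdsSet_iff_forall]
  intro z hz
  filter_upwards [hΨ.eventually_forall_mem hZ hO fun t ht => hdO (hΨS z hz t ht)] with y hy
  refine ⟨hΨ.zero y, fun t ht => ?_⟩
  beta_reduce
  rw [← hZO (hy t ht)]
  exact (hΨ.deriv y t).hasDerivWithinAt

/-- Polynomial surrogates of any accuracy whose flows are confined. -/
theorem exists_confined_surrogate {r : ℕ} {U K : Set (J1 n)} {T : ℝ} (hU : IsCompact U)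
    (hK : IsCompact K) {H : J1 n → ℝ} (hH : RegularNear r U H) {ΦH : ℝ → J1 n → J1 n}
    (hΦH : IsConfinedFlow (contactField H) K (interior U) T ΦH) {ε : ℝ} (hε : 0 < ε) :
    ∃ N, ∃ G ∈ polyHam n N, cNorm (r + 1) U (fun z => H z - G z) < ENNReal.ofReal ε ∧
      ∃ ΦG, IsConfinedFlow (contactField G) K U T ΦG := by
  obtain ⟨H', V, L, hV, hUV, hHH', hH', hHs, hL⟩ := exists_truncation hU hH
  have hXs : HasCompactSupport (contactField H') := hasCompactSupport_contactField hHs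
  obtain ⟨M, hM⟩ := hXs.exists_bound_of_continuous hL.continuous
  obtain ⟨Φ, hΦ⟩ := exists_isGlobalFlow hL hM
  have hXV : EqOn (contactField H') (contactField H) V := fun z hz =>
    contactField_congr (hHH'.eventuallyEq_of_mem (hV.mem_nhds hz))
  have hmem : ∀ z ∈ K, ∀ t ∈ Icc 0 T, Φ t z ∈ interior U := fun z hz t ht => by
    rw [← (hΦH.eventually_eq hV (interior_subset.trans hUV) hΦ hL hXV hz).self_of_nhds t ht]
    exact hΦH.mem z hz t ht
  obtain ⟨η, hη, hconf⟩ := exists_isConfinedFlow_of_close hL hXs hΦ hK hU hmem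
  obtain ⟨ρ, hρ⟩ := hU.isBounded.exists_norm_le
  obtain ⟨C, hC, hest⟩ := exists_contactField_estimate n r ρ
  set ε' : ℝ := min (ε / 2) (η / C) with hε'_def
  have hε' : 0 < ε' := lt_min (by positivity) (by positivity)
  obtain ⟨N, G, hG, happ⟩ := exists_polyHam_approx (m := r + 1) (by exact_mod_cast hH') hHs hU hε'
  have hGs := contDiff_of_mem_polyHam hG
  refine ⟨N, G, hG, ?_, hconf _ ((contDiff_infty_contactField hGs).of_le (by norm_cast))
    fun z hz => ?_⟩
  · refine (cNorm_le_ofReal (c := ε / 2) fun i hi z hz => ?_).trans_lt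
      ((ENNReal.ofReal_lt_ofReal_iff hε).2 (by linarith))
    have e : (fun z => H z - G z) =ᶠ[𝓝 z] fun z => H' z - G z := by
      filter_upwards [hV.mem_nhds (hUV hz)] with y hy
      rw [hHH' hy]
    have h1 : ContDiffAt ℝ i H' z := (hH'.of_le (by exact_mod_cast hi)).contDiffAt
    have h2 : ContDiffAt ℝ i G z := (hGs.of_le (by exact_mod_cast le_top)).contDiffAt
    rw [(e.iteratedFDeriv ℝ i).eq_of_nhds, fun_iteratedFDeriv_sub_apply h1 h2]
    exact (happ i hi z hz).trans (min_le_left _ _)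
  -- At a common base point the term with `‖y - y'‖` vanishes, so any bound for the derivatives of
  -- `G` will do.
  · have h1 := hest H' G hH' (hGs.of_le (by exact_mod_cast le_top)) z z ε'
      (∑ i ∈ Finset.range (r + 2), ‖iteratedFDeriv ℝ i G z‖) (hρ z hz)
      (fun i hi => happ i hi z hz) (fun i hi => Finset.single_le_sum
        (f := fun i => ‖iteratedFDeriv ℝ i G z‖) (fun j _ => norm_nonneg _)
        (Finset.mem_range.2 (by omega))) 0 (Nat.zero_le r)
    simp only [sub_self, norm_zero, mul_zero, add_zero] at h1
    have h2 : ‖contactField G z - contactField H' z‖ ≤ C * ε' := by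
      rw [norm_sub_rev]
      simpa only [iteratedFDeriv_zero_eq_comp, Function.comp_apply, ← map_sub,
        LinearIsometryEquiv.norm_map] using h1
    refine h2.trans ?_
    calc C * ε' ≤ C * (η / C) := by
          gcongr
          exact min_le_right _ _
      _ = η := by field_simp

end J1

/-! ### The main theorem -/

open J1

theorem mainTheorem2 (n : ℕ) :
    -- every polynomial-in-`p` Hamiltonian has a depth-one representation
    (∀ N : ℕ, ∀ G ∈ polyHam n N, ∃ R : DepthOne n, R.ham = G) ∧
    -- for each representation `R` and each order `p` there is a composition scheme
    ∃ scheme : DepthOne n → ℕ → List (Factor n),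
      (∀ R p, ∀ f ∈ scheme R p, f.gen ∈ R.generators ∧ 0 < f.expo) ∧
      ∀ (r : ℕ) (U : Set (J1 n)) (T : ℝ), IsCompact U → 0 < T →
        (∃ (Capprox : (J1 n → ℝ) → ℝ≥0 → ℝ) (δ : (J1 n → ℝ) → ℝ → ℝ),
          (∀ H B, 0 < Capprox H B) ∧ (∀ H ε, 0 < δ H ε) ∧
          ∀ (N : ℕ) (G : J1 n → ℝ) (R : DepthOne n) (p : ℕ), G ∈ polyHam n N → R.ham = G →
            ∃ (Csplit h₀ : ℝ) (W : Set (J1 n)) (Ψ : ℝ → J1 n → J1 n),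
              0 < Csplit ∧ U ⊆ W ∧ IsOneStepMap (scheme R p) h₀ W Ψ ∧
              ∀ (K : Set (J1 n)) (ΦG : ℝ → J1 n → J1 n), IsCompact K → K ⊆ U →
                IsConfinedFlow (contactField G) K U T ΦG →
                -- the splitting error
                (∀ t ∈ Icc 0 T, ∀ z ∈ K, ContDiffAt ℝ r (ΦG t) z) ∧
                (∀ h, 0 < h → h < h₀ → ∀ k : ℕ, k * h ≤ T →
                  (∀ z ∈ K, (Ψ h)^[k] z ∈ W) ∧
                  cNorm r K (fun z => ΦG (k * h) z - (Ψ h)^[k] z)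
                    ≤ ENNReal.ofReal (Csplit * h ^ p)) ∧
                ∀ (H : J1 n → ℝ) (ΦH : ℝ → J1 n → J1 n), RegularNear r U H →
                  IsConfinedFlow (contactField H) K U T ΦH →
                  (∀ t ∈ Icc 0 T, ∀ z ∈ K, ContDiffAt ℝ r (ΦH t) z) ∧
                  -- the total error
                  (∀ B : ℝ≥0, cNorm (r + 1) U (fun z => H z - G z) ≤ B →
                    (LipschitzOnWith B (iteratedFDeriv ℝ (r + 1) H) U ∨
                      LipschitzOnWith B (iteratedFDeriv ℝ (r + 1) G) U) →
                    ∀ h, 0 < h → h < h₀ → ∀ k : ℕ, k * h ≤ T →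
                      cNorm r K (fun z => ΦH (k * h) z - (Ψ h)^[k] z)
                        ≤ ENNReal.ofReal (Capprox H B) * cNorm (r + 1) U (fun z => H z - G z)
                          + ENNReal.ofReal (Csplit * h ^ p)) ∧
                  -- sufficiently good surrogates and small steps reach any accuracy
                  (∀ ε : ℝ, 0 < ε →
                    cNorm (r + 1) U (fun z => H z - G z) < ENNReal.ofReal (δ H ε) →
                    ∃ h₁, 0 < h₁ ∧ h₁ ≤ h₀ ∧ ∀ h, 0 < h → h < h₁ → ∀ k : ℕ, k * h ≤ T →
                      cNorm r K (fun z => ΦH (k * h) z - (Ψ h)^[k] z) < ENNReal.ofReal ε)) ∧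
        -- such surrogates exist if the trajectories of `H` remain in the interior of `U`
        (∀ (H : J1 n → ℝ) (K : Set (J1 n)) (ΦH : ℝ → J1 n → J1 n), RegularNear r U H →
          IsCompact K → K ⊆ U → IsConfinedFlow (contactField H) K (interior U) T ΦH →
          ∀ (ε : ℝ) (p : ℕ), 0 < ε →
            ∃ (N : ℕ) (G : J1 n → ℝ) (ΦG : ℝ → J1 n → J1 n) (R : DepthOne n)
              (h₀ : ℝ) (W : Set (J1 n)) (Ψ : ℝ → J1 n → J1 n),
              G ∈ polyHam n N ∧ cNorm (r + 1) U (fun z => H z - G z) < ENNReal.ofReal ε ∧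
              IsConfinedFlow (contactField G) K U T ΦG ∧ R.ham = G ∧
              U ⊆ W ∧ IsOneStepMap (scheme R p) h₀ W Ψ ∧
              ∀ h, 0 < h → h < h₀ → ∀ k : ℕ, k * h ≤ T →
                (∀ z ∈ K, (Ψ h)^[k] z ∈ W) ∧
                cNorm r K (fun z => ΦH (k * h) z - (Ψ h)^[k] z) < ENNReal.ofReal ε) := by
  refine ⟨fun N G hG => exists_depthOne hG, fun R p => R.scheme p, fun R p f hf =>
    R.mem_scheme hf, fun r U T hU _ => ⟨?_, ?_⟩⟩
  -- The constants are functions of `H` chosen before the surrogate, the scheme and `K`; irregular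
  -- Hamiltonians receive arbitrary values.
  · have hdata : ∀ H : J1 n → ℝ, ∃ Capp δ Φ, (∀ B, 0 < Capp B) ∧ (∀ ε, 0 < δ ε) ∧
        (RegularNear r U H → IsSurrogateEstimate r U T H Capp δ Φ) := by
      intro H
      by_cases hH : RegularNear r U H
      · obtain ⟨Capp, δ, Φ, h1, h2, h3⟩ := exists_isSurrogateEstimate (T := T) hU hH
        exact ⟨Capp, δ, Φ, h1, h2, fun _ => h3⟩
      · exact ⟨fun _ => 1, fun _ => 1, fun _ => id, fun _ => one_pos, fun _ => one_pos,
          fun h => absurd h hH⟩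
    choose Capp δ Φ hCapp hδ hest using hdata
    refine ⟨Capp, fun H ε => δ H (ε / 2), hCapp, fun H ε => hδ H _, fun N G R p hG hR => ?_⟩
    obtain ⟨Csplit, h₀, W, Ψ, hC, hUW, hstep, herr⟩ := exists_total_error (r := r) (T := T) hU p hG hR
    refine ⟨Csplit, h₀, W, Ψ, hC, hUW, hstep, fun K ΦG _ _ hΦG => ?_⟩
    obtain ⟨h1, h2, h3⟩ := herr K ΦG hΦG
    exact ⟨h1, h2, fun H ΦH hH hΦH => h3 H (Capp H) (δ H) (Φ H) ΦH (hCapp H) (hest H hH) hΦH⟩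
  · intro H K ΦH hH hK _ hΦH ε p hε
    obtain ⟨Capp, δ, Φ, hCapp, hδ, hest⟩ := exists_isSurrogateEstimate (T := T) hU hH
    -- The tolerance `δ (ε / 2)` depends on `H` only, so the surrogate can be chosen to meet it
    -- together with `ε`.
    obtain ⟨N, G, hG, hclose, ΦG, hΦG⟩ := exists_confined_surrogate hU hK hH hΦH
      (lt_min hε (hδ (ε / 2)))
    obtain ⟨R, hR⟩ := exists_depthOne hG
    obtain ⟨Csplit, h₀, W, Ψ, hC, hUW, hstep, herr⟩ := exists_total_error (r := r) (T := T) hU p hG hR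
    obtain ⟨-, hW, herr⟩ := herr K ΦG hΦG
    obtain ⟨-, -, herr⟩ := herr H Capp δ Φ ΦH hCapp hest
      ⟨hΦH.flow, fun z hz t ht => interior_subset (hΦH.mem z hz t ht)⟩
    obtain ⟨h₁, hh₁, hh₁₀, herr⟩ := herr ε hε
      (hclose.trans_le (ENNReal.ofReal_le_ofReal (min_le_right _ _)))
    refine ⟨N, G, ΦG, R, h₁, W, Ψ, hG, hclose.trans_le (ENNReal.ofReal_le_ofReal (min_le_left _ _)),
      hΦG, hR, hUW, ⟨hh₁, hstep.isOpen, fun h h0 hh => hstep.realizes h h0 (hh.trans_le hh₁₀),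
        fun h h0 hh => hstep.contact h h0 (hh.trans_le hh₁₀)⟩, fun h h0 hh k hk =>
        ⟨(hW h h0 (hh.trans_le hh₁₀) k hk).1, herr h h0 hh k hk⟩⟩
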